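/- Let $\Omega=(0,1)$, $V=H^1_0(\Omega)$, $Q=BV(\Omega)$, and write $(\cdot,\cdot)$ for the $L^2(\Omega)$ inner product. Let $\alpha>0$, $u_d\in L^\infty(\Omega)$, $a\in C^{0,1}([0,1])$ with $a\ge\nu$ on $[0,1]$ for a constant $\nu>0$, and $d_0\in L^\infty(\Omega)$ with $d_0\ge 0$ a.e. For $v,w\in V$ set $\mathfrak a(v,w)=(av',w')+(d_0v,w)$, and for $u\in V$, $q\in Q$ set $J(u,q)=\frac12\|u-u_d\|_{L^2(\Omega)}^2+\alpha\|q'\|_{\mathcal M(\Omega)}$, where $\|q'\|_{\mathcal M(\Omega)}$ is the total variation norm of the distributional derivative $q'$ of $q$. Let $\bar q\in Q$ with state $\bar u\in V$ be optimal for $$\min_{(u,q)\in V\times Q}J(u,q)\quad\text{s.t.}\quad \mathfrak a(u,w)=(q,w)\ \ \forall w\in V,$$ let $\bar z\in V$ be the adjoint state, $\mathfrak a(w,\bar z)=(w,\bar u-u_d)$ for all $w\in V$, and let $\bar\Phi(x)=\int_0^x\bar z(s)\,ds$. Assume that the set $\{x\in\Omega:\ |\bar\Phi(x)|=\alpha\}$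 is finite, with distinct elements $\bar x^1,\dots,\bar x^m$ (where $m\ge0$), and that $\bar z'(\bar x^i)\ne0$ for $i=1,\dots,m$. For a mesh $0=x_0<x_1<\dots<x_l=1$ with $l>1$, let $h=\max_{1\le i\le l}(x_i-x_{i-1})$, and let $V_h\subset V$ be the space of continuous functions on $[0,1]$ that vanish at $0$ and $1$ and are affine on each $(x_{i-1},x_i)$. In the variational discretization, $V$ is replaced by $V_h$ and the control space $Q$ is kept: let $\bar q_h\in Q$ with state $\bar u_h\in V_h$ be optimal for $$\min_{(u_h,q)\in V_h\times Q}J(u_h,q)\quad\text{s.t.}\quad \mathfrak a(u_h,w_h)=(q,w_h)\ \ \forall w_h\in V_h,$$ and let $\bar z_h\in V_h$ be the discrete adjoint state, $\mathfrak a(w_h,\bar z_h)=(w_h,\bar u_h-u_d)$ for all $w_h\in V_h$. Then there are $R,C,h_0>0$ such that the balls $B_R(\bar x^i)$, $1\le i\le m$, are contained in $\Omega$ and pairwise disjoint, there are real numbers $\bar a,\bar c^1,\dots,\bar c^m$ with $$\bar q=\bar a+\sum_{i=1}^m\bar c^i\,1_{(\bar x^i,1)}\quad\text{a.e. in }\Omega,$$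 and for every mesh with $h\le h_0$ the following holds. For each $i$ the function $\bar z_h$ has exactly one root $\bar x_h^i$ in $B_R(\bar x^i)$; there are real numbers $\bar a_h,\bar c_h^1,\dots,\bar c_h^m$ with $$\bar q_h=\bar a_h+\sum_{i=1}^m\bar c_h^i\,1_{(\bar x_h^i,1)}\quad\text{a.e. in }\Omega;$$ and $$\sum_{i=1}^m|\bar x^i-\bar x_h^i|\le Ch^2,\qquad \sum_{i=1}^m|\bar c^i-\bar c_h^i|\le Ch^2,\qquad |\bar a-\bar a_h|\le Ch^2,$$ $$\|\bar q-\bar q_h\|_{L^1(\Omega)}\le Ch^2,\qquad \|\bar z-\bar z_h\|_{L^\infty(\Omega)}\le Ch^2.$$ -/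

import Mathlib

open MeasureTheory

namespace BVControl

noncomputable section

/-- The spatial domain `Ω = (0, 1)`. -/
abbrev Omega : Set ℝ := Set.Ioo (0 : ℝ) 1

/-- Lebesgue measure on `Ω`. -/
abbrev volOmega : Measure ℝ := (volume : Measure ℝ).restrict Omega

/-- Test functions: `φ ∈ C_c^∞(Ω)`. -/
structure IsTest (φ : ℝ → ℝ) : Prop where
  smooth : ContDiff ℝ (⊤ : ℕ∞) φ
  compact : HasCompactSupport φ
  support_subset : tsupport φ ⊆ Omega

/-- `g` is the weak derivative of `v` on `Ω` (both are meant to be integrable on `Ω`). -/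
def HasWeakDeriv (v g : ℝ → ℝ) : Prop :=
  ∀ φ : ℝ → ℝ, IsTest φ →
    ∫ x in Omega, v x * deriv φ x = - ∫ x in Omega, g x * φ x

/-- `v ∈ V = H¹₀(Ω)` with weak derivative `dv`: `v` and `dv` are square integrable, and `v` is the
continuous representative on `[0, 1]`, which vanishes at both end points. -/
structure MemV (v dv : ℝ → ℝ) : Prop where
  continuousOn : ContinuousOn v (Set.Icc 0 1)
  zero_left : v 0 = 0
  zero_right : v 1 = 0
  memLp : MemLp v 2 volOmega
  memLp_deriv : MemLp dv 2 volOmega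
  weakDeriv : HasWeakDeriv v dv

/-- The integral of a function against a finite signed measure. -/
def integralSigned (φ : ℝ → ℝ) (μ : SignedMeasure ℝ) : ℝ :=
  (∫ x, φ x ∂μ.toJordanDecomposition.posPart) - ∫ x, φ x ∂μ.toJordanDecomposition.negPart

/-- `q ∈ Q = BV(Ω)` with `q' = μ`: the function `q` is in `L¹(Ω)`, and its distributional
derivative on `Ω` is the finite signed Radon measure `μ` on `Ω` (a signed Borel measure on `ℝ`
that does not charge the complement of `Ω`). The measure `μ` is determined by `q`. -/
structure MemBV (q : ℝ → ℝ) (μ : SignedMeasure ℝ) : Prop where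
  memLp : MemLp q 1 volOmega
  concentrated : μ.totalVariation Omegaᶜ = 0
  distribDeriv : ∀ φ : ℝ → ℝ, IsTest φ →
    ∫ x in Omega, q x * deriv φ x = - integralSigned φ μ

/-- The total variation norm `‖μ‖_{M(Ω)}` of a measure as in `MemBV`. -/
def measNorm (μ : SignedMeasure ℝ) : ℝ := (μ.totalVariation Set.univ).toReal

/-- The bilinear form `𝔞(v, w) = (a v', w') + (d₀ v, w)`; `dv`, `dw` are the weak derivatives. -/
def bilin (a d₀ v dv w dw : ℝ → ℝ) : ℝ :=
  (∫ x in Omega, a x * dv x * dw x) + ∫ x in Omega, d₀ x * v x * w x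

/-- The data of the control problem: `α > 0`, `u_d ∈ L^∞(Ω)`, `a ∈ C^{0,1}([0,1])` with
`a ≥ ν > 0`, and `0 ≤ d₀ ∈ L^∞(Ω)`. -/
structure IsData (α : ℝ) (a d₀ u_d : ℝ → ℝ) : Prop where
  alpha_pos : 0 < α
  desired : MemLp u_d ⊤ volOmega
  lipschitz : ∃ K : NNReal, LipschitzOnWith K a (Set.Icc 0 1)
  elliptic : ∃ ν : ℝ, 0 < ν ∧ ∀ x ∈ Set.Icc (0 : ℝ) 1, ν ≤ a x
  bounded : MemLp d₀ ⊤ volOmega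
  nonneg : ∀ᵐ x ∂volOmega, 0 ≤ d₀ x

/-- The cost `J(u, q) = ½ ‖u - u_d‖²_{L²} + α ‖q'‖_{M(Ω)}`, where `μ = q'`. -/
def cost (α : ℝ) (u_d u : ℝ → ℝ) (μ : SignedMeasure ℝ) : ℝ :=
  1 / 2 * (∫ x in Omega, (u x - u_d x) ^ 2) + α * measNorm μ

/- In the next three definitions `W` is the state space, given as a relation between a function
and its weak derivative: `MemV` for the continuous and `MemVh M` for the discretized problem. -/

/-- `u ∈ W` and `𝔞(u, w) = (q, w)` for all `w ∈ W`. -/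
def IsState (W : (ℝ → ℝ) → (ℝ → ℝ) → Prop) (a d₀ q u : ℝ → ℝ) : Prop :=
  ∃ du, W u du ∧ ∀ w dw, W w dw → bilin a d₀ u du w dw = ∫ x in Omega, q x * w x

/-- `z ∈ W` and `𝔞(w, z) = (w, u - u_d)` for all `w ∈ W`. -/
def IsAdjoint (W : (ℝ → ℝ) → (ℝ → ℝ) → Prop) (a d₀ u_d u z : ℝ → ℝ) : Prop :=
  ∃ dz, W z dz ∧ ∀ w dw, W w dw →
    bilin a d₀ w dw z dz = ∫ x in Omega, w x * (u x - u_d x)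

/-- `q` is an optimal control, with associated state `u`, of the problem of minimizing `J(u, q)`
over `(u, q) ∈ W × BV(Ω)` subject to `𝔞(u, w) = (q, w)` for all `w ∈ W`. -/
def IsOptimal (W : (ℝ → ℝ) → (ℝ → ℝ) → Prop) (α : ℝ) (a d₀ u_d q u : ℝ → ℝ) : Prop :=
  ∃ μ, MemBV q μ ∧ IsState W a d₀ q u ∧
    ∀ q₁ μ₁ u₁, MemBV q₁ μ₁ → IsState W a d₀ q₁ u₁ → cost α u_d u μ ≤ cost α u_d u₁ μ₁

/-- A mesh `0 = x₀ < x₁ < ⋯ < x_l = 1` with `l > 1`. -/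
structure Mesh where
  l : ℕ
  one_lt : 1 < l
  node : Fin (l + 1) → ℝ
  strictMono : StrictMono node
  node_zero : node 0 = 0
  node_last : node (Fin.last l) = 1

/-- The mesh width `h`, the maximal length of a subinterval. -/
def Mesh.width (M : Mesh) : ℝ := ⨆ i : Fin M.l, (M.node i.succ - M.node i.castSucc)

/-- `v ∈ V_h` with weak derivative `dv`: `v ∈ V` is continuous on `[0, 1]`, vanishes at the end
points, and is affine on each subinterval of the mesh. -/
def MemVh (M : Mesh) (v dv : ℝ → ℝ) : Prop :=
  MemV v dv ∧ ∀ i : Fin M.l, ∃ b c : ℝ,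
    ∀ x ∈ Set.Ioo (M.node i.castSucc) (M.node i.succ), v x = b + c * x

/-- The multiplier `Φ(x) = ∫₀ˣ z(s) ds`. -/
def multiplier (z : ℝ → ℝ) (x : ℝ) : ℝ := ∫ s in (0 : ℝ)..x, z s

/-- The piecewise constant function `a₀ + ∑ i, cⁱ 1_{(xⁱ, 1)}`. -/
def stepFun {m : ℕ} (a₀ : ℝ) (c x : Fin m → ℝ) (t : ℝ) : ℝ :=
  a₀ + ∑ i, c i * (Set.Ioo (x i) 1).indicator (fun _ => (1 : ℝ)) t

end

end BVControl

/-! In one dimension an `H¹₀` function is the primitive of its derivative, and a BV function is, up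
to a constant, the distribution function of its derivative. The optimality condition then makes the
multiplier `Φ` bounded by `α` in absolute value and forces `q'` to live where `|Φ| = α`
(`IsStationary.ae_abs_primitive_eq`), so a finite extremal set makes `q` a step function. The same
argument applies to the discrete problem, with the multiplier of `z_h`; the only property of the
state space that it uses is `IsStateSpace`.

The rate is driven by one number, the `L²` norm `E` of `e = u_h - ũ`, where `ũ` is the discrete
state of the continuous optimal control `q`. Testing each of the two variational inequalities with
the other control cancels the total variation terms and leaves `E² ≤ C h² ‖q_h - q‖_{L¹} + C h² E`
(`IsData.exists_key_estimate`). The factors `h²` are maximum norm finite element errors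
(`IsData.exists_fe_estimate`). These need no condition on the mesh, because the slopes of discrete
test functions can be prescribed freely up to their mean (`IsData.exists_stability`).

An a priori bound for `q_h` in `L¹` (`IsData.exists_apriori`) first gives `E = O(h)`. Hence `z_h`
and its derivative are uniformly close to those of `z`. Near each extremal point `z` has a simple
zero, so `z_h` has exactly one zero there; elsewhere `|Φ|` stays below `α` by a fixed margin, so the
jumps of `q_h` can only sit at those zeros, at distance `O(h² + E)` from the jumps of `q`
(`exists_roots`).

It remains to compare two step functions whose jumps are close. For a fixed smooth `w` with discrete
Ritz projection `ŵ`, the pairing `(q_h - q, w)` is `(q_h - q, ŵ)` up to `O(h²) ‖q_h - q‖_{L¹}`, and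
`(q_h - q, ŵ) = 𝔞(e, ŵ) = 𝔞(e, w)` is `O(E)` after integration by parts
(`IsData.exists_pairing_estimate`). Finitely many such `w` determine jump heights and constant
(`exists_stepFun_compare`), whence `‖q_h - q‖_{L¹} ≤ C (h² + E)`. Inserted in the quadratic
inequality, this improves `E = O(h)` to `E = O(h²)`, and every error in the theorem is `O(h² + E)`.
-/

namespace BVControl

/-! ### Primitives, test functions and the du Bois-Reymond lemma. -/

noncomputable section

/-- The primitive of `g` that vanishes at `0`. -/
def primitive (g : ℝ → ℝ) (x : ℝ) : ℝ := ∫ s in (0 : ℝ)..x, g s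

instance : IsProbabilityMeasure volOmega := ⟨by simp [volOmega]⟩

theorem integral_omega_eq (f : ℝ → ℝ) : ∫ x in Omega, f x = ∫ x in (0 : ℝ)..1, f x := by
  rw [intervalIntegral.integral_of_le zero_le_one, integral_Ioc_eq_integral_Ioo]

theorem intervalIntegrable_iff_omega (f : ℝ → ℝ) :
    IntervalIntegrable f volume 0 1 ↔ IntegrableOn f Omega := by
  rw [intervalIntegrable_iff_integrableOn_Ioo_of_le zero_le_one]

theorem intervalIntegrable_of_omega {f : ℝ → ℝ} (hf : IntegrableOn f Omega) {x y : ℝ}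
    (hx : x ∈ Set.Icc (0 : ℝ) 1) (hy : y ∈ Set.Icc (0 : ℝ) 1) :
    IntervalIntegrable f volume x y := by
  apply ((intervalIntegrable_iff_omega f).2 hf).mono_set
  rw [Set.uIcc_of_le zero_le_one]
  exact Set.uIcc_subset_Icc hx hy

theorem ae_omega_iff (p : ℝ → Prop) : (∀ᵐ x ∂volOmega, p x) ↔ ∀ᵐ x, x ∈ Omega → p x :=
  ae_restrict_iff' measurableSet_Ioo

theorem ae_Icc_of_ae_omega {p : ℝ → Prop} (h : ∀ᵐ x ∂volOmega, p x) :
    ∀ᵐ x, x ∈ Set.Icc (0 : ℝ) 1 → p x := by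
  rw [ae_omega_iff] at h
  have h₁ : ∀ᵐ x : ℝ, x ≠ 0 := by simp [ae_iff]
  have h₂ : ∀ᵐ x : ℝ, x ≠ 1 := by simp [ae_iff]
  filter_upwards [h, h₁, h₂] with x hx h0 h1 hI
  exact hx ⟨lt_of_le_of_ne hI.1 (Ne.symm h0), lt_of_le_of_ne hI.2 h1⟩

theorem primitive_zero (g : ℝ → ℝ) : primitive g 0 = 0 := by simp [primitive]

theorem primitive_one (g : ℝ → ℝ) : primitive g 1 = ∫ x in Omega, g x :=
  (integral_omega_eq g).symm

theorem primitive_congr {f g : ℝ → ℝ} (h : f =ᵐ[volOmega] g) {x : ℝ}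
    (hx : x ∈ Set.Icc (0 : ℝ) 1) : primitive f x = primitive g x := by
  apply intervalIntegral.integral_congr_ae
  filter_upwards [ae_Icc_of_ae_omega h] with y hy hm
  rw [Set.uIoc_of_le hx.1] at hm
  exact hy ⟨hm.1.le, hm.2.trans hx.2⟩

theorem primitive_sub_primitive {g : ℝ → ℝ} (hg : IntegrableOn g Omega) {x y : ℝ}
    (hx : x ∈ Set.Icc (0 : ℝ) 1) (hy : y ∈ Set.Icc (0 : ℝ) 1) :
    primitive g y - primitive g x = ∫ s in x..y, g s := by
  have h0 : (0 : ℝ) ∈ Set.Icc (0 : ℝ) 1 := by simp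
  exact intervalIntegral.integral_interval_sub_left
    (intervalIntegrable_of_omega hg h0 hy) (intervalIntegrable_of_omega hg h0 hx)

theorem primitive_ac {g : ℝ → ℝ} (hg : IntegrableOn g Omega) :
    AbsolutelyContinuousOnInterval (primitive g) 0 1 :=
  ((intervalIntegrable_iff_omega g).2 hg).absolutelyContinuousOnInterval_intervalIntegral
    (by simp)

theorem primitive_continuousOn {g : ℝ → ℝ} (hg : IntegrableOn g Omega) :
    ContinuousOn (primitive g) (Set.Icc 0 1) := by
  simpa using (primitive_ac hg).continuousOn

theorem integrableOn_mul_continuousOn {f g : ℝ → ℝ} (hf : IntegrableOn f Omega)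
    (hg : ContinuousOn g (Set.Icc 0 1)) : IntegrableOn (fun x => f x * g x) Omega := by
  rw [← intervalIntegrable_iff_omega] at hf ⊢
  exact hf.mul_continuousOn (by simpa using hg)

theorem continuousOn_integrableOn {g : ℝ → ℝ} (hg : ContinuousOn g (Set.Icc 0 1)) :
    IntegrableOn g Omega :=
  (hg.integrableOn_Icc).mono_set Set.Ioo_subset_Icc_self

theorem primitive_ae_deriv {g : ℝ → ℝ} (hg : IntegrableOn g Omega) :
    deriv (primitive g) =ᵐ[volOmega] g := by
  have := ((intervalIntegrable_iff_omega g).2 hg).ae_hasDerivAt_integral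
  change ∀ᵐ x ∂volOmega, _
  rw [ae_omega_iff]
  filter_upwards [this] with x hx hm
  have h01 : Set.uIcc (0 : ℝ) 1 = Set.Icc 0 1 := Set.uIcc_of_le zero_le_one
  exact (hx (by rw [h01]; exact Set.Ioo_subset_Icc_self hm) 0 (by simp)).deriv

/-- Integration by parts for two absolutely continuous functions. -/
theorem ibp_omega {f g : ℝ → ℝ} (hf : IntegrableOn f Omega) (hg : IntegrableOn g Omega) :
    ∫ x in Omega, primitive f x * g x =
      primitive f 1 * primitive g 1 - ∫ x in Omega, f x * primitive g x := by
  have h := (primitive_ac hf).integral_mul_deriv_eq_deriv_mul (primitive_ac hg)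
  rw [← integral_omega_eq, ← integral_omega_eq] at h
  simp only [primitive_zero, mul_zero, sub_zero] at h
  have e1 : ∫ x in Omega, primitive f x * g x =
      ∫ x in Omega, primitive f x * deriv (primitive g) x := by
    apply integral_congr_ae
    filter_upwards [primitive_ae_deriv hg] with x hx
    rw [hx]
  have e2 : ∫ x in Omega, f x * primitive g x =
      ∫ x in Omega, deriv (primitive f) x * primitive g x := by
    apply integral_congr_ae
    filter_upwards [primitive_ae_deriv hf] with x hx
    rw [hx]
  rw [e1, e2, h]

namespace IsTest

variable {φ : ℝ → ℝ}

theorem eq_zero (h : IsTest φ) {x : ℝ} (hx : x ∉ Omega) : φ x = 0 := by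
  by_contra hne
  exact hx (h.support_subset (subset_tsupport φ hne))

theorem deriv_continuous (h : IsTest φ) : Continuous (deriv φ) :=
  h.smooth.continuous_deriv (by simp)

theorem differentiable (h : IsTest φ) : Differentiable ℝ φ :=
  h.smooth.differentiable (by simp)

theorem primitive_deriv (h : IsTest φ) (x : ℝ) : primitive (deriv φ) x = φ x := by
  unfold primitive
  rw [intervalIntegral.integral_deriv_eq_sub (fun x _ => h.differentiable x)
    (h.deriv_continuous.intervalIntegrable _ _), h.eq_zero (x := 0) (by simp), sub_zero]

theorem deriv_integrable (h : IsTest φ) : IntegrableOn (deriv φ) Omega :=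
  continuousOn_integrableOn h.deriv_continuous.continuousOn

theorem integrable (h : IsTest φ) : IntegrableOn φ Omega :=
  continuousOn_integrableOn h.smooth.continuous.continuousOn

theorem mk_deriv (h : IsTest φ) : IsTest (deriv φ) where
  smooth := by
    have := h.smooth
    exact ((contDiff_infty_iff_deriv (𝕜 := ℝ)).1 this).2
  compact := h.compact.deriv
  support_subset := (tsupport_deriv_subset (𝕜 := ℝ)).trans h.support_subset

end IsTest

/-- A smooth bump in `Ω`. -/
theorem exists_isTest_bump {x r : ℝ} (hr : 0 < r) (h : Metric.closedBall x r ⊆ Omega) :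
    ∃ φ : ℝ → ℝ, IsTest φ ∧ φ x = 1 ∧ (∀ y, 0 ≤ φ y) ∧ ∀ y, y ∉ Metric.ball x r → φ y = 0 := by
  let b : ContDiffBump x := ⟨r / 2, r, by linarith, by linarith⟩
  refine ⟨b, ⟨b.contDiff, b.hasCompactSupport, ?_⟩, ?_, fun y => b.nonneg, ?_⟩
  · rw [b.tsupport_eq]; exact h
  · exact b.one_of_mem_closedBall (by simp [b]; linarith)
  · intro y hy
    have := b.support_eq
    by_contra hne
    exact hy (this ▸ hne)

theorem exists_isTest_integral_one : ∃ χ : ℝ → ℝ, IsTest χ ∧ ∫ x in Omega, χ x = 1 := by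
  let b : ContDiffBump (1 / 2 : ℝ) := ⟨1 / 8, 1 / 4, by norm_num, by norm_num⟩
  have ht : tsupport (b.normed volume) ⊆ Omega := by
    rw [b.tsupport_normed_eq]
    intro x hx
    rw [Metric.mem_closedBall, Real.dist_eq, abs_le] at hx
    have h1 : b.rOut = 1 / 4 := rfl
    rw [h1] at hx
    constructor <;> linarith [hx.1, hx.2]
  refine ⟨b.normed volume, ⟨b.contDiff_normed, b.hasCompactSupport_normed, ht⟩, ?_⟩
  rw [setIntegral_eq_integral_of_forall_compl_eq_zero]
  · exact b.integral_normed
  · intro x hx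
    by_contra hne
    exact hx (ht (subset_tsupport _ hne))

/-- A test function with vanishing mean has a test function as a primitive. -/
theorem isTest_primitive {ψ : ℝ → ℝ} (hψ : IsTest ψ) (h0 : ∫ x in Omega, ψ x = 0) :
    IsTest (primitive ψ) ∧ deriv (primitive ψ) = ψ := by
  have hc : Continuous ψ := hψ.smooth.continuous
  have hd : deriv (primitive ψ) = ψ := by
    funext x
    exact (hc.integral_hasStrictDerivAt 0 x).hasDerivAt.deriv
  obtain ⟨s, t, hst, hsub⟩ : ∃ s t : ℝ, Set.Icc s t ⊆ Omega ∧ tsupport ψ ⊆ Set.Icc s t := by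
    by_cases hne : (tsupport ψ).Nonempty
    · have hk : IsCompact (tsupport ψ) := hψ.compact
      obtain ⟨s, hs, hs'⟩ := hk.exists_isLeast hne
      obtain ⟨t, ht, ht'⟩ := hk.exists_isGreatest hne
      refine ⟨s, t, fun x hx => ?_, fun x hx => ⟨hs' hx, ht' hx⟩⟩
      exact ⟨(hψ.support_subset hs).1.trans_le hx.1, hx.2.trans_lt (hψ.support_subset ht).2⟩
    · refine ⟨1 / 2, 1 / 2, ?_, by simp [Set.not_nonempty_iff_eq_empty.1 hne]⟩
      intro x hx
      have := le_antisymm hx.2 hx.1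
      subst this
      constructor <;> norm_num
  have hz : ∀ x, x ∉ Set.Icc s t → ψ x = 0 := by
    intro x hx
    by_contra hne
    exact hx (hsub (subset_tsupport _ hne))
  -- To the left of the support nothing has been integrated yet; to the right the whole integral has
  -- been collected, and it is zero.
  have hsupp : Function.support (primitive ψ) ⊆ Set.Icc s t := by
    intro x hx
    by_contra hns
    apply hx
    rw [Set.mem_Icc, not_and_or, not_le, not_le] at hns
    have hω : ∀ y, y ∉ Omega → ψ y = 0 := fun y hy => hψ.eq_zero hy
    rcases hns with hxs | hxt
    · unfold primitive
      rw [intervalIntegral.integral_congr (g := fun _ => 0)]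
      · simp
      · intro y hy
        apply show ∀ y, y ≤ max 0 x → ψ y = 0 from ?_
        · exact hy.2
        · intro y hy
          rcases le_max_iff.1 hy with h | h
          · exact hω y (fun hm => absurd hm.1 (not_lt.2 h))
          · exact hz y (fun hm => absurd hm.1 (not_le.2 (h.trans_lt hxs)))
    · have h1 : primitive ψ x = primitive ψ 1 + ∫ y in (1 : ℝ)..x, ψ y :=
        (intervalIntegral.integral_add_adjacent_intervals (hc.intervalIntegrable _ _)
          (hc.intervalIntegrable _ _)).symm
      rw [h1, primitive_one, h0, zero_add, intervalIntegral.integral_congr (g := fun _ => 0)]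
      · simp
      · intro y hy
        have : min 1 x ≤ y := hy.1
        rcases min_le_iff.1 this with h | h
        · exact hω y (fun hm => absurd hm.2 (not_lt.2 h))
        · exact hz y (fun hm => absurd hm.2 (not_le.2 (hxt.trans_le h)))
  have hts : tsupport (primitive ψ) ⊆ Set.Icc s t := closure_minimal hsupp isClosed_Icc
  refine ⟨⟨?_, ?_, hts.trans hst⟩, hd⟩
  · rw [contDiff_infty_iff_deriv, hd]
    refine ⟨fun x => ?_, hψ.smooth⟩
    exact (hc.integral_hasStrictDerivAt 0 x).hasDerivAt.differentiableAt
  · exact isCompact_Icc.of_isClosed_subset (isClosed_tsupport _) hts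

/-- The lemma of du Bois-Reymond. -/
theorem ae_const_of_integral_deriv_eq_zero {f : ℝ → ℝ} (hf : IntegrableOn f Omega)
    (h : ∀ φ, IsTest φ → ∫ x in Omega, f x * deriv φ x = 0) :
    ∃ c, ∀ᵐ x ∂volOmega, f x = c := by
  obtain ⟨χ, hχ, hχ1⟩ := exists_isTest_integral_one
  set c := ∫ x in Omega, f x * χ x with hc
  refine ⟨c, ?_⟩
  have hfc : IntegrableOn (fun x => f x - c) Omega := hf.sub (integrable_const c)
  have key := isOpen_Ioo.ae_eq_zero_of_integral_contDiff_smul_eq_zero (μ := volume)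
    (U := Omega) (f := fun x => f x - c) hfc.locallyIntegrableOn ?_
  · rw [ae_omega_iff]
    filter_upwards [key] with x hx hm
    linarith [hx hm]
  · intro ψ h1 h2 h3
    have hψ : IsTest ψ := ⟨h1, h2, h3⟩
    set k := ∫ x in Omega, ψ x with hk
    -- Subtracting the multiple of `χ` that carries the mean of `ψ` leaves a derivative of a test
    -- function, to which the hypothesis applies.
    have ht : IsTest (fun x => ψ x - k * χ x) := by
      refine ⟨h1.sub (contDiff_const.mul hχ.smooth), ?_, ?_⟩
      · exact h2.sub (hχ.compact.mul_left)
      · refine (tsupport_sub ψ (fun x => k * χ x)).trans (Set.union_subset h3 ?_)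
        exact (tsupport_mul_subset_right (f := fun _ => k)).trans hχ.support_subset
    have hfψ : IntegrableOn (fun x => f x * ψ x) Omega :=
      integrableOn_mul_continuousOn hf h1.continuous.continuousOn
    have hfχ : IntegrableOn (fun x => f x * χ x) Omega :=
      integrableOn_mul_continuousOn hf hχ.smooth.continuous.continuousOn
    have h0 : ∫ x in Omega, (ψ x - k * χ x) = 0 := by
      rw [integral_sub hψ.integrable (hχ.integrable.const_mul k), integral_const_mul, hχ1]
      simp [hk]
    obtain ⟨hp, hd⟩ := isTest_primitive ht h0
    have := h _ hp
    rw [hd] at this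
    have e1 : ∫ x in Omega, f x * (ψ x - k * χ x) = (∫ x in Omega, f x * ψ x) - k * c := by
      rw [hc, ← integral_const_mul, ← integral_sub hfψ (hfχ.const_mul k)]
      congr 1; ext x; ring
    rw [← setIntegral_eq_integral_of_forall_compl_eq_zero (s := Omega)
      (fun x hx => by simp [hψ.eq_zero hx])]
    have e2 : ∫ x in Omega, ψ x • (f x - c) = (∫ x in Omega, f x * ψ x) - c * k := by
      rw [hk, ← integral_const_mul, ← integral_sub hfψ (hψ.integrable.const_mul c)]
      congr 1; ext x; simp; ring
    rw [e2]; linarith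

theorem MemLp.integrableOn_omega {g : ℝ → ℝ} (hg : MemLp g 2 volOmega) : IntegrableOn g Omega :=
  hg.integrable (by norm_num)

/-! ### The space `H¹₀` as the primitives of mean-zero `L²` functions. -/

namespace MemV

variable {v dv : ℝ → ℝ}

theorem integrable_deriv (h : MemV v dv) : IntegrableOn dv Omega :=
  MemLp.integrableOn_omega h.memLp_deriv

/-- Both functions have weak derivative `dv`, so they differ by a constant almost everywhere, by
continuity everywhere, and they agree at `0`. Together with the converse `memV_of_eqOn_primitive`
this identifies `V` with a closed subspace of `L²`. -/
theorem eqOn_primitive (h : MemV v dv) : Set.EqOn v (primitive dv) (Set.Icc 0 1) := by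
  have hi := h.integrable_deriv
  obtain ⟨c, hc⟩ := ae_const_of_integral_deriv_eq_zero (f := fun x => v x - primitive dv x)
    ((continuousOn_integrableOn h.continuousOn).sub
      (continuousOn_integrableOn (primitive_continuousOn hi))) (by
    intro φ hφ
    have h1 := h.weakDeriv φ hφ
    have h2 := ibp_omega hi hφ.deriv_integrable
    simp only [hφ.primitive_deriv, hφ.eq_zero (x := 1) (by simp), mul_zero, zero_sub] at h2
    have e : ∫ x in Omega, (v x - primitive dv x) * deriv φ x =
        (∫ x in Omega, v x * deriv φ x) - ∫ x in Omega, primitive dv x * deriv φ x := by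
      rw [← integral_sub]
      · congr 1; ext x; ring
      · exact integrableOn_mul_continuousOn (continuousOn_integrableOn h.continuousOn)
          hφ.deriv_continuous.continuousOn
      · exact integrableOn_mul_continuousOn
          (continuousOn_integrableOn (primitive_continuousOn hi))
          hφ.deriv_continuous.continuousOn
    rw [e, h1, h2, sub_self])
  have hcont : ContinuousOn (fun x => v x - primitive dv x) (Set.Icc 0 1) :=
    h.continuousOn.sub (primitive_continuousOn hi)
  have hEq : Set.EqOn (fun x => v x - primitive dv x) (fun _ => c) (Set.Icc 0 1) := by
    have h1 : (fun x => v x - primitive dv x) =ᵐ[volume.restrict (Set.Icc (0 : ℝ) 1)]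
        (fun _ => c) := by
      rw [Filter.EventuallyEq, ae_restrict_iff' measurableSet_Icc]
      exact ae_Icc_of_ae_omega hc
    exact Measure.eqOn_Icc_of_ae_eq volume (by norm_num) h1 hcont continuousOn_const
  have h0 : c = 0 := by
    have := hEq (x := 0) (by simp)
    simp only [h.zero_left, primitive_zero, sub_zero] at this
    exact this.symm
  intro x hx
  have := hEq hx
  simp only [h0] at this
  linarith

theorem primitive_deriv_one (h : MemV v dv) : primitive dv 1 = 0 := by
  rw [← h.eqOn_primitive (by simp), h.zero_right]

theorem integral_deriv (h : MemV v dv) : ∫ x in Omega, dv x = 0 := by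
  rw [← primitive_one, h.primitive_deriv_one]

end MemV

theorem memLp_of_continuousOn {v : ℝ → ℝ} (hv : ContinuousOn v (Set.Icc 0 1)) (p : ENNReal) :
    MemLp v p volOmega := by
  obtain ⟨C, hC⟩ := isCompact_Icc.exists_bound_of_continuousOn hv
  refine MemLp.of_bound ?_ C ?_
  · exact (continuousOn_integrableOn hv).aestronglyMeasurable
  · rw [ae_omega_iff]
    exact Filter.Eventually.of_forall fun x hx => hC x (Set.Ioo_subset_Icc_self hx)

theorem memV_of_eqOn_primitive {v g : ℝ → ℝ} (hg : MemLp g 2 volOmega)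
    (hv : Set.EqOn v (primitive g) (Set.Icc 0 1)) (h1 : primitive g 1 = 0) : MemV v g := by
  have hi := MemLp.integrableOn_omega hg
  have hc : ContinuousOn v (Set.Icc 0 1) := (primitive_continuousOn hi).congr hv
  refine ⟨hc, ?_, ?_, memLp_of_continuousOn hc 2, hg, ?_⟩
  · rw [hv (by simp), primitive_zero]
  · rw [hv (by simp), h1]
  · intro φ hφ
    have h2 := ibp_omega hi hφ.deriv_integrable
    simp only [hφ.primitive_deriv, hφ.eq_zero (x := 1) (by simp), mul_zero, zero_sub] at h2
    rw [← h2]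
    exact setIntegral_congr_fun measurableSet_Ioo
      fun x hx => by simp only [hv (Set.Ioo_subset_Icc_self hx)]

theorem memV_zero : MemV 0 0 :=
  memV_of_eqOn_primitive MemLp.zero (fun x _ => by simp [primitive]) (by simp [primitive])

theorem primitive_add_smul {f g : ℝ → ℝ} (hf : IntegrableOn f Omega) (hg : IntegrableOn g Omega)
    (t : ℝ) {x : ℝ} (hx : x ∈ Set.Icc (0 : ℝ) 1) :
    primitive (f + t • g) x = primitive f x + t * primitive g x := by
  have h0 : (0 : ℝ) ∈ Set.Icc (0 : ℝ) 1 := by simp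
  unfold primitive
  rw [← intervalIntegral.integral_const_mul, ← intervalIntegral.integral_add
    (intervalIntegrable_of_omega hf h0 hx) ((intervalIntegrable_of_omega hg h0 hx).const_mul t)]
  rfl

theorem MemV.add_smul {v dv w dw : ℝ → ℝ} (hv : MemV v dv) (hw : MemV w dw) (t : ℝ) :
    MemV (v + t • w) (dv + t • dw) := by
  refine memV_of_eqOn_primitive (hv.memLp_deriv.add (hw.memLp_deriv.const_smul t)) ?_ ?_
  · intro x hx
    rw [primitive_add_smul hv.integrable_deriv hw.integrable_deriv t hx]
    simp [hv.eqOn_primitive hx, hw.eqOn_primitive hx]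
  · rw [primitive_add_smul hv.integrable_deriv hw.integrable_deriv t (by simp),
      hv.primitive_deriv_one, hw.primitive_deriv_one]
    simp

theorem memVh_zero (M : Mesh) : MemVh M 0 0 :=
  ⟨memV_zero, fun _ => ⟨0, 0, fun x _ => by simp⟩⟩

theorem MemVh.add_smul {M : Mesh} {v dv w dw : ℝ → ℝ} (hv : MemVh M v dv) (hw : MemVh M w dw)
    (t : ℝ) : MemVh M (v + t • w) (dv + t • dw) := by
  refine ⟨hv.1.add_smul hw.1 t, fun i => ?_⟩
  obtain ⟨b, c, h⟩ := hv.2 i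
  obtain ⟨b', c', h'⟩ := hw.2 i
  refine ⟨b + t * b', c + t * c', fun x hx => ?_⟩
  simp only [Pi.add_apply, Pi.smul_apply, smul_eq_mul, h x hx, h' x hx]
  ring

theorem MemVh.sub {M : Mesh} {v dv w dw : ℝ → ℝ} (hv : MemVh M v dv) (hw : MemVh M w dw) :
    MemVh M (v - w) (dv - dw) := by
  have := hv.add_smul hw (-1)
  simpa [sub_eq_add_neg] using this

end

end BVControl
-- The bilinear form on derivatives, and solvability in `V` and `V_h` by Lax-Milgram.
namespace BVControl

noncomputable section

theorem abs_primitive_le {g : ℝ → ℝ} (hg : IntegrableOn g Omega) {x : ℝ}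
    (hx : x ∈ Set.Icc (0 : ℝ) 1) : |primitive g x| ≤ ∫ s in Omega, |g s| := by
  have h0 : (0 : ℝ) ∈ Set.Icc (0 : ℝ) 1 := by simp
  calc |primitive g x| ≤ ∫ s in (0 : ℝ)..x, |g s| :=
        intervalIntegral.abs_integral_le_integral_abs hx.1
    _ ≤ ∫ s in (0 : ℝ)..1, |g s| := by
        apply intervalIntegral.integral_mono_interval le_rfl hx.1 hx.2
        · exact Filter.Eventually.of_forall fun s => abs_nonneg _
        · exact intervalIntegrable_of_omega hg.abs h0 (by simp)
    _ = _ := (integral_omega_eq _).symm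

/-- The Cauchy-Schwarz inequality on the unit interval, for one function. -/
theorem sq_integral_abs_le {g : ℝ → ℝ} (hg : MemLp g 2 volOmega) :
    (∫ x in Omega, |g x|) ^ 2 ≤ ∫ x in Omega, g x ^ 2 := by
  have hi : IntegrableOn (fun x => |g x|) Omega := (MemLp.integrableOn_omega hg).abs
  have h2 : IntegrableOn (fun x => g x ^ 2) Omega := hg.integrable_sq
  set m := ∫ x in Omega, |g x| with hm
  -- The claim is the nonnegativity of the variance of `|g|`; `Ω` has measure one.
  have h : 0 ≤ ∫ x in Omega, (|g x| - m) ^ 2 := integral_nonneg fun x => sq_nonneg _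
  have e : ∫ x in Omega, (|g x| - m) ^ 2 = (∫ x in Omega, g x ^ 2) - 2 * m * m + m ^ 2 := by
    have : ∀ x, (|g x| - m) ^ 2 = g x ^ 2 - 2 * m * |g x| + m ^ 2 := by
      intro x; rw [sub_sq, sq_abs]; ring
    simp_rw [this]
    have h3 : IntegrableOn (fun x => 2 * m * |g x|) Omega := hi.const_mul _
    have h4 : IntegrableOn (fun x => g x ^ 2 - 2 * m * |g x|) Omega := h2.sub h3
    rw [integral_add h4 (integrable_const _), integral_sub h2 h3, integral_const_mul, ← hm]
    simp
  nlinarith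

theorem MemV.abs_le {v dv : ℝ → ℝ} (h : MemV v dv) {x : ℝ} (hx : x ∈ Set.Icc (0 : ℝ) 1) :
    |v x| ≤ ∫ s in Omega, |dv s| := by
  rw [h.eqOn_primitive hx]; exact abs_primitive_le h.integrable_deriv hx

theorem lp_integral_sq (g : Lp ℝ 2 volOmega) : ∫ x in Omega, g x ^ 2 = ‖g‖ ^ 2 := by
  rw [← real_inner_self_eq_norm_sq, L2.inner_def]
  congr 1; ext x
  simp [sq]

theorem lp_integral_abs_le (g : Lp ℝ 2 volOmega) : ∫ x in Omega, |g x| ≤ ‖g‖ := by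
  have := sq_integral_abs_le (Lp.memLp g)
  rw [lp_integral_sq] at this
  exact (abs_le_of_sq_le_sq' this (norm_nonneg _)).2

theorem lp_integral_abs_mul_le (g h : Lp ℝ 2 volOmega) :
    ∫ x in Omega, |g x| * |h x| ≤ ‖g‖ * ‖h‖ := by
  have := real_inner_le_norm (|g|) (|h|)
  rw [norm_abs_eq_norm, norm_abs_eq_norm, L2.inner_def] at this
  refine le_trans (le_of_eq ?_) this
  apply integral_congr_ae
  filter_upwards [Lp.coeFn_abs g, Lp.coeFn_abs h] with x h1 h2
  simp [h1, h2, mul_comm]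

theorem lp_abs_primitive_le (g : Lp ℝ 2 volOmega) {x : ℝ} (hx : x ∈ Set.Icc (0 : ℝ) 1) :
    |primitive g x| ≤ ‖g‖ :=
  (abs_primitive_le (MemLp.integrableOn_omega (Lp.memLp g)) hx).trans (lp_integral_abs_le g)

theorem lp_primitive_add (g h : Lp ℝ 2 volOmega) {x : ℝ} (hx : x ∈ Set.Icc (0 : ℝ) 1) :
    primitive (g + h : Lp ℝ 2 volOmega) x = primitive g x + primitive h x := by
  have := primitive_add_smul (MemLp.integrableOn_omega (Lp.memLp g))
    (MemLp.integrableOn_omega (Lp.memLp h)) 1 hx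
  rw [one_mul, one_smul] at this
  rw [← this]
  exact primitive_congr (Lp.coeFn_add g h) hx

theorem lp_primitive_smul (t : ℝ) (g : Lp ℝ 2 volOmega) {x : ℝ} (hx : x ∈ Set.Icc (0 : ℝ) 1) :
    primitive (t • g : Lp ℝ 2 volOmega) x = t * primitive g x := by
  rw [primitive_congr (Lp.coeFn_smul t g) hx]
  exact intervalIntegral.integral_const_mul t _

namespace IsData

variable {α : ℝ} {a d₀ u_d : ℝ → ℝ}

theorem continuousOn (hd : IsData α a d₀ u_d) : ContinuousOn a (Set.Icc 0 1) := by
  obtain ⟨K, hK⟩ := hd.lipschitz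
  exact hK.continuousOn

theorem exists_abs_le (hd : IsData α a d₀ u_d) :
    ∃ A, 0 ≤ A ∧ ∀ x ∈ Set.Icc (0 : ℝ) 1, |a x| ≤ A := by
  obtain ⟨C, hC⟩ := isCompact_Icc.exists_bound_of_continuousOn hd.continuousOn
  exact ⟨C, (norm_nonneg _).trans (hC 0 (by simp)), hC⟩

end IsData

theorem exists_ae_abs_le {f : ℝ → ℝ} (hf : MemLp f ⊤ volOmega) :
    ∃ C, 0 ≤ C ∧ ∀ᵐ x ∂volOmega, |f x| ≤ C := by
  refine ⟨(eLpNorm f ⊤ volOmega).toReal, ENNReal.toReal_nonneg, ?_⟩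
  have h := ae_le_eLpNormEssSup (f := f) (μ := volOmega)
  filter_upwards [h] with x hx
  rw [← eLpNorm_exponent_top] at hx
  rw [← Real.norm_eq_abs, ← toReal_enorm]
  exact ENNReal.toReal_mono hf.2.ne hx

section bilin

variable {α : ℝ} {a d₀ u_d : ℝ → ℝ}

theorem IsData.integrable_principal (hd : IsData α a d₀ u_d) {g h : ℝ → ℝ}
    (hg : MemLp g 2 volOmega) (hh : MemLp h 2 volOmega) :
    IntegrableOn (fun x => a x * g x * h x) Omega := by
  have : IntegrableOn (fun x => g x * h x * a x) Omega :=
    integrableOn_mul_continuousOn (hg.integrable_mul hh) hd.continuousOn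
  exact this.congr (Filter.Eventually.of_forall fun x => by simp; ring)

theorem IsData.integrable_potential (hd : IsData α a d₀ u_d) {v w : ℝ → ℝ}
    (hv : ContinuousOn v (Set.Icc 0 1)) (hw : ContinuousOn w (Set.Icc 0 1)) :
    IntegrableOn (fun x => d₀ x * v x * w x) Omega :=
  integrableOn_mul_continuousOn (integrableOn_mul_continuousOn
    (hd.bounded.integrable le_top) hv) hw

theorem bilin_comm (v dv w dw : ℝ → ℝ) : bilin a d₀ v dv w dw = bilin a d₀ w dw v dv := by
  unfold bilin
  congr 1 <;> (congr 1; ext x; ring)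

theorem bilin_congr {v dv w dw v' dv' w' dw' : ℝ → ℝ} (h1 : ∀ x ∈ Omega, v x = v' x)
    (h2 : dv =ᵐ[volOmega] dv') (h3 : ∀ x ∈ Omega, w x = w' x) (h4 : dw =ᵐ[volOmega] dw') :
    bilin a d₀ v dv w dw = bilin a d₀ v' dv' w' dw' := by
  unfold bilin
  congr 1
  · apply integral_congr_ae
    filter_upwards [h2, h4] with x hx hx'
    rw [hx, hx']
  · apply setIntegral_congr_fun measurableSet_Ioo
    intro x hx
    simp only [h1 x hx, h3 x hx]

theorem IsData.bilin_add_smul_left' (hd : IsData α a d₀ u_d) {v dv v' dv' w dw : ℝ → ℝ}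
    (hv : ContinuousOn v (Set.Icc 0 1)) (hdv : MemLp dv 2 volOmega)
    (hv' : ContinuousOn v' (Set.Icc 0 1)) (hdv' : MemLp dv' 2 volOmega)
    (hw : ContinuousOn w (Set.Icc 0 1)) (hdw : MemLp dw 2 volOmega) (t : ℝ) :
    bilin a d₀ (v + t • v') (dv + t • dv') w dw =
      bilin a d₀ v dv w dw + t * bilin a d₀ v' dv' w dw := by
  unfold bilin
  rw [mul_add, ← integral_const_mul, ← integral_const_mul]
  have e1 : ∫ x in Omega, a x * (dv + t • dv') x * dw x =
      (∫ x in Omega, a x * dv x * dw x) + ∫ x in Omega, t * (a x * dv' x * dw x) := by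
    rw [← integral_add (hd.integrable_principal hdv hdw)
      ((hd.integrable_principal hdv' hdw).const_mul t)]
    congr 1; ext x; simp; ring
  have e2 : ∫ x in Omega, d₀ x * (v + t • v') x * w x =
      (∫ x in Omega, d₀ x * v x * w x) + ∫ x in Omega, t * (d₀ x * v' x * w x) := by
    rw [← integral_add (hd.integrable_potential hv hw)
      ((hd.integrable_potential hv' hw).const_mul t)]
    congr 1; ext x; simp; ring
  rw [e1, e2]; ring

theorem IsData.bilin_add_smul_left (hd : IsData α a d₀ u_d) {v dv v' dv' w dw : ℝ → ℝ}
    (hv : MemV v dv) (hv' : MemV v' dv') (hw : MemV w dw) (t : ℝ) :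
    bilin a d₀ (v + t • v') (dv + t • dv') w dw =
      bilin a d₀ v dv w dw + t * bilin a d₀ v' dv' w dw :=
  hd.bilin_add_smul_left' hv.continuousOn hv.memLp_deriv hv'.continuousOn hv'.memLp_deriv
    hw.continuousOn hw.memLp_deriv t

theorem IsData.bilin_sub_left (hd : IsData α a d₀ u_d) {v dv v' dv' w dw : ℝ → ℝ}
    (hv : MemV v dv) (hv' : MemV v' dv') (hw : MemV w dw) :
    bilin a d₀ (v - v') (dv - dv') w dw =
      bilin a d₀ v dv w dw - bilin a d₀ v' dv' w dw := by
  have := hd.bilin_add_smul_left hv hv' hw (-1)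
  simpa [sub_eq_add_neg] using this

/-- The form `𝔞` is coercive. -/
theorem IsData.le_bilin_self (hd : IsData α a d₀ u_d) {ν : ℝ}
    (hν : ∀ x ∈ Set.Icc (0 : ℝ) 1, ν ≤ a x) {v dv : ℝ → ℝ}
    (hdv : MemLp dv 2 volOmega) :
    ν * ∫ x in Omega, dv x ^ 2 ≤ bilin a d₀ v dv v dv := by
  unfold bilin
  have h1 : ν * ∫ x in Omega, dv x ^ 2 ≤ ∫ x in Omega, a x * dv x * dv x := by
    rw [← integral_const_mul]
    apply setIntegral_mono_on (hdv.integrable_sq.const_mul ν)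
      (hd.integrable_principal hdv hdv) measurableSet_Ioo
    intro x hx
    have := hν x (Set.Ioo_subset_Icc_self hx)
    nlinarith [sq_nonneg (dv x)]
  have h2 : 0 ≤ ∫ x in Omega, d₀ x * v x * v x := by
    apply integral_nonneg_of_ae
    filter_upwards [hd.nonneg] with x hx
    simp only [Pi.zero_apply]
    rw [mul_assoc]
    exact mul_nonneg hx (mul_self_nonneg _)
  linarith

/-- The form `𝔞` on `L²`, with a function identified with its derivative. -/
def lpBilin (a d₀ : ℝ → ℝ) (g h : Lp ℝ 2 volOmega) : ℝ :=
  bilin a d₀ (primitive g) g (primitive h) h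

theorem lp_primitive_continuousOn (g : Lp ℝ 2 volOmega) :
    ContinuousOn (primitive g) (Set.Icc 0 1) :=
  primitive_continuousOn (MemLp.integrableOn_omega (Lp.memLp g))

theorem lpBilin_comm (g h : Lp ℝ 2 volOmega) : lpBilin a d₀ g h = lpBilin a d₀ h g :=
  bilin_comm _ _ _ _

theorem IsData.lpBilin_add_smul (hd : IsData α a d₀ u_d) (t : ℝ) (f g h : Lp ℝ 2 volOmega) :
    lpBilin a d₀ (f + t • g) h = lpBilin a d₀ f h + t * lpBilin a d₀ g h := by
  unfold lpBilin
  rw [← hd.bilin_add_smul_left' (lp_primitive_continuousOn f) (Lp.memLp f)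
    (lp_primitive_continuousOn g) (Lp.memLp g) (lp_primitive_continuousOn h) (Lp.memLp h) t]
  apply bilin_congr
  · intro x hx
    have hx' := Set.Ioo_subset_Icc_self hx
    rw [lp_primitive_add _ _ hx', lp_primitive_smul _ _ hx']
    rfl
  · filter_upwards [Lp.coeFn_add f (t • g), Lp.coeFn_smul t g] with x h1 h2
    rw [h1, Pi.add_apply, h2]; rfl
  · exact fun _ _ => rfl
  · rfl

theorem IsData.lpBilin_zero (hd : IsData α a d₀ u_d) (h : Lp ℝ 2 volOmega) :
    lpBilin a d₀ 0 h = 0 := by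
  have := hd.lpBilin_add_smul 1 0 0 h
  simp only [smul_zero, add_zero, one_mul] at this
  linarith

theorem IsData.exists_abs_lpBilin_le (hd : IsData α a d₀ u_d) :
    ∃ C, ∀ g h : Lp ℝ 2 volOmega, ‖lpBilin a d₀ g h‖ ≤ C * ‖g‖ * ‖h‖ := by
  obtain ⟨A, hA0, hA⟩ := hd.exists_abs_le
  obtain ⟨D, hD0, hD⟩ := exists_ae_abs_le hd.bounded
  refine ⟨A + D, fun g h => ?_⟩
  have h1 : ‖∫ x in Omega, a x * g x * h x‖ ≤ A * (‖g‖ * ‖h‖) := by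
    have hi : IntegrableOn (fun x => |g x| * |h x|) Omega :=
      (Lp.memLp g).abs.integrable_mul (Lp.memLp h).abs
    calc ‖∫ x in Omega, a x * g x * h x‖ ≤ ∫ x in Omega, A * (|g x| * |h x|) := by
          apply norm_integral_le_of_norm_le (hi.const_mul A)
          rw [ae_omega_iff]
          refine Filter.Eventually.of_forall fun x hx => ?_
          rw [norm_mul, norm_mul, mul_assoc]
          exact mul_le_mul_of_nonneg_right (hA x (Set.Ioo_subset_Icc_self hx)) (by positivity)
      _ = A * ∫ x in Omega, |g x| * |h x| := integral_const_mul _ _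
      _ ≤ _ := mul_le_mul_of_nonneg_left (lp_integral_abs_mul_le g h) hA0
  have h2 : ‖∫ x in Omega, d₀ x * primitive g x * primitive h x‖ ≤ D * (‖g‖ * ‖h‖) := by
    have := norm_integral_le_of_norm_le_const (μ := volOmega)
      (f := fun x => d₀ x * primitive g x * primitive h x) (C := D * (‖g‖ * ‖h‖)) (by
        have hm : ∀ᵐ x ∂volOmega, x ∈ Omega := ae_restrict_mem measurableSet_Ioo
        filter_upwards [hD, hm] with x hx hm
        have hm' := Set.Ioo_subset_Icc_self hm
        rw [norm_mul, norm_mul, mul_assoc]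
        exact mul_le_mul hx (mul_le_mul (lp_abs_primitive_le g hm') (lp_abs_primitive_le h hm')
          (norm_nonneg _) (norm_nonneg _)) (by positivity) hD0)
    simpa using this
  unfold lpBilin bilin
  calc _ ≤ _ := norm_add_le _ _
    _ ≤ _ := add_le_add h1 h2
    _ = _ := by ring

/-- The form `𝔞` as a continuous bilinear map on `L²`. -/
theorem IsData.exists_clm_bilin (hd : IsData α a d₀ u_d) :
    ∃ B : Lp ℝ 2 volOmega →L[ℝ] Lp ℝ 2 volOmega →L[ℝ] ℝ, ∀ g h, B g h = lpBilin a d₀ g h := by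
  obtain ⟨C, hC⟩ := hd.exists_abs_lpBilin_le
  have hadd : ∀ f g h, lpBilin a d₀ (f + g) h = lpBilin a d₀ f h + lpBilin a d₀ g h := by
    intro f g h
    have := hd.lpBilin_add_smul 1 f g h
    simpa using this
  have hsmul : ∀ (t : ℝ) g h, lpBilin a d₀ (t • g) h = t • lpBilin a d₀ g h := by
    intro t g h
    have := hd.lpBilin_add_smul t 0 g h
    simpa [hd.lpBilin_zero] using this
  refine ⟨LinearMap.mkContinuous₂ (LinearMap.mk₂ ℝ (lpBilin a d₀) hadd hsmul ?_ ?_) C ?_, ?_⟩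
  · intro f g h
    simp only [lpBilin_comm f, hadd]
  · intro t g h
    simp only [lpBilin_comm g, hsmul]
  · intro g h
    exact hC g h
  · intro g h
    rfl

theorem exists_clm_primitive {f : ℝ → ℝ} (hf : IntegrableOn f Omega) :
    ∃ ℓ : Lp ℝ 2 volOmega →L[ℝ] ℝ, ∀ g, ℓ g = ∫ x in Omega, f x * primitive g x := by
  refine ⟨LinearMap.mkContinuous
    { toFun := fun g => ∫ x in Omega, f x * primitive g x
      map_add' := ?_
      map_smul' := ?_ } (∫ x in Omega, |f x|) ?_, fun g => rfl⟩
  · intro g h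
    rw [← integral_add (integrableOn_mul_continuousOn hf (lp_primitive_continuousOn g))
      (integrableOn_mul_continuousOn hf (lp_primitive_continuousOn h))]
    apply setIntegral_congr_fun measurableSet_Ioo
    intro x hx
    simp only [lp_primitive_add _ _ (Set.Ioo_subset_Icc_self hx)]; ring
  · intro t g
    simp only [RingHom.id_apply, smul_eq_mul]
    rw [← integral_const_mul]
    apply setIntegral_congr_fun measurableSet_Ioo
    intro x hx
    simp only [lp_primitive_smul _ _ (Set.Ioo_subset_Icc_self hx)]; ring
  · intro g
    calc ‖∫ x in Omega, f x * primitive g x‖ ≤ ∫ x in Omega, |f x| * ‖g‖ := by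
          apply norm_integral_le_of_norm_le (hf.abs.mul_const _)
          rw [ae_omega_iff]
          refine Filter.Eventually.of_forall fun x hx => ?_
          rw [norm_mul]
          exact mul_le_mul_of_nonneg_left
            (lp_abs_primitive_le g (Set.Ioo_subset_Icc_self hx)) (abs_nonneg _)
      _ = _ := integral_mul_const _ _

theorem exists_clm_eval (x : ℝ) (hx : x ∈ Set.Icc (0 : ℝ) 1) :
    ∃ ℓ : Lp ℝ 2 volOmega →L[ℝ] ℝ, ∀ g, ℓ g = primitive g x :=
  ⟨LinearMap.mkContinuous
    { toFun := fun g => primitive g x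
      map_add' := fun g h => lp_primitive_add g h hx
      map_smul' := fun t g => lp_primitive_smul t g hx } 1
    (fun g => by simpa using lp_abs_primitive_le g hx), fun _ => rfl⟩

/-- Lax-Milgram on a closed space of derivatives. -/
theorem IsData.exists_state_of_isClosed (hd : IsData α a d₀ u_d)
    (K : Submodule ℝ (Lp ℝ 2 volOmega)) (hK : IsClosed (K : Set (Lp ℝ 2 volOmega)))
    {f : ℝ → ℝ} (hf : IntegrableOn f Omega) :
    ∃ g ∈ K, ∀ h ∈ K, lpBilin a d₀ g h = ∫ x in Omega, f x * primitive h x := by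
  obtain ⟨B, hB⟩ := hd.exists_clm_bilin
  obtain ⟨ℓ, hℓ⟩ := exists_clm_primitive hf
  obtain ⟨ν, hν0, hν⟩ := hd.elliptic
  have : CompleteSpace K := hK.completeSpace_coe
  let BK : K →L[ℝ] K →L[ℝ] ℝ := B.bilinearComp K.subtypeL K.subtypeL
  have hBK : ∀ g h : K, BK g h = lpBilin a d₀ g h := fun g h => hB g h
  -- The norm on `K` is the `L²` norm of the derivative, so the principal part alone is coercive
  -- with constant `ν`; no Poincaré inequality is needed.
  have hcoer : IsCoercive BK := by
    refine ⟨ν, hν0, fun g => ?_⟩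
    rw [hBK]
    have := hd.le_bilin_self hν (v := primitive (g : Lp ℝ 2 volOmega))
      (Lp.memLp (g : Lp ℝ 2 volOmega))
    rw [lp_integral_sq] at this
    rw [mul_assoc, ← sq]
    exact this
  let r : K := (InnerProductSpace.toDual ℝ K).symm (ℓ.comp K.subtypeL)
  refine ⟨hcoer.continuousLinearEquivOfBilin.symm r, Submodule.coe_mem _, fun h hh => ?_⟩
  have h1 := hcoer.continuousLinearEquivOfBilin_apply
    (hcoer.continuousLinearEquivOfBilin.symm r) ⟨h, hh⟩
  rw [ContinuousLinearEquiv.apply_symm_apply, hBK, InnerProductSpace.toDual_symm_apply] at h1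
  rw [← h1]
  exact hℓ h

end bilin

/-- What the analysis uses of the state spaces `V` and `V_h`. -/
structure IsStateSpace (a d₀ : ℝ → ℝ) (W : (ℝ → ℝ) → (ℝ → ℝ) → Prop) : Prop where
  memV : ∀ {v dv}, W v dv → MemV v dv
  add_smul : ∀ {v dv w dw}, W v dv → W w dw → ∀ t : ℝ, W (v + t • w) (dv + t • dw)
  exists_state : ∀ f : ℝ → ℝ, IntegrableOn f Omega → ∃ u, IsState W a d₀ f u

/-- Transfers Lax-Milgram from `L²` classes of derivatives back to pairs of functions: a state space
only has to be matched with a closed subspace `K` of derivatives, up to null sets. -/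
theorem IsData.exists_isState_of_isClosed {α : ℝ} {a d₀ u_d : ℝ → ℝ} (hd : IsData α a d₀ u_d)
    {W : (ℝ → ℝ) → (ℝ → ℝ) → Prop} (hW : ∀ {v dv}, W v dv → MemV v dv)
    (K : Submodule ℝ (Lp ℝ 2 volOmega)) (hK : IsClosed (K : Set (Lp ℝ 2 volOmega)))
    (h₁ : ∀ g ∈ K, W (primitive g) g)
    (h₂ : ∀ w dw (h : W w dw), (hW h).memLp_deriv.toLp ∈ K)
    (f : ℝ → ℝ) (hf : IntegrableOn f Omega) : ∃ u, IsState W a d₀ f u := by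
  obtain ⟨g, hg, hs⟩ := hd.exists_state_of_isClosed K hK hf
  refine ⟨primitive g, g, h₁ g hg, fun w dw hw => ?_⟩
  have := hs _ (h₂ w dw hw)
  have hae := (hW hw).memLp_deriv.coeFn_toLp
  have hp : ∀ x ∈ Omega, w x = primitive ((hW hw).memLp_deriv.toLp) x := by
    intro x hx
    have hx' := Set.Ioo_subset_Icc_self hx
    rw [primitive_congr hae hx', (hW hw).eqOn_primitive hx']
  rw [bilin_congr (fun _ _ => rfl) (Filter.EventuallyEq.refl _ _) hp hae.symm]
  refine this.trans ?_
  apply setIntegral_congr_fun measurableSet_Ioo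
  intro x hx
  simp only [hp x hx]

/-- The left boundary value of a primitive is automatic; the right one is the kernel of a continuous
functional. -/
theorem IsData.isStateSpace_memV {α : ℝ} {a d₀ u_d : ℝ → ℝ} (hd : IsData α a d₀ u_d) :
    IsStateSpace a d₀ MemV := by
  refine ⟨id, fun h h' t => h.add_smul h' t, ?_⟩
  obtain ⟨ℓ, hℓ⟩ := exists_clm_eval 1 (by simp)
  refine hd.exists_isState_of_isClosed id ℓ.ker ℓ.isClosed_ker ?_ ?_
  · intro g hg
    have h0 : ℓ g = 0 := hg
    exact memV_of_eqOn_primitive (Lp.memLp g) (fun _ _ => rfl) (by rw [← hℓ, h0])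
  · intro w dw hw
    change ℓ _ = 0
    rw [hℓ, primitive_congr hw.memLp_deriv.coeFn_toLp (by simp), hw.primitive_deriv_one]

theorem Mesh.node_mem (M : Mesh) (i : Fin (M.l + 1)) : M.node i ∈ Set.Icc (0 : ℝ) 1 := by
  constructor
  · rw [← M.node_zero]; exact M.strictMono.monotone (Fin.zero_le i)
  · rw [← M.node_last]; exact M.strictMono.monotone (Fin.le_last i)

theorem Mesh.node_lt (M : Mesh) (i : Fin M.l) : M.node i.castSucc < M.node i.succ :=
  M.strictMono i.castSucc_lt_succ

theorem Mesh.Icc_subset (M : Mesh) (i : Fin M.l) :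
    Set.Icc (M.node i.castSucc) (M.node i.succ) ⊆ Set.Icc 0 1 :=
  Set.Icc_subset_Icc (M.node_mem _).1 (M.node_mem _).2

/-- A continuous function that is affine in the interior of an interval is affine on it. -/
theorem affine_on_Icc {v : ℝ → ℝ} {s t b c : ℝ} (hst : s < t)
    (hv : ContinuousOn v (Set.Icc s t)) (h : ∀ x ∈ Set.Ioo s t, v x = b + c * x) :
    ∀ x ∈ Set.Icc s t, v x = b + c * x := by
  have hcl : closure (Set.Ioo s t) = Set.Icc s t := closure_Ioo hst.ne
  intro x hx
  have : Set.EqOn v (fun x => b + c * x) (Set.Icc s t) :=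
    Set.EqOn.of_subset_closure (s := Set.Ioo s t) (fun y hy => h y hy) hv
      (by fun_prop) Set.Ioo_subset_Icc_self hcl.ge
  exact this hx

theorem IsData.isStateSpace_memVh {α : ℝ} {a d₀ u_d : ℝ → ℝ} (hd : IsData α a d₀ u_d)
    (M : Mesh) : IsStateSpace a d₀ (MemVh M) := by
  refine ⟨fun h => h.1, fun h h' t => h.add_smul h' t, ?_⟩
  choose! ℓ hℓ using exists_clm_eval
  -- Being affine on a cell is written as a linear relation between the value at each point of the
  -- cell and the values at its two end nodes. Point evaluation of the primitive is continuous on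
  -- `L²`, so `K` is closed without a dimension argument.
  let K : Submodule ℝ (Lp ℝ 2 volOmega) := (ℓ 1).ker ⊓ ⨅ i : Fin M.l,
    ⨅ x : Set.Icc (M.node i.castSucc) (M.node i.succ),
      ((M.node i.succ - M.node i.castSucc) • ℓ x - (M.node i.succ - x) • ℓ (M.node i.castSucc)
        - ((x : ℝ) - M.node i.castSucc) • ℓ (M.node i.succ)).ker
  have hmem : ∀ g : Lp ℝ 2 volOmega, g ∈ K ↔ primitive g 1 = 0 ∧ ∀ i : Fin M.l,
      ∀ x ∈ Set.Icc (M.node i.castSucc) (M.node i.succ),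
        (M.node i.succ - M.node i.castSucc) * primitive g x
          - (M.node i.succ - x) * primitive g (M.node i.castSucc)
          - (x - M.node i.castSucc) * primitive g (M.node i.succ) = 0 := by
    intro g
    simp only [K, Submodule.mem_inf, Submodule.mem_iInf, Subtype.forall]
    refine and_congr ?_ (forall_congr' fun i => forall_congr' fun x => ?_)
    · rw [← hℓ 1 (by simp)]; rfl
    · refine forall_congr' fun hx => ?_
      rw [← hℓ x (M.Icc_subset i hx), ← hℓ _ (M.node_mem _), ← hℓ _ (M.node_mem _)]
      rfl
  refine hd.exists_isState_of_isClosed (fun h => h.1) K ?_ ?_ ?_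
  · have : (K : Set (Lp ℝ 2 volOmega)) = ((ℓ 1).ker : Set _) ∩ ⋂ i : Fin M.l,
      ⋂ x : Set.Icc (M.node i.castSucc) (M.node i.succ),
      (((M.node i.succ - M.node i.castSucc) • ℓ x - (M.node i.succ - x) • ℓ (M.node i.castSucc)
        - ((x : ℝ) - M.node i.castSucc) • ℓ (M.node i.succ)).ker : Set _) := by
      simp [K, Submodule.coe_iInf]
    rw [this]
    exact (ContinuousLinearMap.isClosed_ker _).inter
      (isClosed_iInter fun i => isClosed_iInter fun x => ContinuousLinearMap.isClosed_ker _)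
  · intro g hg
    obtain ⟨h0, h1⟩ := (hmem g).1 hg
    refine ⟨memV_of_eqOn_primitive (Lp.memLp g) (fun _ _ => rfl) h0, fun i => ?_⟩
    have hp : M.node i.succ - M.node i.castSucc ≠ 0 := (sub_pos.2 (M.node_lt i)).ne'
    refine ⟨(M.node i.succ * primitive g (M.node i.castSucc)
      - M.node i.castSucc * primitive g (M.node i.succ)) / (M.node i.succ - M.node i.castSucc),
      (primitive g (M.node i.succ) - primitive g (M.node i.castSucc))
        / (M.node i.succ - M.node i.castSucc), fun x hx => ?_⟩
    have := h1 i x (Set.Ioo_subset_Icc_self hx)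
    field_simp
    linarith
  · intro w dw hw
    rw [hmem]
    have hae := hw.1.memLp_deriv.coeFn_toLp
    have hp : ∀ x ∈ Set.Icc (0 : ℝ) 1, primitive (hw.1.memLp_deriv.toLp) x = w x := by
      intro x hx
      rw [primitive_congr hae hx, hw.1.eqOn_primitive hx]
    refine ⟨by rw [hp 1 (by simp), hw.1.zero_right], fun i x hx => ?_⟩
    obtain ⟨b, c, h⟩ := hw.2 i
    have haff := affine_on_Icc (M.node_lt i) (hw.1.continuousOn.mono (M.Icc_subset i)) h
    rw [hp x (M.Icc_subset i hx), hp _ (M.node_mem _), hp _ (M.node_mem _), haff x hx,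
      haff _ (Set.left_mem_Icc.2 (M.node_lt i).le), haff _ (Set.right_mem_Icc.2 (M.node_lt i).le)]
    ring

end

end BVControl
-- Signed measures and functions of bounded variation.
namespace BVControl

noncomputable section

open scoped NNReal ENNReal

section signed

theorem integrable_of_concentrated {ν : Measure ℝ} [IsFiniteMeasure ν] (hν : ν Omegaᶜ = 0)
    {φ : ℝ → ℝ} (hφ : ContinuousOn φ (Set.Icc 0 1)) : Integrable φ ν := by
  have hr : ν.restrict Omega = ν := Measure.restrict_eq_self_of_ae_mem (by
    rw [ae_iff]; exact hν)
  obtain ⟨C, hC⟩ := isCompact_Icc.exists_bound_of_continuousOn hφ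
  rw [← hr]
  refine ⟨(hφ.mono Set.Ioo_subset_Icc_self).aestronglyMeasurable measurableSet_Ioo, ?_⟩
  apply HasFiniteIntegral.of_bounded (C := C)
  rw [ae_restrict_iff' measurableSet_Ioo]
  exact Filter.Eventually.of_forall fun x hx => hC x (Set.Ioo_subset_Icc_self hx)

theorem totalVariation_add_le (μ ν : SignedMeasure ℝ) :
    (μ + ν).totalVariation ≤ μ.totalVariation + ν.totalVariation := by
  simp only [SignedMeasure.totalVariation_eq_variation]
  exact VectorMeasure.variation_add_le

theorem totalVariation_smul (c : ℝ) (μ : SignedMeasure ℝ) :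
    (c • μ).totalVariation = ‖c‖₊ • μ.totalVariation := by
  simp only [SignedMeasure.totalVariation_eq_variation]
  exact VectorMeasure.variation_smul

theorem measNorm_combo_le (s t : ℝ) (μ ν : SignedMeasure ℝ) :
    measNorm (s • μ + t • ν) ≤ |s| * measNorm μ + |t| * measNorm ν := by
  unfold measNorm
  have h := totalVariation_add_le (s • μ) (t • ν) Set.univ
  rw [totalVariation_smul, totalVariation_smul] at h
  have h' := ENNReal.toReal_mono (measure_ne_top _ _) h
  refine h'.trans (le_of_eq ?_)
  rw [Measure.add_apply, ENNReal.toReal_add (measure_ne_top _ _) (measure_ne_top _ _),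
    Measure.smul_apply, Measure.smul_apply, ENNReal.smul_def, ENNReal.smul_def, smul_eq_mul,
    smul_eq_mul, ENNReal.toReal_mul, ENNReal.toReal_mul]
  rfl

theorem measNorm_nonneg (μ : SignedMeasure ℝ) : 0 ≤ measNorm μ := ENNReal.toReal_nonneg

theorem abs_apply_le_measNorm (μ : SignedMeasure ℝ) (s : Set ℝ) : |μ s| ≤ measNorm μ := by
  refine (μ.norm_le_totalVariation s).trans ?_
  exact measureReal_mono (Set.subset_univ s)

theorem measNorm_eq (μ : SignedMeasure ℝ) :
    measNorm μ = μ.toJordanDecomposition.posPart.real Set.univ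
      + μ.toJordanDecomposition.negPart.real Set.univ := by
  unfold measNorm SignedMeasure.totalVariation
  rw [Measure.add_apply, ENNReal.toReal_add (measure_ne_top _ _) (measure_ne_top _ _)]
  rfl

variable {μ μ' : SignedMeasure ℝ}

theorem posPart_compl (h : μ.totalVariation Omegaᶜ = 0) :
    μ.toJordanDecomposition.posPart Omegaᶜ = 0 := by
  rw [SignedMeasure.totalVariation, Measure.add_apply, add_eq_zero] at h
  exact h.1

theorem negPart_compl (h : μ.totalVariation Omegaᶜ = 0) :
    μ.toJordanDecomposition.negPart Omegaᶜ = 0 := by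
  rw [SignedMeasure.totalVariation, Measure.add_apply, add_eq_zero] at h
  exact h.2

theorem IsTest.integrable_measure {φ : ℝ → ℝ} (hφ : IsTest φ) (ν : Measure ℝ)
    [IsFiniteMeasure ν] : Integrable φ ν :=
  hφ.smooth.continuous.integrable_of_hasCompactSupport hφ.compact

/-- The integral against a difference of finite measures. -/
theorem integralSigned_sub {φ : ℝ → ℝ} (hφ : IsTest φ) (p n : Measure ℝ) [IsFiniteMeasure p]
    [IsFiniteMeasure n] (h : μ = p.toSignedMeasure - n.toSignedMeasure) :
    integralSigned φ μ = (∫ x, φ x ∂p) - ∫ x, φ x ∂n := by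
  set P := μ.toJordanDecomposition.posPart with hP
  set N := μ.toJordanDecomposition.negPart with hN
  have h1 : P.toSignedMeasure - N.toSignedMeasure = p.toSignedMeasure - n.toSignedMeasure := by
    rw [← h]; exact μ.toSignedMeasure_toJordanDecomposition
  -- Rearranged so that only positive measures occur, for which integrals are additive; minimality
  -- of the Jordan decomposition plays no role.
  have h2 : P + n = p + N := by
    rw [← Measure.toSignedMeasure_eq_toSignedMeasure_iff, Measure.toSignedMeasure_add,
      Measure.toSignedMeasure_add]
    rw [sub_eq_sub_iff_add_eq_add] at h1
    exact h1
  have h3 : ∫ x, φ x ∂(P + n) = ∫ x, φ x ∂(p + N) := by rw [h2]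
  rw [integral_add_measure (hφ.integrable_measure P) (hφ.integrable_measure n),
    integral_add_measure (hφ.integrable_measure p) (hφ.integrable_measure N)] at h3
  unfold integralSigned
  rw [← hP, ← hN]
  linarith

theorem integralSigned_add {φ : ℝ → ℝ} (hφ : IsTest φ) (μ ν : SignedMeasure ℝ) :
    integralSigned φ (μ + ν) = integralSigned φ μ + integralSigned φ ν := by
  have h1 := μ.toSignedMeasure_toJordanDecomposition
  have h2 := ν.toSignedMeasure_toJordanDecomposition
  rw [integralSigned_sub hφ (μ.toJordanDecomposition.posPart + ν.toJordanDecomposition.posPart)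
    (μ.toJordanDecomposition.negPart + ν.toJordanDecomposition.negPart),
    integral_add_measure (hφ.integrable_measure _) (hφ.integrable_measure _),
    integral_add_measure (hφ.integrable_measure _) (hφ.integrable_measure _)]
  · unfold integralSigned; ring
  · rw [Measure.toSignedMeasure_add, Measure.toSignedMeasure_add]
    conv_lhs => rw [← h1, ← h2]
    unfold JordanDecomposition.toSignedMeasure
    abel

theorem integralSigned_smul (φ : ℝ → ℝ) (c : ℝ) (μ : SignedMeasure ℝ) :
    integralSigned φ (c • μ) = c * integralSigned φ μ := by
  unfold integralSigned
  rw [SignedMeasure.toJordanDecomposition_smul_real]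
  rcases le_or_gt 0 c with hc | hc
  · rw [JordanDecomposition.real_smul_posPart_nonneg _ _ hc,
      JordanDecomposition.real_smul_negPart_nonneg _ _ hc, integral_smul_nnreal_measure,
      integral_smul_nnreal_measure]
    simp only [NNReal.smul_def, Real.coe_toNNReal _ hc, smul_eq_mul]
    ring
  · rw [JordanDecomposition.real_smul_posPart_neg _ _ hc,
      JordanDecomposition.real_smul_negPart_neg _ _ hc, integral_smul_nnreal_measure,
      integral_smul_nnreal_measure]
    simp only [NNReal.smul_def, Real.coe_toNNReal _ (neg_nonneg.2 hc.le), smul_eq_mul]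
    ring

end signed

namespace MemBV

variable {q q' : ℝ → ℝ} {μ μ' : SignedMeasure ℝ}

theorem integrable (h : MemBV q μ) : IntegrableOn q Omega := memLp_one_iff_integrable.1 h.memLp

theorem combo (h : MemBV q μ) (h' : MemBV q' μ') (s t : ℝ) :
    MemBV (s • q + t • q') (s • μ + t • μ') := by
  refine ⟨(h.memLp.const_smul s).add (h'.memLp.const_smul t), ?_, fun φ hφ => ?_⟩
  · have := totalVariation_add_le (s • μ) (t • μ') Omegaᶜ
    rw [totalVariation_smul, totalVariation_smul] at this
    refine le_antisymm (this.trans (le_of_eq ?_)) bot_le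
    simp [h.concentrated, h'.concentrated]
  · rw [integralSigned_add hφ, integralSigned_smul, integralSigned_smul]
    have i1 := integrableOn_mul_continuousOn h.integrable hφ.deriv_continuous.continuousOn
    have i2 := integrableOn_mul_continuousOn h'.integrable hφ.deriv_continuous.continuousOn
    have e : ∫ x in Omega, (s • q + t • q') x * deriv φ x =
        s * (∫ x in Omega, q x * deriv φ x) + t * ∫ x in Omega, q' x * deriv φ x := by
      rw [← integral_const_mul, ← integral_const_mul,
        ← integral_add (i1.const_mul s) (i2.const_mul t)]
      congr 1; ext x; simp; ring
    rw [e, h.distribDeriv φ hφ, h'.distribDeriv φ hφ]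
    ring

theorem zero : MemBV 0 0 := by
  refine ⟨MemLp.zero, by simp [SignedMeasure.totalVariation_zero], fun φ _ => ?_⟩
  simp [integralSigned, SignedMeasure.toJordanDecomposition_zero]

theorem const (c : ℝ) : MemBV (fun _ => c) 0 := by
  refine ⟨memLp_const c, by simp [SignedMeasure.totalVariation_zero], fun φ hφ => ?_⟩
  have : ∫ x in Omega, deriv φ x = 0 := by
    rw [← primitive_one, hφ.primitive_deriv, hφ.eq_zero (by simp)]
  rw [integral_const_mul, this]
  simp [integralSigned, SignedMeasure.toJordanDecomposition_zero]

end MemBV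

theorem measNorm_zero : measNorm 0 = 0 := by
  simp [measNorm, SignedMeasure.totalVariation_zero]

theorem setIntegral_indicator_Ioi {ψ : ℝ → ℝ} (hψ : IntegrableOn ψ Omega) {y : ℝ}
    (hy : y ∈ Omega) :
    ∫ x in Omega, (Set.Ioi y).indicator ψ x = primitive ψ 1 - primitive ψ y := by
  rw [setIntegral_indicator measurableSet_Ioi,
    primitive_sub_primitive hψ (Set.Ioo_subset_Icc_self hy) (by simp),
    intervalIntegral.integral_of_le hy.2.le, integral_Ioc_eq_integral_Ioo]
  congr 2
  ext x
  constructor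
  · rintro ⟨h1, h2⟩; exact ⟨h2, h1.2⟩
  · rintro ⟨h1, h2⟩; exact ⟨⟨hy.1.trans h1, h2⟩, h1⟩

/-- Fubini's theorem for the distribution function of a measure on `Ω`. -/
theorem integral_measure_Iio_mul {ν : Measure ℝ} [IsFiniteMeasure ν] (hν : ν Omegaᶜ = 0)
    {ψ : ℝ → ℝ} (hψ : IntegrableOn ψ Omega) :
    ∫ x in Omega, ν.real (Set.Iio x) * ψ x = ∫ y, (primitive ψ 1 - primitive ψ y) ∂ν := by
  have hint : Integrable (Function.uncurry fun x y => (Set.Iio x).indicator (fun _ => ψ x) y)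
      (volOmega.prod ν) := by
    have h1 : Integrable (fun p : ℝ × ℝ => ψ p.1) (volOmega.prod ν) :=
      Integrable.comp_fst hψ ν
    have h2 := h1.indicator (s := {p : ℝ × ℝ | p.2 < p.1})
      (measurableSet_lt measurable_snd measurable_fst)
    refine h2.congr (Filter.Eventually.of_forall fun p => ?_)
    simp [Function.uncurry, Set.indicator_apply]
  have h := integral_integral_swap hint
  have e1 : ∀ x, ∫ y, (Set.Iio x).indicator (fun _ => ψ x) y ∂ν = ν.real (Set.Iio x) * ψ x := by
    intro x
    rw [integral_indicator_const _ measurableSet_Iio, smul_eq_mul]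
  simp_rw [e1] at h
  rw [h]
  apply integral_congr_ae
  have hm : ∀ᵐ y ∂ν, y ∈ Omega := by rw [ae_iff]; exact hν
  filter_upwards [hm] with y hy
  rw [← setIntegral_indicator_Ioi hψ hy]
  congr 1

/-- The distribution function of a signed measure. -/
theorem signed_apply_Iio (μ : SignedMeasure ℝ) (x : ℝ) :
    μ (Set.Iio x) = μ.toJordanDecomposition.posPart.real (Set.Iio x)
      - μ.toJordanDecomposition.negPart.real (Set.Iio x) :=
  μ.apply_eq_posPart_real_sub_negPart_real measurableSet_Iio

theorem integrableOn_measure_Iio (ν : Measure ℝ) [IsFiniteMeasure ν] {ψ : ℝ → ℝ}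
    (hψ : IntegrableOn ψ Omega) : IntegrableOn (fun x => ν.real (Set.Iio x) * ψ x) Omega := by
  have hm : Monotone fun x => ν.real (Set.Iio x) :=
    fun x y h => measureReal_mono (Set.Iio_subset_Iio h)
  refine Integrable.bdd_mul (c := ν.real Set.univ) hψ hm.measurable.aestronglyMeasurable
    (Filter.Eventually.of_forall fun x => ?_)
  rw [Real.norm_of_nonneg measureReal_nonneg]
  exact measureReal_mono (Set.subset_univ _)

theorem integrableOn_signed_Iio (μ : SignedMeasure ℝ) {ψ : ℝ → ℝ}
    (hψ : IntegrableOn ψ Omega) : IntegrableOn (fun x => μ (Set.Iio x) * ψ x) Omega := by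
  simp_rw [signed_apply_Iio, sub_mul]
  exact (integrableOn_measure_Iio _ hψ).sub (integrableOn_measure_Iio _ hψ)

/-- Fubini on the two Jordan parts: a mass at `y` is weighted with the integral of `ψ` over `(y,
1)`, which is minus the primitive at `y` because `ψ` has mean zero. -/
theorem integral_signed_Iio_mul {μ : SignedMeasure ℝ} (hμ : μ.totalVariation Omegaᶜ = 0)
    {ψ : ℝ → ℝ} (hψ : IntegrableOn ψ Omega) (h1 : primitive ψ 1 = 0) :
    ∫ x in Omega, μ (Set.Iio x) * ψ x = - integralSigned (primitive ψ) μ := by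
  simp_rw [signed_apply_Iio, sub_mul]
  rw [integral_sub (integrableOn_measure_Iio _ hψ) (integrableOn_measure_Iio _ hψ),
    integral_measure_Iio_mul (posPart_compl hμ) hψ,
    integral_measure_Iio_mul (negPart_compl hμ) hψ]
  simp only [h1, zero_sub, integral_neg]
  unfold integralSigned
  ring

/-- A function of bounded variation is, up to a constant, the distribution function of its
derivative. -/
theorem MemBV.ae_eq {q : ℝ → ℝ} {μ : SignedMeasure ℝ} (h : MemBV q μ) :
    ∃ c, ∀ᵐ x ∂volOmega, q x = c + μ (Set.Iio x) := by
  have h1 : IntegrableOn (fun x => μ (Set.Iio x)) Omega := by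
    simpa using integrableOn_signed_Iio μ (ψ := fun _ => 1) (integrable_const 1)
  obtain ⟨c, hc⟩ := ae_const_of_integral_deriv_eq_zero (f := fun x => q x - μ (Set.Iio x))
    (h.integrable.sub h1) (by
    intro φ hφ
    have e : ∫ x in Omega, (q x - μ (Set.Iio x)) * deriv φ x =
        (∫ x in Omega, q x * deriv φ x) - ∫ x in Omega, μ (Set.Iio x) * deriv φ x := by
      simp_rw [sub_mul]
      exact integral_sub
        (integrableOn_mul_continuousOn h.integrable hφ.deriv_continuous.continuousOn)
        (integrableOn_signed_Iio μ hφ.deriv_integrable)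
    rw [e, h.distribDeriv φ hφ, integral_signed_Iio_mul h.concentrated hφ.deriv_integrable
      (by rw [hφ.primitive_deriv, hφ.eq_zero (by simp)])]
    have : primitive (deriv φ) = φ := funext hφ.primitive_deriv
    rw [this, sub_self])
  refine ⟨c, ?_⟩
  filter_upwards [hc] with x hx
  linarith

/-- The undetermined constant in `q` is invisible to a mean-zero `z`. For an adjoint state `z` this
brings in the multiplier: the pairing with `q` becomes an integral of `Φ` against `q'`. -/
theorem MemBV.integral_mul {q : ℝ → ℝ} {μ : SignedMeasure ℝ} (h : MemBV q μ) {z : ℝ → ℝ}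
    (hz : IntegrableOn z Omega) (h1 : primitive z 1 = 0) :
    ∫ x in Omega, z x * q x = - integralSigned (primitive z) μ := by
  obtain ⟨c, hc⟩ := h.ae_eq
  rw [← integral_signed_Iio_mul h.concentrated hz h1]
  have e : ∫ x in Omega, z x * q x = ∫ x in Omega, (c * z x + μ (Set.Iio x) * z x) := by
    apply integral_congr_ae
    filter_upwards [hc] with x hx
    rw [hx]; ring
  rw [e, integral_add (hz.const_mul c) (integrableOn_signed_Iio μ hz), integral_const_mul,
    ← primitive_one, h1, mul_zero, zero_add]

/-- The competitor that turns the optimality condition into a pointwise bound for the multiplier. -/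
theorem memBV_indicator {y : ℝ} (hy : y ∈ Omega) :
    MemBV ((Set.Ioi y).indicator fun _ => 1) (Measure.dirac y).toSignedMeasure := by
  have hv : (Measure.dirac y).toSignedMeasure.totalVariation = Measure.dirac y := by
    rw [SignedMeasure.totalVariation_eq_variation]
    exact Measure.variation_toSignedMeasure
  refine ⟨(memLp_const 1).indicator measurableSet_Ioi, ?_, fun φ hφ => ?_⟩
  · rw [hv, Measure.dirac_apply' _ measurableSet_Ioo.compl]
    simpa using hy
  · have e : ∫ x in Omega, (Set.Ioi y).indicator (fun _ => (1 : ℝ)) x * deriv φ x =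
        ∫ x in Omega, (Set.Ioi y).indicator (deriv φ) x := by
      congr 1; ext x; simp [Set.indicator_apply]
    rw [e, setIntegral_indicator_Ioi hφ.deriv_integrable hy, hφ.primitive_deriv,
      hφ.primitive_deriv, hφ.eq_zero (x := 1) (by simp),
      integralSigned_sub hφ (Measure.dirac y) 0 (by simp)]
    simp

theorem measNorm_dirac (y : ℝ) : measNorm (Measure.dirac y).toSignedMeasure = 1 := by
  unfold measNorm
  rw [SignedMeasure.totalVariation_eq_variation, Measure.variation_toSignedMeasure]
  simp

/-! ### First-order optimality and the structure of optimal controls. -/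

section optimality

variable {α : ℝ} {a d₀ u_d : ℝ → ℝ} {W : (ℝ → ℝ) → (ℝ → ℝ) → Prop}

/-- Dividing by `t` and letting `t` tend to zero: along a segment starting at a minimizer, the
first-order term of a quadratic upper bound for the increase of the cost is nonnegative. -/
theorem nonneg_of_forall_add_mul {X B : ℝ}
    (h : ∀ t, 0 < t → t ≤ 1 → 0 ≤ t * X + t ^ 2 * B) : 0 ≤ X := by
  by_contra hX
  push Not at hX
  set t := min 1 (-X / (2 * (|B| + 1))) with ht
  have hB : 0 < 2 * (|B| + 1) := by positivity
  have ht0 : 0 < t := lt_min one_pos (div_pos (by linarith) hB)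
  have h1 := h t ht0 (min_le_left _ _)
  have h2 : t * (2 * (|B| + 1)) ≤ -X := by
    rw [← le_div_iff₀ hB]; exact min_le_right _ _
  have h3 : 0 ≤ X + t * B := by
    have : 0 ≤ t * (X + t * B) := by nlinarith
    exact nonneg_of_mul_nonneg_right this ht0
  nlinarith [le_abs_self B, abs_nonneg B, mul_le_mul_of_nonneg_left (le_abs_self B) ht0.le]

theorem IsStateSpace.isState_combo (hd : IsData α a d₀ u_d) (hW : IsStateSpace a d₀ W)
    {q u q' u' : ℝ → ℝ} (hq : IntegrableOn q Omega) (hq' : IntegrableOn q' Omega)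
    (h : IsState W a d₀ q u) (h' : IsState W a d₀ q' u') (t : ℝ) :
    IsState W a d₀ (q + t • q') (u + t • u') := by
  obtain ⟨du, hu, hs⟩ := h
  obtain ⟨du', hu', hs'⟩ := h'
  refine ⟨_, hW.add_smul hu hu' t, fun w dw hw => ?_⟩
  have hc := (hW.memV hw).continuousOn
  rw [hd.bilin_add_smul_left (hW.memV hu) (hW.memV hu') (hW.memV hw), hs w dw hw, hs' w dw hw,
    ← integral_const_mul, ← integral_add (integrableOn_mul_continuousOn hq hc)
      ((integrableOn_mul_continuousOn hq' hc).const_mul t)]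
  congr 1; ext x; simp; ring

/-- The optimality condition of the control problem. -/
theorem IsOptimal.variational_inequality (hd : IsData α a d₀ u_d) (hW : IsStateSpace a d₀ W)
    {q u z : ℝ → ℝ} {μ : SignedMeasure ℝ} (hq : MemBV q μ) (hu : IsState W a d₀ q u)
    (hmin : ∀ q₁ μ₁ u₁, MemBV q₁ μ₁ → IsState W a d₀ q₁ u₁ →
      cost α u_d u μ ≤ cost α u_d u₁ μ₁)
    (hz : IsAdjoint W a d₀ u_d u z) {q₁ : ℝ → ℝ} {μ₁ : SignedMeasure ℝ} (hq₁ : MemBV q₁ μ₁) :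
    0 ≤ (∫ x in Omega, z x * (q₁ x - q x)) + α * (measNorm μ₁ - measNorm μ) := by
  obtain ⟨u₁, hu₁⟩ := hW.exists_state q₁ hq₁.integrable
  have hdiff : IsState W a d₀ (q₁ + (-1 : ℝ) • q) (u₁ + (-1 : ℝ) • u) :=
    hW.isState_combo hd hq₁.integrable hq.integrable hu₁ hu (-1)
  have hqd : IntegrableOn (q₁ + (-1 : ℝ) • q) Omega :=
    hq₁.integrable.add (hq.integrable.smul (-1 : ℝ))
  obtain ⟨dz, hzW, hz'⟩ := hz
  obtain ⟨de, heW, he'⟩ := hdiff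
  -- The adjoint equation tested with the state of `q₁ - q`, and that state's equation tested with
  -- `z`.
  have hA : ∫ x in Omega, (u₁ + (-1 : ℝ) • u) x * (u x - u_d x) =
      ∫ x in Omega, z x * (q₁ x - q x) := by
    rw [← hz' _ _ heW, he' _ _ hzW]
    congr 1; ext x; simp; ring
  rw [← hA]
  set e := u₁ + (-1 : ℝ) • u with he
  obtain ⟨du, huW, hu'⟩ := hu
  have huc := (hW.memV huW).continuousOn
  have hec := (hW.memV heW).continuousOn
  have hr : MemLp (fun x => u x - u_d x) 2 volOmega :=
    (memLp_of_continuousOn huc 2).sub (hd.desired.mono_exponent le_top)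
  have hel : MemLp e 2 volOmega := memLp_of_continuousOn hec 2
  apply nonneg_of_forall_add_mul (B := 1 / 2 * ∫ x in Omega, e x ^ 2)
  intro t ht0 ht1
  -- Along the segment from `q` to `q₁` the tracking term is a quadratic polynomial in `t`, while
  -- the total variation is bounded by convexity.
  have hqt := hq.combo hq₁ (1 - t) t
  have hst : IsState W a d₀ ((1 - t) • q + t • q₁) (u + t • e) := by
    have := hW.isState_combo hd hq.integrable hqd ⟨du, huW, hu'⟩ ⟨de, heW, he'⟩ t
    convert this using 1
    ext x; simp; ring
  have h1 := hmin _ _ _ hqt hst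
  have h2 := measNorm_combo_le (1 - t) t μ μ₁
  rw [abs_of_nonneg (by linarith), abs_of_nonneg ht0.le] at h2
  unfold cost at h1
  have i1 : IntegrableOn (fun x => (u x - u_d x) ^ 2) Omega := hr.integrable_sq
  have i2 : IntegrableOn (fun x => e x * (u x - u_d x)) Omega := hel.integrable_mul hr
  have i3 : IntegrableOn (fun x => e x ^ 2) Omega := hel.integrable_sq
  have e1 : ∫ x in Omega, ((u + t • e) x - u_d x) ^ 2 = (∫ x in Omega, (u x - u_d x) ^ 2)
      + 2 * t * (∫ x in Omega, e x * (u x - u_d x)) + t ^ 2 * ∫ x in Omega, e x ^ 2 := by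
    rw [← integral_const_mul, ← integral_const_mul, ← integral_add i1 (i2.const_mul _)]
    have i4 : IntegrableOn
      (fun x => (u x - u_d x) ^ 2 + 2 * t * (e x * (u x - u_d x))) Omega :=
      i1.add (i2.const_mul _)
    rw [← integral_add i4 (i3.const_mul _)]
    congr 1; ext x; simp; ring
  rw [e1] at h1
  have h3 := mul_le_mul_of_nonneg_left h2 hd.alpha_pos.le
  nlinarith

/-- The variational inequality satisfied by an optimal control `q` with `q' = μ`. -/
def IsStationary (α : ℝ) (z q : ℝ → ℝ) (μ : SignedMeasure ℝ) : Prop :=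
  ∀ q₁ μ₁, MemBV q₁ μ₁ →
    0 ≤ (∫ x in Omega, z x * (q₁ x - q x)) + α * (measNorm μ₁ - measNorm μ)

variable {z q : ℝ → ℝ} {μ : SignedMeasure ℝ}

/-- Adding a constant of either sign to `q` does not change the total variation, so `z` must be
orthogonal to constants. -/
theorem IsStationary.primitive_one (h : IsStationary α z q μ) (hq : MemBV q μ) :
    primitive z 1 = 0 := by
  have key : ∀ c : ℝ, 0 ≤ c * primitive z 1 := by
    intro c
    have := h _ _ (hq.combo (MemBV.const c) 1 1)
    simp only [one_smul, add_zero, smul_zero, sub_self, mul_zero, Pi.add_apply,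
      add_sub_cancel_left] at this
    rw [integral_mul_const, ← BVControl.primitive_one] at this
    linarith
  linarith [key 1, key (-1)]

/-- Euler's identity for the positively homogeneous total variation: the competitors `0` and `2q`
give the two inequalities. -/
theorem IsStationary.integral_eq (h : IsStationary α z q μ) (hα : 0 < α) (hq : MemBV q μ) :
    ∫ x in Omega, z x * q x = - (α * measNorm μ) := by
  have h0 := h _ _ MemBV.zero
  have h2 := h _ _ (hq.combo hq 1 1)
  have e : ∀ x, ((1 : ℝ) • q + (1 : ℝ) • q) x - q x = q x := fun x => by simp
  simp only [e] at h2
  simp only [Pi.zero_apply, zero_sub, mul_neg, integral_neg, measNorm_zero] at h0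
  have h3 := measNorm_combo_le 1 1 μ μ
  simp only [abs_one, one_mul] at h3
  nlinarith [mul_le_mul_of_nonneg_left h3 hα.le]

theorem IsStationary.le_integral (h : IsStationary α z q μ) (hα : 0 < α) (hq : MemBV q μ)
    (hz : ContinuousOn z (Set.Icc 0 1)) {q₁ : ℝ → ℝ} {μ₁ : SignedMeasure ℝ} (h₁ : MemBV q₁ μ₁) :
    0 ≤ (∫ x in Omega, z x * q₁ x) + α * measNorm μ₁ := by
  have := h _ _ h₁
  have i1 : IntegrableOn (fun x => z x * q₁ x) Omega := by
    simpa only [mul_comm] using integrableOn_mul_continuousOn h₁.integrable hz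
  have i2 : IntegrableOn (fun x => z x * q x) Omega := by
    simpa only [mul_comm] using integrableOn_mul_continuousOn hq.integrable hz
  simp_rw [mul_sub] at this
  rw [integral_sub i1 i2, h.integral_eq hα hq] at this
  linarith

/-- The competitors `±1_{(y,1)}` have total variation at most one, and `z` integrates to `-Φ(y)`
over `(y, 1)`. -/
theorem IsStationary.abs_primitive_le (h : IsStationary α z q μ) (hα : 0 < α) (hq : MemBV q μ)
    (hz : ContinuousOn z (Set.Icc 0 1)) {y : ℝ} (hy : y ∈ Omega) : |primitive z y| ≤ α := by
  have hzi := continuousOn_integrableOn hz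
  have e : ∫ x in Omega, z x * (Set.Ioi y).indicator (fun _ => (1 : ℝ)) x = - primitive z y := by
    rw [← zero_sub, ← h.primitive_one hq, ← setIntegral_indicator_Ioi hzi hy]
    congr 1; ext x; simp [Set.indicator_apply]
  have h1 := h.le_integral hα hq hz (memBV_indicator hy)
  have h2 := h.le_integral hα hq hz ((memBV_indicator hy).combo MemBV.zero (-1) 0)
  have h3 := measNorm_combo_le (-1) 0 (Measure.dirac y).toSignedMeasure 0
  have e2 : ∫ x in Omega, z x *
      ((-1 : ℝ) • ((Set.Ioi y).indicator fun _ => (1 : ℝ)) + (0 : ℝ) • (0 : ℝ → ℝ)) x =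
      - ∫ x in Omega, z x * (Set.Ioi y).indicator (fun _ => (1 : ℝ)) x := by
    rw [← integral_neg]
    congr 1; ext x; simp
  rw [e2, e, neg_neg] at h2
  rw [e, measNorm_dirac] at h1
  simp only [measNorm_dirac, abs_neg, abs_one, abs_zero, mul_one, zero_mul, add_zero] at h3
  rw [abs_le]
  constructor
  · have := mul_le_mul_of_nonneg_left h3 hα.le
    simp only [mul_one] at this
    linarith
  · linarith

/-- The derivative of an optimal control is concentrated where the multiplier is extremal. -/
theorem IsStationary.ae_abs_primitive_eq (h : IsStationary α z q μ) (hα : 0 < α)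
    (hq : MemBV q μ) (hz : ContinuousOn z (Set.Icc 0 1)) :
    (∀ᵐ y ∂μ.toJordanDecomposition.posPart, y ∈ Omega ∧ |primitive z y| = α) ∧
      ∀ᵐ y ∂μ.toJordanDecomposition.negPart, y ∈ Omega ∧ |primitive z y| = α := by
  set P := μ.toJordanDecomposition.posPart with hP
  set N := μ.toJordanDecomposition.negPart with hN
  have hzi := continuousOn_integrableOn hz
  have hc := primitive_continuousOn hzi
  have hP0 : P Omegaᶜ = 0 := posPart_compl hq.concentrated
  have hN0 : N Omegaᶜ = 0 := negPart_compl hq.concentrated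
  have hPm : ∀ᵐ y ∂P, y ∈ Omega := by rw [ae_iff]; exact hP0
  have hNm : ∀ᵐ y ∂N, y ∈ Omega := by rw [ae_iff]; exact hN0
  have iP : Integrable (primitive z) P := integrable_of_concentrated hP0 hc
  have iN : Integrable (primitive z) N := integrable_of_concentrated hN0 hc
  have h1 := hq.integral_mul hzi (h.primitive_one hq)
  rw [h.integral_eq hα hq, neg_inj] at h1
  unfold integralSigned at h1
  rw [measNorm_eq, ← hP, ← hN] at h1
  have iP' : Integrable (fun y => α - primitive z y) P := (integrable_const α).sub iP
  have iN' : Integrable (fun y => α + primitive z y) N := (integrable_const α).add iN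
  have e1 : ∫ y, (α - primitive z y) ∂P = α * P.real Set.univ - ∫ y, primitive z y ∂P := by
    rw [integral_sub (integrable_const α) iP]; simp [mul_comm]
  have e2 : ∫ y, (α + primitive z y) ∂N = α * N.real Set.univ + ∫ y, primitive z y ∂N := by
    rw [integral_add (integrable_const α) iN]; simp [mul_comm]
  -- Euler's identity says that the integrals of `α - Φ` against `P` and of `α + Φ` against `N` add
  -- up to zero. Both integrands are nonnegative, hence both vanish almost everywhere.
  have n1 : 0 ≤ᵐ[P] fun y => α - primitive z y := by
    filter_upwards [hPm] with y hy
    have := (abs_le.1 (h.abs_primitive_le hα hq hz hy)).2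
    simpa using this
  have n2 : 0 ≤ᵐ[N] fun y => α + primitive z y := by
    filter_upwards [hNm] with y hy
    have := (abs_le.1 (h.abs_primitive_le hα hq hz hy)).1
    simp only [Pi.zero_apply]; linarith
  have p1 := integral_nonneg_of_ae n1
  have p2 := integral_nonneg_of_ae n2
  have z1 : ∫ y, (α - primitive z y) ∂P = 0 := by linarith
  have z2 : ∫ y, (α + primitive z y) ∂N = 0 := by linarith
  rw [integral_eq_zero_iff_of_nonneg_ae n1 iP'] at z1
  rw [integral_eq_zero_iff_of_nonneg_ae n2 iN'] at z2
  constructor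
  · filter_upwards [z1, hPm] with y hy hm
    refine ⟨hm, ?_⟩
    have : primitive z y = α := by simp only [Pi.zero_apply] at hy; linarith
    rw [this, abs_of_pos hα]
  · filter_upwards [z2, hNm] with y hy hm
    refine ⟨hm, ?_⟩
    have : primitive z y = -α := by simp only [Pi.zero_apply] at hy; linarith
    rw [this, abs_neg, abs_of_pos hα]

theorem measureReal_Iio_of_ae_mem_range {ν : Measure ℝ} [IsFiniteMeasure ν] {m : ℕ}
    {x : Fin m → ℝ} (hx : Function.Injective x) (h : ∀ᵐ y ∂ν, y ∈ Set.range x) (t : ℝ) :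
    ν.real (Set.Iio t) = ∑ i, ν.real {x i} * (Set.Ioi (x i)).indicator (fun _ => 1) t := by
  classical
  have e : ν.real (Set.Iio t) = ν.real ((Finset.univ.filter fun i => x i < t).image x) := by
    apply measureReal_congr
    filter_upwards [h] with y hy
    obtain ⟨i, rfl⟩ := hy
    simp only [eq_iff_iff]
    constructor
    · intro hi
      change x i ∈ (((Finset.univ.filter fun i => x i < t).image x : Finset ℝ) : Set ℝ)
      simp only [Finset.coe_image, Finset.coe_filter, Finset.mem_univ, true_and]
      exact ⟨i, hi, rfl⟩
    · intro hi
      change x i ∈ (((Finset.univ.filter fun i => x i < t).image x : Finset ℝ) : Set ℝ) at hi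
      simp only [Finset.coe_image, Finset.coe_filter, Finset.mem_univ, true_and] at hi
      obtain ⟨j, hj, hji⟩ := hi
      rw [← hji]; exact hj
  rw [e, ← sum_measureReal_singleton, Finset.sum_image (fun i _ j _ hij => hx hij),
    Finset.sum_filter]
  apply Finset.sum_congr rfl
  intro i _
  by_cases hi : x i < t <;> simp [hi]

/-- A derivative carried by finitely many points is a sum of point masses, whose distribution
function is a step function; the jumps are the masses. Used for `q` with the extremal points of `Φ`,
and for `q_h` with the roots of `z_h`. -/
theorem IsStationary.ae_eq_stepFun (h : IsStationary α z q μ) (hα : 0 < α)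
    (hq : MemBV q μ) (hz : ContinuousOn z (Set.Icc 0 1)) {m : ℕ} {x : Fin m → ℝ}
    (hx : Function.Injective x) (hset : ∀ y ∈ Omega, |primitive z y| = α → y ∈ Set.range x) :
    ∃ c, q =ᵐ[volOmega] stepFun c (fun i => μ {x i}) x := by
  obtain ⟨h1, h2⟩ := h.ae_abs_primitive_eq hα hq hz
  obtain ⟨c, hc⟩ := hq.ae_eq
  refine ⟨c, ?_⟩
  have hm : ∀ᵐ y ∂volOmega, y ∈ Omega := ae_restrict_mem measurableSet_Ioo
  filter_upwards [hc, hm] with t ht htm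
  rw [ht, signed_apply_Iio,
    measureReal_Iio_of_ae_mem_range hx (h1.mono fun y hy => hset y hy.1 hy.2),
    measureReal_Iio_of_ae_mem_range hx (h2.mono fun y hy => hset y hy.1 hy.2),
    ← Finset.sum_sub_distrib]
  unfold stepFun
  congr 1
  apply Finset.sum_congr rfl
  intro i _
  beta_reduce
  rw [μ.apply_eq_posPart_real_sub_negPart_real (measurableSet_singleton _)]
  have : (Set.Ioo (x i) 1).indicator (fun _ => (1 : ℝ)) t =
      (Set.Ioi (x i)).indicator (fun _ => 1) t := by
    simp only [Set.indicator_apply, Set.mem_Ioo, Set.mem_Ioi, htm.2, and_true]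
  rw [this]; ring

end optimality

end

end BVControl
-- Piecewise constant functions on a mesh and maximum norm stability.
namespace BVControl

noncomputable section

theorem abs_integral_mul_le {f w : ℝ → ℝ} (hf : IntegrableOn f Omega) {B : ℝ}
    (hw : ∀ x ∈ Set.Icc (0 : ℝ) 1, |w x| ≤ B) :
    |∫ x in Omega, f x * w x| ≤ (∫ x in Omega, |f x|) * B := by
  rw [← integral_mul_const, ← Real.norm_eq_abs]
  apply norm_integral_le_of_norm_le (hf.abs.mul_const _)
  rw [ae_omega_iff]
  refine Filter.Eventually.of_forall fun x hx => ?_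
  rw [norm_mul]
  exact mul_le_mul_of_nonneg_left (hw x (Set.Ioo_subset_Icc_self hx)) (abs_nonneg _)

namespace Mesh

variable (M : Mesh)

/-- The length of a cell of the mesh. -/
def len (i : Fin M.l) : ℝ := M.node i.succ - M.node i.castSucc

theorem len_pos (i : Fin M.l) : 0 < M.len i := sub_pos.2 (M.node_lt i)

theorem len_le_width (i : Fin M.l) : M.len i ≤ M.width :=
  le_ciSup (f := fun i : Fin M.l => M.node i.succ - M.node i.castSucc)
    (Set.finite_range _).bddAbove i

theorem l_pos : 0 < M.l := one_pos.trans M.one_lt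

theorem width_pos : 0 < M.width :=
  (M.len_pos ⟨0, M.l_pos⟩).trans_le (M.len_le_width _)

theorem width_le_one : M.width ≤ 1 := by
  have : Nonempty (Fin M.l) := ⟨⟨0, M.l_pos⟩⟩
  apply ciSup_le
  intro i
  linarith [(M.node_mem i.succ).2, (M.node_mem i.castSucc).1]

/-- A cell of the mesh. -/
def cell (i : Fin M.l) : Set ℝ := Set.Ioc (M.node i.castSucc) (M.node i.succ)

theorem exists_mem_cell {x : ℝ} (hx : x ∈ Set.Ioc (0 : ℝ) 1) : ∃ i, x ∈ M.cell i := by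
  have key : ∀ k : Fin (M.l + 1), x ≤ M.node k → ∃ i, x ∈ M.cell i := by
    intro k
    induction k using Fin.induction with
    | zero => intro h; rw [M.node_zero] at h; exact absurd hx.1 (not_lt.2 h)
    | succ i ih =>
      intro h
      by_cases h' : x ≤ M.node i.castSucc
      · exact ih h'
      · exact ⟨i, not_le.1 h', h⟩
  exact key (Fin.last _) (by rw [M.node_last]; exact hx.2)

theorem eq_of_mem_cell {x : ℝ} {i j : Fin M.l} (hi : x ∈ M.cell i) (hj : x ∈ M.cell j) :
    i = j := by
  by_contra hne
  rcases lt_or_gt_of_ne hne with h | h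
  · have : M.node i.succ ≤ M.node j.castSucc :=
      M.strictMono.monotone (Fin.succ_le_castSucc_iff.2 h)
    linarith [hi.2, hj.1]
  · have : M.node j.succ ≤ M.node i.castSucc :=
      M.strictMono.monotone (Fin.succ_le_castSucc_iff.2 h)
    linarith [hj.2, hi.1]

theorem cell_subset (i : Fin M.l) : M.cell i ⊆ Set.Icc 0 1 :=
  Set.Ioc_subset_Icc_self.trans (M.Icc_subset i)

/-- The piecewise constant function with given values on the cells. -/
def step (c : Fin M.l → ℝ) (x : ℝ) : ℝ := ∑ i, c i * (M.cell i).indicator (fun _ => 1) x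

theorem step_apply (c : Fin M.l → ℝ) {i : Fin M.l} {x : ℝ} (hx : x ∈ M.cell i) :
    M.step c x = c i := by
  unfold step
  rw [Finset.sum_eq_single i]
  · simp [hx]
  · intro j _ hj
    rw [Set.indicator_of_notMem (fun h => hj (M.eq_of_mem_cell h hx)), mul_zero]
  · simp

theorem memLp_step (c : Fin M.l → ℝ) : MemLp (M.step c) 2 volOmega := by
  have : M.step c = fun x => ∑ i, (M.cell i).indicator (fun _ => c i) x := by
    ext x
    unfold step
    exact Finset.sum_congr rfl fun i _ => by by_cases h : x ∈ M.cell i <;> simp [h]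
  rw [this]
  exact memLp_finsetSum _ fun i _ => (memLp_const (c i)).indicator measurableSet_Ioc

theorem integrable_step (c : Fin M.l → ℝ) : IntegrableOn (M.step c) Omega :=
  MemLp.integrableOn_omega (M.memLp_step c)

theorem setIntegral_cell {f : ℝ → ℝ} (i : Fin M.l) :
    ∫ x in Omega, (M.cell i).indicator f x =
      ∫ x in M.node i.castSucc..M.node i.succ, f x := by
  rw [cell, setIntegral_indicator measurableSet_Ioc, intervalIntegral.integral_of_le (M.node_lt i).le]
  apply setIntegral_congr_set
  have h1 : ∀ᵐ x : ℝ, x ≠ 1 := by simp [ae_iff]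
  filter_upwards [h1] with x hx
  rw [eq_iff_iff]
  constructor
  · intro h; exact h.2
  · intro h
    exact ⟨⟨(M.node_mem _).1.trans_lt h.1, lt_of_le_of_ne (h.2.trans (M.node_mem _).2) hx⟩, h⟩

theorem integral_mul_step {f : ℝ → ℝ} (hf : IntegrableOn f Omega) (c : Fin M.l → ℝ) :
    ∫ x in Omega, f x * M.step c x =
      ∑ i, c i * ∫ x in M.node i.castSucc..M.node i.succ, f x := by
  have e : ∀ x, f x * M.step c x = ∑ i, c i * (M.cell i).indicator f x := by
    intro x
    unfold step
    rw [Finset.mul_sum]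
    apply Finset.sum_congr rfl
    intro i _
    by_cases h : x ∈ M.cell i <;> simp [h, mul_comm]
  simp_rw [e]
  rw [integral_finsetSum]
  · apply Finset.sum_congr rfl
    intro i _
    rw [integral_const_mul, M.setIntegral_cell]
  · intro i _
    exact Integrable.const_mul (hf.indicator measurableSet_Ioc) _

theorem integral_step (c : Fin M.l → ℝ) : ∫ x in Omega, M.step c x = ∑ i, c i * M.len i := by
  have := M.integral_mul_step (f := fun _ => 1) (integrable_const 1) c
  simpa [len] using this

theorem abs_step (c : Fin M.l → ℝ) {x : ℝ} (hx : x ∈ Omega) :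
    |M.step c x| = M.step (fun i => |c i|) x := by
  obtain ⟨i, hi⟩ := M.exists_mem_cell (Set.Ioo_subset_Ioc_self hx)
  rw [M.step_apply _ hi, M.step_apply _ hi]

theorem integral_abs_step (c : Fin M.l → ℝ) :
    ∫ x in Omega, |M.step c x| = ∑ i, |c i| * M.len i := by
  rw [← M.integral_step]
  exact setIntegral_congr_fun measurableSet_Ioo fun x hx => M.abs_step c hx

theorem ae_of_cell {p : ℝ → Prop} (h : ∀ i, ∀ x ∈ M.cell i, p x) : ∀ᵐ x ∂volOmega, p x := by
  rw [ae_omega_iff]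
  refine Filter.Eventually.of_forall fun x hx => ?_
  obtain ⟨i, hi⟩ := M.exists_mem_cell (Set.Ioo_subset_Ioc_self hx)
  exact h i x hi

/-- Discrete test functions can be prescribed through their slopes, subject only to the zero mean.
This one-dimensional fact replaces estimates of discrete Green's functions. -/
theorem memVh_step (c : Fin M.l → ℝ) (hc : ∑ i, c i * M.len i = 0) :
    MemVh M (primitive (M.step c)) (M.step c) := by
  refine ⟨memV_of_eqOn_primitive (M.memLp_step c) (fun _ _ => rfl)
    (by rw [primitive_one, M.integral_step, hc]), fun i => ?_⟩
  refine ⟨primitive (M.step c) (M.node i.castSucc) - c i * M.node i.castSucc, c i,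
    fun x hx => ?_⟩
  have h := primitive_sub_primitive (M.integrable_step c) (M.node_mem i.castSucc)
    (M.Icc_subset i (Set.Ioo_subset_Icc_self hx))
  have e : ∫ s in M.node i.castSucc..x, M.step c s = ∫ s in M.node i.castSucc..x, c i := by
    apply intervalIntegral.integral_congr_ae
    refine Filter.Eventually.of_forall fun s hs => ?_
    rw [Set.uIoc_of_le hx.1.le] at hs
    exact M.step_apply c ⟨hs.1, hs.2.trans hx.2.le⟩
  rw [e, intervalIntegral.integral_const, smul_eq_mul] at h
  linarith

end Mesh

/-- Away from the null set of nodes, `dv` is almost everywhere the classical slope of `v`; the zero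
mean encodes the boundary values. -/
theorem MemVh.ae_eq_step {M : Mesh} {v dv : ℝ → ℝ} (h : MemVh M v dv) :
    ∃ c, dv =ᵐ[volOmega] M.step c ∧ ∑ i, c i * M.len i = 0 := by
  choose b c hbc using h.2
  have hae : dv =ᵐ[volOmega] M.step c := by
    have hn : ∀ᵐ x ∂volOmega, x ∉ Set.range M.node := by
      apply ae_restrict_of_ae
      exact (Set.finite_range M.node).countable.ae_notMem volume
    have hm : ∀ᵐ x ∂volOmega, x ∈ Omega := ae_restrict_mem measurableSet_Ioo
    filter_upwards [primitive_ae_deriv h.1.integrable_deriv, hn, hm] with x hx hxn hxm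
    obtain ⟨i, hi⟩ := M.exists_mem_cell (Set.Ioo_subset_Ioc_self hxm)
    have hio : x ∈ Set.Ioo (M.node i.castSucc) (M.node i.succ) :=
      ⟨hi.1, lt_of_le_of_ne hi.2 fun he => hxn ⟨_, he.symm⟩⟩
    rw [M.step_apply c hi, ← hx]
    have hev : primitive dv =ᶠ[nhds x] fun y => b i + c i * y := by
      filter_upwards [isOpen_Ioo.mem_nhds hio] with y hy
      rw [← h.1.eqOn_primitive (M.Icc_subset i (Set.Ioo_subset_Icc_self hy)), hbc i y hy]
    rw [hev.deriv_eq]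
    simp
  refine ⟨c, hae, ?_⟩
  rw [← M.integral_step, ← integral_congr_ae hae, h.1.integral_deriv]

section stability

variable {α : ℝ} {a d₀ u_d : ℝ → ℝ}

theorem IsData.exists_abs_potential_le (hd : IsData α a d₀ u_d) :
    ∃ D₀, 0 ≤ D₀ ∧ ∀ (v w : ℝ → ℝ) (A B : ℝ), 0 ≤ A → 0 ≤ B →
      (∀ x ∈ Set.Icc (0 : ℝ) 1, |v x| ≤ A) → (∀ x ∈ Set.Icc (0 : ℝ) 1, |w x| ≤ B) →
      |∫ x in Omega, d₀ x * v x * w x| ≤ D₀ * A * B := by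
  obtain ⟨D, hD0, hD⟩ := exists_ae_abs_le hd.bounded
  refine ⟨D, hD0, fun v w A B hA hB hv hw => ?_⟩
  have := norm_integral_le_of_norm_le_const (μ := volOmega)
    (f := fun x => d₀ x * v x * w x) (C := D * A * B) (by
      have hm : ∀ᵐ x ∂volOmega, x ∈ Omega := ae_restrict_mem measurableSet_Ioo
      filter_upwards [hD, hm] with x hx hm
      have hm' := Set.Ioo_subset_Icc_self hm
      rw [norm_mul, norm_mul]
      exact mul_le_mul (mul_le_mul hx (hv x hm') (norm_nonneg _) hD0) (hw x hm')
        (norm_nonneg _) (by positivity))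
  simpa using this

theorem integral_abs_nonneg (g : ℝ → ℝ) : 0 ≤ ∫ x in Omega, |g x| :=
  integral_nonneg fun _ => abs_nonneg _

/-- Stability of the energy type. -/
theorem IsData.integral_abs_deriv_le (hd : IsData α a d₀ u_d) {ν : ℝ} (hν0 : 0 < ν)
    (hν : ∀ x ∈ Set.Icc (0 : ℝ) 1, ν ≤ a x) {v dv : ℝ → ℝ} (hv : MemV v dv) {D : ℝ}
    (hD : 0 ≤ D) (h : |bilin a d₀ v dv v dv| ≤ D * ∫ x in Omega, |dv x|) :
    ∫ x in Omega, |dv x| ≤ D / ν := by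
  have h1 := hd.le_bilin_self hν (v := v) hv.memLp_deriv
  have h2 := sq_integral_abs_le hv.memLp_deriv
  set m := ∫ x in Omega, |dv x| with hm
  have hm0 : 0 ≤ m := integral_abs_nonneg dv
  rw [le_div_iff₀ hν0]
  by_contra hcon
  push Not at hcon
  have hmpos : 0 < m := by
    rcases hm0.eq_or_lt with h0 | h0
    · rw [← h0, zero_mul] at hcon; linarith
    · exact h0
  have h3 := (le_abs_self _).trans h
  -- Coercivity controls the `L²` norm, Cauchy-Schwarz passes to the `L¹` norm `m`, and one factor
  -- `m > 0` cancels.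
  have h4 : ν * m ^ 2 ≤ D * m := (mul_le_mul_of_nonneg_left h2 hν0.le).trans (h1.trans h3)
  nlinarith

theorem Mesh.integral_principal_step (M : Mesh) (ha : ContinuousOn a (Set.Icc 0 1))
    (c g : Fin M.l → ℝ) : ∫ x in Omega, a x * M.step c x * M.step g x =
      ∑ i, g i * (c i * ∫ x in M.node i.castSucc..M.node i.succ, a x) := by
  have hi : IntegrableOn (fun x => a x * M.step c x) Omega := by
    simpa only [mul_comm] using integrableOn_mul_continuousOn (M.integrable_step c) ha
  rw [M.integral_mul_step hi g]
  apply Finset.sum_congr rfl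
  intro i _
  congr 1
  rw [← intervalIntegral.integral_const_mul]
  apply intervalIntegral.integral_congr_ae
  refine Filter.Eventually.of_forall fun s hs => ?_
  rw [Set.uIoc_of_le (M.node_lt i).le] at hs
  rw [M.step_apply c hs, mul_comm]

/-- Piecewise constant functions whose weighted differences are small are small. -/
theorem abs_le_of_weighted_diff {n : ℕ} {c ℓ β : Fin n → ℝ} {ν D : ℝ} (hν : 0 < ν) (hD : 0 ≤ D)
    (hℓ : ∀ i, 0 < ℓ i) (hβ : ∀ i, ν ≤ β i) (hsum : ∑ i, c i * ℓ i = 0)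
    (hdiff : ∀ i j, |c i * β i - c j * β j| ≤ D) (i : Fin n) : |c i| ≤ D / ν := by
  have hβi := hβ i
  rw [le_div_iff₀ hν]
  rcases lt_trichotomy (c i) 0 with h | h | h
  -- The weighted mean of `c` vanishes, so some value has the opposite sign or is zero; comparing
  -- with it turns a bound on differences into a bound on `c i` itself.
  · obtain ⟨j, hj⟩ : ∃ j, 0 ≤ c j := by
      by_contra hcon
      push Not at hcon
      have : ∑ i, c i * ℓ i < 0 :=
        Finset.sum_neg (fun j _ => mul_neg_of_neg_of_pos (hcon j) (hℓ j)) ⟨i, Finset.mem_univ i⟩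
      linarith
    have h1 := (abs_le.1 (hdiff i j)).1
    have h2 : 0 ≤ c j * β j := mul_nonneg hj (hν.le.trans (hβ j))
    rw [abs_of_neg h]
    nlinarith
  · rw [h]; simpa using hD
  · obtain ⟨j, hj⟩ : ∃ j, c j ≤ 0 := by
      by_contra hcon
      push Not at hcon
      have : 0 < ∑ i, c i * ℓ i :=
        Finset.sum_pos (fun j _ => mul_pos (hcon j) (hℓ j)) ⟨i, Finset.mem_univ i⟩
      linarith
    have h1 := (abs_le.1 (hdiff i j)).2
    have h2 : c j * β j ≤ 0 := mul_nonpos_of_nonpos_of_nonneg hj (hν.le.trans (hβ j))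
    rw [abs_of_pos h]
    nlinarith

/-- Maximum norm stability of the finite element method, for the function and its derivative. -/
theorem IsData.exists_stability (hd : IsData α a d₀ u_d) :
    ∃ C, 0 ≤ C ∧ ∀ (M : Mesh) (v dv : ℝ → ℝ) (D : ℝ), MemVh M v dv → 0 ≤ D →
      (∀ w dw, MemVh M w dw → |bilin a d₀ v dv w dw| ≤ D * ∫ x in Omega, |dw x|) →
      (∀ x ∈ Set.Icc (0 : ℝ) 1, |v x| ≤ C * D) ∧ ∀ᵐ x ∂volOmega, |dv x| ≤ C * D := by
  obtain ⟨ν, hν0, hν⟩ := hd.elliptic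
  obtain ⟨D₀, hD₀, hpot⟩ := hd.exists_abs_potential_le
  -- The factor `2` bounds the `L¹` norm of the test slope below, `1 + D₀ / ν` accounts for moving
  -- the potential term to the right-hand side, and `1 / ν` is ellipticity.
  set C₁ := 2 * (1 + D₀ / ν) / ν with hC₁
  have hC₁0 : 0 ≤ C₁ := by positivity
  refine ⟨1 / ν + C₁, by positivity, fun M v dv D hv hD h => ?_⟩
  have hm := hd.integral_abs_deriv_le hν0 hν hv.1 hD (h v dv hv)
  have hvb : ∀ x ∈ Set.Icc (0 : ℝ) 1, |v x| ≤ D / ν := fun x hx => (hv.1.abs_le hx).trans hm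
  constructor
  · intro x hx
    refine (hvb x hx).trans ?_
    rw [div_eq_mul_one_div, mul_comm D]
    exact mul_le_mul_of_nonneg_right (by linarith) hD
  obtain ⟨c, hc, hsum⟩ := hv.ae_eq_step
  set A : Fin M.l → ℝ := fun i => ∫ x in M.node i.castSucc..M.node i.succ, a x with hA
  have hAν : ∀ i, ν ≤ A i / M.len i := by
    intro i
    rw [le_div_iff₀ (M.len_pos i)]
    have : ∫ x in M.node i.castSucc..M.node i.succ, ν ≤ A i := by
      apply intervalIntegral.integral_mono_on (M.node_lt i).le (by simp)
      · exact (hd.continuousOn.mono (by rw [Set.uIcc_of_le (M.node_lt i).le]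
                                        exact M.Icc_subset i)).intervalIntegrable
      · intro x hx; exact hν x (M.Icc_subset i hx)
    simpa [Mesh.len, mul_comm] using this
  -- The potential term is of lower order: it is bounded by the energy estimate for `v`, which
  -- leaves a purely algebraic relation between the slopes.
  have key : ∀ g : Fin M.l → ℝ, ∑ i, g i * M.len i = 0 →
      |∑ i, g i * (c i * A i)| ≤ D * (1 + D₀ / ν) * ∑ i, |g i| * M.len i := by
    intro g hg
    have hw := M.memVh_step g hg
    have h1 := h _ _ hw
    have h2 := hpot v (primitive (M.step g)) (D / ν) (∫ x in Omega, |M.step g x|)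
      (by positivity) (integral_abs_nonneg _) hvb (fun x hx => hw.1.abs_le hx)
    rw [bilin_congr (fun _ _ => rfl) hc (fun _ _ => rfl) (Filter.EventuallyEq.refl _ _)] at h1
    unfold bilin at h1
    rw [M.integral_principal_step hd.continuousOn, M.integral_abs_step] at h1
    rw [M.integral_abs_step] at h2
    set S := ∑ i, |g i| * M.len i
    set T := ∫ x in Omega, d₀ x * v x * primitive (M.step g) x
    have h3 := abs_sub_abs_le_abs_sub (∑ i, g i * (c i * A i)) (-T)
    rw [sub_neg_eq_add, abs_neg] at h3
    have : D * (1 + D₀ / ν) * S = D * S + D₀ * (D / ν) * S := by ring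
    rw [this]
    linarith
  have hdiff : ∀ i j, |c i * (A i / M.len i) - c j * (A j / M.len j)| ≤
      2 * (D * (1 + D₀ / ν)) := by
    intro i j
    -- The indicator of cell `i` with integral one. The difference of two of these has mean zero and
    -- `L¹` norm at most `2`, whatever the cell lengths, so `c i` times the cell average of `a` is
    -- nearly independent of `i`.
    set e : Fin M.l → Fin M.l → ℝ := fun i k => if k = i then 1 / M.len i else 0 with he
    have e0 : ∀ i k, 0 ≤ e i k := by
      intro i k
      simp only [he]
      split_ifs
      · exact (one_div_pos.2 (M.len_pos _)).le
      · exact le_rfl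
    have esum : ∀ (i) (f : Fin M.l → ℝ), ∑ k, e i k * f k = 1 / M.len i * f i := by
      intro i f
      simp [he]
    have elen : ∀ i, ∑ k, e i k * M.len k = 1 := by
      intro i
      rw [esum, one_div_mul_cancel (M.len_pos i).ne']
    have hk := key (fun k => e i k - e j k) (by
      simp only [sub_mul, Finset.sum_sub_distrib, elen, sub_self])
    have hs : ∑ k, |e i k - e j k| * M.len k ≤ 2 := by
      calc _ ≤ ∑ k, (e i k * M.len k + e j k * M.len k) := by
            apply Finset.sum_le_sum
            intro k _
            rw [← add_mul]
            apply mul_le_mul_of_nonneg_right _ (M.len_pos k).le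
            refine (abs_sub _ _).trans ?_
            rw [abs_of_nonneg (e0 i k), abs_of_nonneg (e0 j k)]
        _ = 2 := by rw [Finset.sum_add_distrib, elen, elen]; norm_num
    simp only [sub_mul, Finset.sum_sub_distrib, esum] at hk
    have ecomm : ∀ k, 1 / M.len k * (c k * A k) = c k * (A k / M.len k) := fun k => by ring
    rw [ecomm, ecomm] at hk
    refine hk.trans ?_
    have hp : 0 ≤ D * (1 + D₀ / ν) := by positivity
    have := mul_le_mul_of_nonneg_left hs hp
    linarith
  have hfin := abs_le_of_weighted_diff hν0 (by positivity) M.len_pos hAν hsum hdiff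
  have hst := M.ae_of_cell (p := fun x => |M.step c x| ≤ (1 / ν + C₁) * D) (by
    intro i x hx
    rw [M.step_apply c hx]
    refine (hfin i).trans ?_
    have e : 2 * (D * (1 + D₀ / ν)) / ν = C₁ * D := by rw [hC₁]; ring
    rw [e]
    exact mul_le_mul_of_nonneg_right (by linarith [one_div_pos.2 hν0]) hD)
  filter_upwards [hc, hst] with x h1 h2
  rw [h1]; exact h2

/-- An `L¹` right-hand side is admissible, since the maximum norm of a test function is at most the
`L¹` norm of its derivative. -/
theorem IsData.exists_stability_state (hd : IsData α a d₀ u_d) :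
    ∃ C, 0 ≤ C ∧ ∀ (M : Mesh) (v dv f : ℝ → ℝ), MemVh M v dv → IntegrableOn f Omega →
      (∀ w dw, MemVh M w dw → bilin a d₀ v dv w dw = ∫ x in Omega, f x * w x) →
      (∀ x ∈ Set.Icc (0 : ℝ) 1, |v x| ≤ C * ∫ x in Omega, |f x|) ∧
        ∀ᵐ x ∂volOmega, |dv x| ≤ C * ∫ x in Omega, |f x| := by
  obtain ⟨C, hC, h⟩ := hd.exists_stability
  refine ⟨C, hC, fun M v dv f hv hf hs => h M v dv _ hv (integral_abs_nonneg f) ?_⟩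
  intro w dw hw
  rw [hs w dw hw]
  exact abs_integral_mul_le hf fun x hx => hw.1.abs_le hx

end stability

end

end BVControl
-- Regularity, interpolation and maximum norm finite element errors.
namespace BVControl

noncomputable section

section regularity

variable {α : ℝ} {a d₀ u_d : ℝ → ℝ}

/-- A primitive of a bounded function is Lipschitz continuous. -/
theorem abs_integral_sub_le {r : ℝ → ℝ} {B : ℝ} (hB : ∀ᵐ x ∂volOmega, |r x| ≤ B) {x y : ℝ}
    (hx : x ∈ Set.Icc (0 : ℝ) 1) (hy : y ∈ Set.Icc (0 : ℝ) 1) :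
    |∫ s in x..y, r s| ≤ B * |y - x| := by
  rw [← Real.norm_eq_abs]
  apply intervalIntegral.norm_integral_le_of_norm_le_const_ae
  filter_upwards [ae_Icc_of_ae_omega hB] with s hs hm
  exact hs (Set.uIcc_subset_Icc hx hy (Set.uIoc_subset_uIcc hm))

theorem abs_div_sub_div_le {n₁ n₂ a₁ a₂ ν A B s t : ℝ} (hν : 0 < ν) (h₁ : ν ≤ a₁) (h₂ : ν ≤ a₂)
    (hA : |a₂| ≤ A) (hB : |n₂| ≤ B) (hn : |n₁ - n₂| ≤ s) (ha : |a₁ - a₂| ≤ t) :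
    |n₁ / a₁ - n₂ / a₂| ≤ (s * A + B * t) / ν ^ 2 := by
  have p₁ := hν.trans_le h₁
  have p₂ := hν.trans_le h₂
  have e : n₁ / a₁ - n₂ / a₂ = ((n₁ - n₂) * a₂ - n₂ * (a₁ - a₂)) / (a₁ * a₂) := by
    field_simp; ring
  rw [e, abs_div, abs_of_pos (mul_pos p₁ p₂)]
  have hs : 0 ≤ s := (abs_nonneg _).trans hn
  have hB' : 0 ≤ B := (abs_nonneg _).trans hB
  have h3 : |(n₁ - n₂) * a₂ - n₂ * (a₁ - a₂)| ≤ s * A + B * t := by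
    refine (abs_sub _ _).trans ?_
    rw [abs_mul, abs_mul]
    exact add_le_add (mul_le_mul hn hA (abs_nonneg _) hs) (mul_le_mul hB ha (abs_nonneg _) hB')
  apply div_le_div₀ ((abs_nonneg _).trans h3) h3 (by positivity)
  nlinarith

/-- Regularity of the state for a bounded right-hand side. -/
theorem IsData.exists_lipschitz_deriv (hd : IsData α a d₀ u_d) {u du f : ℝ → ℝ}
    (hu : MemV u du) (hf : IntegrableOn f Omega) (hfb : ∃ F, ∀ᵐ x ∂volOmega, |f x| ≤ F)
    (hs : ∀ w dw, MemV w dw → bilin a d₀ u du w dw = ∫ x in Omega, f x * w x) :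
    ∃ (g : ℝ → ℝ) (L : ℝ), 0 ≤ L ∧ (∀ x ∈ Set.Icc (0 : ℝ) 1, ∀ y ∈ Set.Icc (0 : ℝ) 1,
      |g x - g y| ≤ L * |x - y|) ∧ du =ᵐ[volOmega] g := by
  obtain ⟨ν, hν0, hν⟩ := hd.elliptic
  obtain ⟨K, hK⟩ := hd.lipschitz
  obtain ⟨A, hA0, hA⟩ := hd.exists_abs_le
  obtain ⟨D, hD0, hD⟩ := exists_ae_abs_le hd.bounded
  obtain ⟨F, hF⟩ := hfb
  obtain ⟨U, hU⟩ := isCompact_Icc.exists_bound_of_continuousOn hu.continuousOn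
  have hd0 : IntegrableOn (fun x => d₀ x * u x) Omega :=
    integrableOn_mul_continuousOn (hd.bounded.integrable le_top) hu.continuousOn
  set r : ℝ → ℝ := fun x => f x - d₀ x * u x with hr
  have hri : IntegrableOn r Omega := hf.sub hd0
  have hm : ∀ᵐ x ∂volOmega, x ∈ Omega := ae_restrict_mem measurableSet_Ioo
  have hrb : ∀ᵐ x ∂volOmega, |r x| ≤ max (F + D * U) 0 := by
    filter_upwards [hF, hD, hm] with x h1 h2 h3
    refine le_trans ?_ (le_max_left _ _)
    refine (abs_sub _ _).trans (add_le_add h1 ?_)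
    rw [abs_mul]
    exact mul_le_mul h2 (hU x (Set.Ioo_subset_Icc_self h3)) (abs_nonneg _) hD0
  set R := max (F + D * U) 0 with hR
  have hR0 : 0 ≤ R := le_max_right _ _
  have hai : IntegrableOn (fun x => du x * a x) Omega :=
    integrableOn_mul_continuousOn hu.integrable_deriv hd.continuousOn
  have hPi : IntegrableOn (primitive r) Omega :=
    continuousOn_integrableOn (primitive_continuousOn hri)
  -- The equation says that the flux `a u'` has weak derivative `-r`, so the flux plus the primitive
  -- of `r` is constant. Hence `u'` is a quotient of Lipschitz functions with denominator at least
  -- `ν`.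
  obtain ⟨c, hc⟩ := ae_const_of_integral_deriv_eq_zero
    (f := fun x => du x * a x + primitive r x) (hai.add hPi) (by
    intro φ hφ
    have hφV : MemV φ (deriv φ) := memV_of_eqOn_primitive
      (memLp_of_continuousOn hφ.deriv_continuous.continuousOn 2)
      (fun x _ => (hφ.primitive_deriv x).symm) (by rw [hφ.primitive_deriv, hφ.eq_zero (by simp)])
    have h1 := hs φ _ hφV
    have h2 := ibp_omega hri hφ.deriv_integrable
    simp only [hφ.primitive_deriv, hφ.eq_zero (x := 1) (by simp), mul_zero, zero_sub] at h2
    unfold bilin at h1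
    have i1 := integrableOn_mul_continuousOn hai hφ.deriv_continuous.continuousOn
    have i2 := integrableOn_mul_continuousOn hPi hφ.deriv_continuous.continuousOn
    have i3 := integrableOn_mul_continuousOn hf hφ.smooth.continuous.continuousOn
    have i4 := integrableOn_mul_continuousOn hd0 hφ.smooth.continuous.continuousOn
    have e1 : ∫ x in Omega, (du x * a x + primitive r x) * deriv φ x =
        (∫ x in Omega, du x * a x * deriv φ x) + ∫ x in Omega, primitive r x * deriv φ x := by
      simp_rw [add_mul]; exact integral_add i1 i2
    have e2 : ∫ x in Omega, r x * φ x =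
        (∫ x in Omega, f x * φ x) - ∫ x in Omega, d₀ x * u x * φ x := by
      simp_rw [hr, sub_mul]; exact integral_sub i3 i4
    have e3 : ∫ x in Omega, du x * a x * deriv φ x = ∫ x in Omega, a x * du x * deriv φ x := by
      simp_rw [mul_comm (du _)]
    rw [e1, h2, e2, e3]
    linarith)
  have hPb : ∀ x ∈ Set.Icc (0 : ℝ) 1, |primitive r x| ≤ R := by
    intro x hx
    have := abs_integral_sub_le hrb (x := 0) (by simp) hx
    refine this.trans ?_
    rw [sub_zero, abs_of_nonneg hx.1]
    exact mul_le_of_le_one_right hR0 hx.2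
  refine ⟨fun x => (c - primitive r x) / a x, (R * A + (|c| + R) * K) / ν ^ 2, by positivity,
    fun x hx y hy => ?_, ?_⟩
  · have h := abs_div_sub_div_le (n₁ := c - primitive r x) (n₂ := c - primitive r y)
      (s := R * |x - y|) (t := K * |x - y|) (B := |c| + R) hν0 (hν x hx) (hν y hy) (hA y hy)
      ((abs_sub _ _).trans (add_le_add le_rfl (hPb y hy))) (by
        rw [sub_sub_sub_cancel_left, primitive_sub_primitive hri hx hy, abs_sub_comm x y]
        exact abs_integral_sub_le hrb hx hy) (by
        have := hK.dist_le_mul x hx y hy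
        simpa [Real.dist_eq] using this)
    refine h.trans (le_of_eq ?_)
    ring
  · filter_upwards [hc, hm] with x h1 h2
    have := hν x (Set.Ioo_subset_Icc_self h2)
    rw [eq_div_iff (hν0.trans_le this).ne']
    linarith

theorem continuousOn_of_abs_sub_le {g : ℝ → ℝ} {L : ℝ} (hL : 0 ≤ L)
    (h : ∀ x ∈ Set.Icc (0 : ℝ) 1, ∀ y ∈ Set.Icc (0 : ℝ) 1, |g x - g y| ≤ L * |x - y|) :
    ContinuousOn g (Set.Icc 0 1) := by
  have : LipschitzOnWith ⟨L, hL⟩ g (Set.Icc 0 1) :=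
    LipschitzOnWith.of_dist_le_mul fun x hx y hy => by
      rw [Real.dist_eq, Real.dist_eq]; exact h x hx y hy
  exact this.continuousOn

theorem Mesh.primitive_node_eq_zero (M : Mesh) {e : ℝ → ℝ} (he : IntegrableOn e Omega)
    (h : ∀ i : Fin M.l, ∫ x in M.node i.castSucc..M.node i.succ, e x = 0) (k : Fin (M.l + 1)) :
    primitive e (M.node k) = 0 := by
  induction k using Fin.induction with
  | zero => rw [M.node_zero, primitive_zero]
  | succ i ih =>
    have := primitive_sub_primitive he (M.node_mem i.castSucc) (M.node_mem i.succ)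
    rw [h i, ih] at this
    linarith

/-- Estimates for the interpolation of a function with Lipschitz continuous derivative. -/
theorem Mesh.exists_interpolant (M : Mesh) {u g : ℝ → ℝ} {L : ℝ} (hL : 0 ≤ L) (hu : MemV u g)
    (hg : ∀ x ∈ Set.Icc (0 : ℝ) 1, ∀ y ∈ Set.Icc (0 : ℝ) 1, |g x - g y| ≤ L * |x - y|) :
    ∃ c : Fin M.l → ℝ, MemVh M (primitive (M.step c)) (M.step c) ∧
      (∀ i, ∀ x ∈ M.cell i, |g x - c i| ≤ L * M.width) ∧
      (∀ i, ∫ x in M.node i.castSucc..M.node i.succ, (g x - c i) = 0) ∧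
      ∀ x ∈ Set.Icc (0 : ℝ) 1, |u x - primitive (M.step c) x| ≤ L * M.width ^ 2 := by
  have hgc := continuousOn_of_abs_sub_le hL hg
  have hii : ∀ i : Fin M.l, IntervalIntegrable g volume (M.node i.castSucc) (M.node i.succ) :=
    fun i => intervalIntegrable_of_omega hu.integrable_deriv (M.node_mem _) (M.node_mem _)
  -- Cell averages of `u'` are the slopes of the nodal interpolant. Their interpolation error
  -- vanishes at the nodes, so inside a cell it is the integral of a function of size `L h` over a
  -- length at most `h`.
  set c : Fin M.l → ℝ := fun i =>
    (∫ x in M.node i.castSucc..M.node i.succ, g x) / M.len i with hc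
  have hcl : ∀ i, c i * M.len i = ∫ x in M.node i.castSucc..M.node i.succ, g x :=
    fun i => div_mul_cancel₀ _ (M.len_pos i).ne'
  have hmean : ∀ i, ∫ x in M.node i.castSucc..M.node i.succ, (g x - c i) = 0 := by
    intro i
    rw [intervalIntegral.integral_sub (hii i) (by simp), ← hcl, intervalIntegral.integral_const]
    simp [Mesh.len, mul_comm]
  have hsum : ∑ i, c i * M.len i = 0 := by
    simp_rw [hcl]
    have := M.integral_mul_step hu.integrable_deriv (fun _ => 1)
    simp only [one_mul] at this
    rw [← this, ← hu.integral_deriv]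
    apply setIntegral_congr_fun measurableSet_Ioo
    intro x hx
    obtain ⟨i, hi⟩ := M.exists_mem_cell (Set.Ioo_subset_Ioc_self hx)
    simp only [M.step_apply _ hi, mul_one]
  have hdiff : ∀ i, ∀ x ∈ M.cell i, |g x - c i| ≤ L * M.width := by
    intro i x hx
    have hx' := M.cell_subset i hx
    have h1 : (g x - c i) * M.len i = ∫ y in M.node i.castSucc..M.node i.succ, (g x - g y) := by
      rw [intervalIntegral.integral_sub (by simp) (hii i), intervalIntegral.integral_const,
        sub_mul, hcl]
      simp [Mesh.len, mul_comm]
    have h2 : |∫ y in M.node i.castSucc..M.node i.succ, (g x - g y)| ≤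
        L * M.width * |M.node i.succ - M.node i.castSucc| := by
      rw [← Real.norm_eq_abs]
      apply intervalIntegral.norm_integral_le_of_norm_le_const
      intro y hy
      rw [Set.uIoc_of_le (M.node_lt i).le] at hy
      refine (hg x hx' y (M.cell_subset i hy)).trans ?_
      apply mul_le_mul_of_nonneg_left _ hL
      refine le_trans ?_ (M.len_le_width i)
      rw [abs_le, Mesh.len]
      constructor <;> linarith [hx.1, hx.2, hy.1, hy.2]
    rw [← h1, abs_mul] at h2
    exact le_of_mul_le_mul_right h2 (abs_pos.2 (M.len_pos i).ne')
  refine ⟨c, M.memVh_step c hsum, hdiff, hmean, fun x hx => ?_⟩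
  set e : ℝ → ℝ := g + (-1 : ℝ) • M.step c with he
  have hei : IntegrableOn e Omega :=
    hu.integrable_deriv.add ((M.integrable_step c).smul (-1 : ℝ))
  have hcell : ∀ (i) (y), y ∈ Set.Icc (M.node i.castSucc) (M.node i.succ) →
      ∫ s in M.node i.castSucc..y, e s = ∫ s in M.node i.castSucc..y, (g s - c i) := by
    intro i y hy
    apply intervalIntegral.integral_congr_ae
    refine Filter.Eventually.of_forall fun s hs => ?_
    rw [Set.uIoc_of_le hy.1] at hs
    simp only [he, Pi.add_apply, Pi.smul_apply, M.step_apply c ⟨hs.1, hs.2.trans hy.2⟩,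
      smul_eq_mul]
    ring
  have hnode := M.primitive_node_eq_zero hei fun i => by
    rw [hcell i _ (Set.right_mem_Icc.2 (M.node_lt i).le), hmean i]
  have hux : u x - primitive (M.step c) x = primitive e x := by
    rw [primitive_add_smul hu.integrable_deriv (M.integrable_step c) (-1) hx,
      hu.eqOn_primitive hx]
    ring
  rw [hux]
  rcases hx.1.eq_or_lt with h0 | h0
  · rw [← h0, primitive_zero, abs_zero]
    exact mul_nonneg hL (sq_nonneg _)
  obtain ⟨i, hi⟩ := M.exists_mem_cell ⟨h0, hx.2⟩
  have h1 := primitive_sub_primitive hei (M.node_mem i.castSucc) hx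
  rw [hnode, sub_zero, hcell i x (Set.Ioc_subset_Icc_self hi)] at h1
  have h2 : |∫ s in M.node i.castSucc..x, (g s - c i)| ≤
      L * M.width * |x - M.node i.castSucc| := by
    rw [← Real.norm_eq_abs]
    apply intervalIntegral.norm_integral_le_of_norm_le_const
    intro y hy
    rw [Set.uIoc_of_le hi.1.le] at hy
    exact hdiff i y ⟨hy.1, hy.2.trans hi.2⟩
  rw [h1]
  refine h2.trans ?_
  rw [sq, ← mul_assoc]
  apply mul_le_mul_of_nonneg_left _ (mul_nonneg hL M.width_pos.le)
  rw [abs_of_pos (sub_pos.2 hi.1)]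
  refine le_trans ?_ (M.len_le_width i)
  rw [Mesh.len]
  linarith [hi.2]

/-- Maximum norm estimates of the finite element error, without a condition on the mesh. -/
theorem IsData.exists_fe_estimate (hd : IsData α a d₀ u_d) :
    ∃ C, 0 ≤ C ∧ ∀ (M : Mesh) (u g u_h du_h : ℝ → ℝ) (L : ℝ), 0 ≤ L → MemV u g →
      (∀ x ∈ Set.Icc (0 : ℝ) 1, ∀ y ∈ Set.Icc (0 : ℝ) 1, |g x - g y| ≤ L * |x - y|) →
      MemVh M u_h du_h →
      (∀ w dw, MemVh M w dw → bilin a d₀ u g w dw = bilin a d₀ u_h du_h w dw) →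
      (∀ x ∈ Set.Icc (0 : ℝ) 1, |u x - u_h x| ≤ C * L * M.width ^ 2) ∧
        ∀ᵐ x ∂volOmega, |g x - du_h x| ≤ C * L * M.width := by
  obtain ⟨K, hK⟩ := hd.lipschitz
  obtain ⟨D₀, hD₀, hpot⟩ := hd.exists_abs_potential_le
  obtain ⟨C, hC, hstab⟩ := hd.exists_stability
  refine ⟨1 + C * (K + D₀), by positivity, fun M u g u_h du_h L hL hu hg huh horth => ?_⟩
  obtain ⟨c, hI, hdiff, hmean, hint⟩ := M.exists_interpolant hL hu hg
  have hh := M.width_pos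
  -- Consistency of order `h²`, although the derivative of the interpolation error is only of order
  -- `h`.
  have hcons : ∀ w dw, MemVh M w dw →
      |bilin a d₀ (u - primitive (M.step c)) (g - M.step c) w dw| ≤
        ((K + D₀) * L * M.width ^ 2) * ∫ x in Omega, |dw x| := by
    intro w dw hw
    obtain ⟨s, hs, hs0⟩ := hw.ae_eq_step
    have hS : ∫ x in Omega, |dw x| = ∑ i, |s i| * M.len i := by
      rw [← M.integral_abs_step]
      apply integral_congr_ae
      filter_upwards [hs] with x hx
      rw [hx]
    rw [bilin_congr (fun _ _ => rfl) (Filter.EventuallyEq.refl _ _) (fun _ _ => rfl) hs]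
    unfold bilin
    have h2 := hpot (u - primitive (M.step c)) w (L * M.width ^ 2) (∫ x in Omega, |dw x|)
      (by positivity) (integral_abs_nonneg _) hint (fun x hx => hw.1.abs_le hx)
    have h1 : |∫ x in Omega, a x * (g - M.step c) x * M.step s x| ≤
        K * L * M.width ^ 2 * ∫ x in Omega, |dw x| := by
      have hi : IntegrableOn (fun x => a x * (g - M.step c) x) Omega := by
        simpa only [mul_comm] using integrableOn_mul_continuousOn
          (hu.integrable_deriv.sub (M.integrable_step c)) hd.continuousOn
      rw [M.integral_mul_step hi, hS, Finset.mul_sum]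
      refine (Finset.abs_sum_le_sum_abs _ _).trans (Finset.sum_le_sum fun i _ => ?_)
      -- The test slope is constant on the cell and `g - c i` has mean zero there, so `a` may be
      -- frozen at the left node; its oscillation supplies the second factor `h`.
      have e1 : ∫ x in M.node i.castSucc..M.node i.succ, a x * (g - M.step c) x =
          ∫ x in M.node i.castSucc..M.node i.succ,
            (a x - a (M.node i.castSucc)) * (g x - c i) := by
        have hsub : Set.uIcc (M.node i.castSucc) (M.node i.succ) ⊆ Set.Icc 0 1 := by
          rw [Set.uIcc_of_le (M.node_lt i).le]; exact M.Icc_subset i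
        have i1 : IntervalIntegrable (fun x => g x - c i) volume
            (M.node i.castSucc) (M.node i.succ) :=
          (intervalIntegrable_of_omega hu.integrable_deriv (M.node_mem _) (M.node_mem _)).sub
            (by simp)
        have i2 : IntervalIntegrable (fun x => a x * (g x - c i)) volume
            (M.node i.castSucc) (M.node i.succ) :=
          i1.continuousOn_mul (hd.continuousOn.mono hsub)
        simp_rw [sub_mul]
        rw [intervalIntegral.integral_sub i2 (i1.const_mul _),
          intervalIntegral.integral_const_mul, hmean i, mul_zero, sub_zero]
        apply intervalIntegral.integral_congr_ae
        refine Filter.Eventually.of_forall fun x hx => ?_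
        rw [Set.uIoc_of_le (M.node_lt i).le] at hx
        simp only [Pi.sub_apply, M.step_apply c hx]
      have e2 : |∫ x in M.node i.castSucc..M.node i.succ,
          (a x - a (M.node i.castSucc)) * (g x - c i)| ≤
          K * M.width * (L * M.width) * |M.node i.succ - M.node i.castSucc| := by
        rw [← Real.norm_eq_abs]
        apply intervalIntegral.norm_integral_le_of_norm_le_const
        intro x hx
        rw [Set.uIoc_of_le (M.node_lt i).le] at hx
        rw [norm_mul]
        refine mul_le_mul ?_ (hdiff i x hx) (norm_nonneg _) (by positivity)
        have := hK.dist_le_mul x (M.cell_subset i hx) _ (M.node_mem i.castSucc)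
        rw [Real.dist_eq, Real.dist_eq] at this
        refine this.trans (mul_le_mul_of_nonneg_left ?_ K.coe_nonneg)
        rw [abs_of_pos (sub_pos.2 hx.1)]
        refine le_trans ?_ (M.len_le_width i)
        rw [Mesh.len]; linarith [hx.2]
      rw [abs_mul, e1]
      refine (mul_le_mul_of_nonneg_left e2 (abs_nonneg _)).trans (le_of_eq ?_)
      have : |M.node i.succ - M.node i.castSucc| = M.len i := abs_of_pos (M.len_pos i)
      rw [this]; ring
    refine (abs_add_le _ _).trans ?_
    refine (add_le_add h1 h2).trans (le_of_eq ?_)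
    ring
  -- By Galerkin orthogonality the discrete function `u_h` minus the interpolant sees only the
  -- consistency error, so stability makes it `O(h²)` even in its derivative.
  obtain ⟨h1, h2⟩ := hstab M _ _ ((K + D₀) * L * M.width ^ 2) (huh.sub hI) (by positivity) (by
    intro w dw hw
    have := hcons w dw hw
    rw [hd.bilin_sub_left hu hI.1 hw.1] at this
    rw [hd.bilin_sub_left huh.1 hI.1 hw.1, ← horth w dw hw]
    exact this)
  constructor
  · intro x hx
    have := h1 x hx
    have h3 := hint x hx
    have e : u x - u_h x = (u x - primitive (M.step c) x) - (u_h - primitive (M.step c)) x := by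
      simp
    rw [e]
    refine (abs_sub _ _).trans ((add_le_add h3 this).trans (le_of_eq ?_))
    ring
  · have h3 := M.ae_of_cell (p := fun x => |g x - M.step c x| ≤ L * M.width) (by
      intro i x hx
      rw [M.step_apply c hx]; exact hdiff i x hx)
    filter_upwards [h2, h3] with x h2 h3
    have e : g x - du_h x = (g x - M.step c x) - (du_h - M.step c) x := by simp
    rw [e]
    refine (abs_sub _ _).trans ((add_le_add h3 h2).trans ?_)
    have h4 : M.width ^ 2 ≤ M.width := by
      have := M.width_le_one; nlinarith
    have h5 : C * ((K + D₀) * L) * M.width ^ 2 ≤ C * ((K + D₀) * L) * M.width :=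
      mul_le_mul_of_nonneg_left h4 (by positivity)
    nlinarith

end regularity

end

end BVControl
-- Error estimates in terms of `E`, and a priori bounds.
namespace BVControl

noncomputable section

section rates

variable {α : ℝ} {a d₀ u_d : ℝ → ℝ}

theorem IsTest.memV {w : ℝ → ℝ} (hw : IsTest w) : MemV w (deriv w) :=
  memV_of_eqOn_primitive (memLp_of_continuousOn hw.deriv_continuous.continuousOn 2)
    (fun x _ => (hw.primitive_deriv x).symm) (by rw [hw.primitive_deriv, hw.eq_zero (by simp)])

theorem IsTest.exists_lipschitz {w : ℝ → ℝ} (hw : IsTest w) :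
    ∃ L, 0 ≤ L ∧ ∀ x y, |w x - w y| ≤ L * |x - y| := by
  obtain ⟨L, hL⟩ := hw.compact.deriv.exists_bound_of_continuous hw.deriv_continuous
  refine ⟨L, (norm_nonneg _).trans (hL 0), fun x y => ?_⟩
  exact Convex.norm_image_sub_le_of_norm_deriv_le (s := Set.univ)
    (fun x _ => hw.differentiable x) (fun x _ => hL x) convex_univ (Set.mem_univ y)
    (Set.mem_univ x)

theorem IsTest.exists_bound {w : ℝ → ℝ} (hw : IsTest w) : ∃ B, 0 ≤ B ∧ ∀ x, |w x| ≤ B := by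
  obtain ⟨B, hB⟩ := hw.compact.exists_bound_of_continuous hw.smooth.continuous
  exact ⟨B, (norm_nonneg _).trans (hB 0), hB⟩

/-- The strong form of the differential operator, applied to a test function. -/
theorem IsData.exists_strong_form (hd : IsData α a d₀ u_d) {w : ℝ → ℝ} (hw : IsTest w) :
    ∃ (φ : ℝ → ℝ) (B : ℝ), 0 ≤ B ∧ IntegrableOn φ Omega ∧ (∀ᵐ x ∂volOmega, |φ x| ≤ B) ∧
      ∀ v dv, MemV v dv → bilin a d₀ w (deriv w) v dv = ∫ x in Omega, φ x * v x := by
  obtain ⟨K, hK⟩ := hd.lipschitz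
  obtain ⟨A, hA0, hA⟩ := hd.exists_abs_le
  obtain ⟨D, hD0, hD⟩ := exists_ae_abs_le hd.bounded
  obtain ⟨W₀, hW₀0, hW₀⟩ := hw.exists_bound
  obtain ⟨W₁, hW₁0, hW₁⟩ := hw.mk_deriv.exists_bound
  obtain ⟨W₂, hW₂0, hW₂⟩ := hw.mk_deriv.exists_lipschitz
  -- A Lipschitz coefficient makes the flux Lipschitz. Hence its derivative is bounded and
  -- integration by parts is legitimate, so that `φ = d₀ w - (a w')'` is a bounded function.
  set f : ℝ → ℝ := fun x => a x * deriv w x with hf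
  have h01 : Set.uIcc (0 : ℝ) 1 = Set.Icc 0 1 := Set.uIcc_of_le zero_le_one
  have hac : AbsolutelyContinuousOnInterval f 0 1 := by
    refine AbsolutelyContinuousOnInterval.mul ?_ ?_
    · apply LipschitzOnWith.absolutelyContinuousOnInterval (K := K)
      rw [h01]; exact hK
    · apply LipschitzOnWith.absolutelyContinuousOnInterval (K := ⟨W₂, hW₂0⟩)
      exact LipschitzOnWith.of_dist_le_mul fun x _ y _ => by
        rw [Real.dist_eq, Real.dist_eq]; exact hW₂ x y
  have hlip : ∀ x ∈ Set.Icc (0 : ℝ) 1, ∀ y ∈ Set.Icc (0 : ℝ) 1,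
      |f x - f y| ≤ (A * W₂ + K * W₁) * |x - y| := by
    intro x hx y hy
    have e : f x - f y = a x * (deriv w x - deriv w y) + (a x - a y) * deriv w y := by
      simp only [hf]; ring
    rw [e]
    have h1 : |a x - a y| ≤ K * |x - y| := by
      have := hK.dist_le_mul x hx y hy
      rwa [Real.dist_eq, Real.dist_eq] at this
    refine (abs_add_le _ _).trans ?_
    rw [abs_mul, abs_mul]
    refine (add_le_add (mul_le_mul (hA x hx) (hW₂ x y) (abs_nonneg _) hA0)
      (mul_le_mul h1 (hW₁ y) (abs_nonneg _) (by positivity))).trans (le_of_eq ?_)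
    ring
  have hderiv : ∀ x ∈ Omega, |deriv f x| ≤ A * W₂ + K * W₁ := by
    intro x hx
    rw [← Real.norm_eq_abs]
    apply norm_deriv_le_of_lip' (by positivity)
    filter_upwards [isOpen_Ioo.mem_nhds hx] with y hy
    exact hlip y (Set.Ioo_subset_Icc_self hy) x (Set.Ioo_subset_Icc_self hx)
  have hdi : IntegrableOn (deriv f) Omega :=
    (intervalIntegrable_iff_omega _).1 hac.intervalIntegrable_deriv
  have hpi : IntegrableOn (fun x => d₀ x * w x) Omega :=
    integrableOn_mul_continuousOn (hd.bounded.integrable le_top) hw.smooth.continuous.continuousOn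
  have hm : ∀ᵐ x ∂volOmega, x ∈ Omega := ae_restrict_mem measurableSet_Ioo
  refine ⟨fun x => d₀ x * w x - deriv f x, D * W₀ + (A * W₂ + K * W₁), by positivity,
    hpi.sub hdi, ?_, ?_⟩
  · filter_upwards [hD, hm] with x h1 h2
    refine (abs_sub _ _).trans (add_le_add ?_ (hderiv x h2))
    rw [abs_mul]
    exact mul_le_mul h1 (hW₀ x) (abs_nonneg _) hD0
  · intro v dv hv
    have hp : ∀ x ∈ Set.Icc (0 : ℝ) 1, primitive dv x = v x :=
      fun x hx => (hv.eqOn_primitive hx).symm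
    have h := hac.integral_mul_deriv_eq_deriv_mul (primitive_ac hv.integrable_deriv)
    rw [hp 1 (by simp), hp 0 (by simp), hv.zero_left, hv.zero_right, ← integral_omega_eq,
      ← integral_omega_eq] at h
    have e1 : ∫ x in Omega, a x * deriv w x * dv x =
        ∫ x in Omega, f x * deriv (primitive dv) x := by
      apply integral_congr_ae
      filter_upwards [primitive_ae_deriv hv.integrable_deriv] with x hx
      rw [hx]
    have e2 : ∫ x in Omega, deriv f x * primitive dv x = ∫ x in Omega, deriv f x * v x := by
      apply setIntegral_congr_fun measurableSet_Ioo
      intro x hx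
      simp only [hp x (Set.Ioo_subset_Icc_self hx)]
    have e3 : ∫ x in Omega, (d₀ x * w x - deriv f x) * v x =
        (∫ x in Omega, d₀ x * w x * v x) - ∫ x in Omega, deriv f x * v x := by
      simp_rw [sub_mul]
      exact integral_sub (integrableOn_mul_continuousOn hpi hv.continuousOn)
        (integrableOn_mul_continuousOn hdi hv.continuousOn)
    unfold bilin
    rw [e1, h, e2, e3]
    ring

/-- The pairing of a control with a test function is controlled by the discrete state. -/
theorem IsData.exists_pairing_estimate (hd : IsData α a d₀ u_d) {w : ℝ → ℝ} (hw : IsTest w) :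
    ∃ C, 0 ≤ C ∧ ∀ (M : Mesh) (e de f : ℝ → ℝ), MemVh M e de → IntegrableOn f Omega →
      (∀ v dv, MemVh M v dv → bilin a d₀ e de v dv = ∫ x in Omega, f x * v x) →
      |∫ x in Omega, f x * w x| ≤
        C * ((∫ x in Omega, |e x|) + M.width ^ 2 * ∫ x in Omega, |f x|) := by
  obtain ⟨φ, B, hB0, hφi, hφB, hφ⟩ := hd.exists_strong_form hw
  obtain ⟨L, hL0, hL⟩ := hw.mk_deriv.exists_lipschitz
  obtain ⟨C, hC, hfe⟩ := hd.exists_fe_estimate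
  refine ⟨B + C * L, by positivity, fun M e de f he hf hs => ?_⟩
  -- The Ritz projection of `w`. Only discrete functions may be inserted in the equation of `e`;
  -- replacing `w` by its projection costs `O(h²)` in the maximum norm.
  obtain ⟨ŵ, dŵ, hŵ, hŵs⟩ := (hd.isStateSpace_memVh M).exists_state φ hφi
  have hest := (hfe M w (deriv w) ŵ dŵ L hL0 hw.memV (fun x _ y _ => hL x y) hŵ (by
    intro v dv hv
    rw [hŵs v dv hv, hφ v dv hv.1])).1
  have h1 : ∫ x in Omega, f x * ŵ x = ∫ x in Omega, φ x * e x := by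
    rw [← hs ŵ dŵ hŵ, bilin_comm, hŵs e de he]
  have i1 := integrableOn_mul_continuousOn hf hŵ.1.continuousOn
  have hcd : ContinuousOn (fun x => w x - ŵ x) (Set.Icc 0 1) :=
    hw.smooth.continuous.continuousOn.sub hŵ.1.continuousOn
  have i2 := integrableOn_mul_continuousOn hf hcd
  have e1 : ∫ x in Omega, f x * w x =
      (∫ x in Omega, φ x * e x) + ∫ x in Omega, f x * (w x - ŵ x) := by
    rw [← h1, ← integral_add i1 i2]
    congr 1; ext x; ring
  have b1 : |∫ x in Omega, φ x * e x| ≤ B * ∫ x in Omega, |e x| := by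
    rw [← integral_const_mul, ← Real.norm_eq_abs]
    apply norm_integral_le_of_norm_le
    · exact (continuousOn_integrableOn he.1.continuousOn).abs.const_mul B
    · filter_upwards [hφB] with x hx
      rw [norm_mul]
      exact mul_le_mul_of_nonneg_right hx (abs_nonneg _)
  have b2 := abs_integral_mul_le hf hest
  have n1 := integral_abs_nonneg e
  have n2 : 0 ≤ M.width ^ 2 * ∫ x in Omega, |f x| :=
    mul_nonneg (sq_nonneg _) (integral_abs_nonneg f)
  rw [e1]
  refine (abs_add_le _ _).trans ((add_le_add b1 b2).trans ?_)
  have p1 : 0 ≤ C * L * ∫ x in Omega, |e x| := by positivity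
  have p2 : 0 ≤ B * (M.width ^ 2 * ∫ x in Omega, |f x|) := by positivity
  nlinarith

/-- The embedding of BV in `L^∞` on an interval: the optimal control is a bounded right-hand side,
so its state has a Lipschitz derivative. -/
theorem MemBV.exists_abs_le {q : ℝ → ℝ} {μ : SignedMeasure ℝ} (h : MemBV q μ) :
    ∃ F, ∀ᵐ x ∂volOmega, |q x| ≤ F := by
  obtain ⟨c, hc⟩ := h.ae_eq
  refine ⟨|c| + measNorm μ, ?_⟩
  filter_upwards [hc] with x hx
  rw [hx]
  exact (abs_add_le _ _).trans (add_le_add le_rfl (abs_apply_le_measNorm μ _))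

theorem abs_integral_mul_le_of_sq {f g : ℝ → ℝ} (hf : ContinuousOn f (Set.Icc 0 1)) {B : ℝ}
    (hg : ∀ x ∈ Set.Icc (0 : ℝ) 1, |g x| ≤ B) :
    |∫ x in Omega, f x * g x| ≤ √(∫ x in Omega, f x ^ 2) * B := by
  have hB : 0 ≤ B := (abs_nonneg _).trans (hg 0 (by simp))
  refine (abs_integral_mul_le (continuousOn_integrableOn hf) hg).trans ?_
  apply mul_le_mul_of_nonneg_right _ hB
  exact Real.le_sqrt_of_sq_le (sq_integral_abs_le (memLp_of_continuousOn hf 2))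

/-- Error estimates in terms of the error `E` of the discrete states of `q` and `q_h`. -/
theorem IsData.exists_key_estimate (hd : IsData α a d₀ u_d) {q u z : ℝ → ℝ}
    {μ : SignedMeasure ℝ} (hq : MemBV q μ) (hu : IsState MemV a d₀ q u)
    (hz : IsAdjoint MemV a d₀ u_d u z) (hst : IsStationary α z q μ) :
    ∃ (g : ℝ → ℝ) (C : ℝ), 0 ≤ C ∧ ContinuousOn g (Set.Icc 0 1) ∧ MemV z g ∧
      ∀ (M : Mesh) (q_h u_h z_h dz_h : ℝ → ℝ) (μ_h : SignedMeasure ℝ), MemBV q_h μ_h →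
        IsState (MemVh M) a d₀ q_h u_h → MemVh M z_h dz_h →
        (∀ w dw, MemVh M w dw →
          bilin a d₀ w dw z_h dz_h = ∫ x in Omega, w x * (u_h x - u_d x)) →
        IsStationary α z_h q_h μ_h →
        ∃ (e de : ℝ → ℝ) (E : ℝ), 0 ≤ E ∧ MemVh M e de ∧
          (∀ w dw, MemVh M w dw →
            bilin a d₀ e de w dw = ∫ x in Omega, (q_h x - q x) * w x) ∧
          ∫ x in Omega, |e x| ≤ E ∧
          E ^ 2 ≤ C * M.width ^ 2 * (∫ x in Omega, |q_h x - q x|) + C * M.width ^ 2 * E ∧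
          (∀ x ∈ Set.Icc (0 : ℝ) 1, |z x - z_h x| ≤ C * (M.width ^ 2 + E)) ∧
          ∀ᵐ x ∂volOmega, |g x - dz_h x| ≤ C * (M.width + E) := by
  obtain ⟨du, huV, hus⟩ := hu
  obtain ⟨dz, hzV, hzs⟩ := hz
  obtain ⟨Cs, hCs, hstab⟩ := hd.exists_stability_state
  obtain ⟨Cf, hCf, hfe⟩ := hd.exists_fe_estimate
  obtain ⟨gu, Lu, hLu, hgu, hdu⟩ :=
    hd.exists_lipschitz_deriv huV hq.integrable hq.exists_abs_le hus
  have hri : IntegrableOn (fun x => u x - u_d x) Omega :=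
    (continuousOn_integrableOn huV.continuousOn).sub (hd.desired.integrable le_top)
  have hzs' : ∀ w dw, MemV w dw →
      bilin a d₀ z dz w dw = ∫ x in Omega, (u x - u_d x) * w x := by
    intro w dw hw
    rw [bilin_comm, hzs w dw hw]
    simp_rw [mul_comm (w _)]
  obtain ⟨gz, Lz, hLz, hgz, hdz⟩ := hd.exists_lipschitz_deriv hzV hri (by
    obtain ⟨U, hU⟩ := isCompact_Icc.exists_bound_of_continuousOn huV.continuousOn
    obtain ⟨D, hD0, hD⟩ := exists_ae_abs_le hd.desired
    have hm : ∀ᵐ x ∂volOmega, x ∈ Omega := ae_restrict_mem measurableSet_Ioo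
    refine ⟨U + D, ?_⟩
    filter_upwards [hD, hm] with x h1 h2
    exact (abs_sub _ _).trans (add_le_add (hU x (Set.Ioo_subset_Icc_self h2)) h1)) hzs'
  -- Weak derivatives are determined only up to null sets; from here on the Lipschitz
  -- representatives are used.
  have replace_deriv : ∀ {v dv g : ℝ → ℝ}, MemV v dv → dv =ᵐ[volOmega] g → MemV v g := by
    intro v dv g hv hg
    refine memV_of_eqOn_primitive ((memLp_congr_ae hg).1 hv.memLp_deriv) ?_ ?_
    · intro x hx
      rw [hv.eqOn_primitive hx, primitive_congr hg hx]
    · rw [← primitive_congr hg (by simp), hv.primitive_deriv_one]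
  have huV' := replace_deriv huV hdu
  have hzV' := replace_deriv hzV hdz
  have hbil : ∀ {v dv g w dw : ℝ → ℝ}, dv =ᵐ[volOmega] g →
      bilin a d₀ v g w dw = bilin a d₀ v dv w dw := fun h =>
    bilin_congr (fun _ _ => rfl) h.symm (fun _ _ => rfl) (Filter.EventuallyEq.refl _ _)
  set C := Cf * Lu + Cf * Lz + Cs * (Cf * Lu) + Cs with hC
  have p1 : 0 ≤ Cf * Lu := by positivity
  have p2 : 0 ≤ Cf * Lz := by positivity
  have p3 : 0 ≤ Cs * (Cf * Lu) := by positivity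
  refine ⟨gz, C, by positivity, continuousOn_of_abs_sub_le hLz hgz, hzV', ?_⟩
  intro M q_h u_h z_h dz_h μ_h hqh huh hzh hzhs hsth
  have hV := hd.isStateSpace_memVh M
  have hw0 := M.width_pos
  -- Auxiliary discrete functions with continuous data: `ut` is the discrete state of `q`, and `zt`
  -- the discrete adjoint for the exact residual `u - u_d`. Both are plain Galerkin approximations,
  -- of `u` and `z`.
  obtain ⟨ut, hut⟩ := hV.exists_state q hq.integrable
  obtain ⟨zt, dzt, hzt, hzts⟩ := hV.exists_state _ hri
  have hqd : IntegrableOn (fun x => q_h x - q x) Omega := hqh.integrable.sub hq.integrable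
  have hest : ∀ x ∈ Set.Icc (0 : ℝ) 1, |u x - ut x| ≤ Cf * Lu * M.width ^ 2 := by
    obtain ⟨dut, hut, huts⟩ := hut
    refine (hfe M u gu ut dut Lu hLu huV' hgu hut ?_).1
    intro w dw hw
    rw [hbil hdu, hus w dw hw.1, huts w dw hw]
  obtain ⟨hz1, hz2⟩ := hfe M z gz zt dzt Lz hLz hzV' hgz hzt (by
    intro w dw hw
    rw [hbil hdz, hzs' w dw hw.1, hzts w dw hw])
  obtain ⟨de, heV, hes⟩ := hV.isState_combo hd hqh.integrable hq.integrable huh hut (-1)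
  set e : ℝ → ℝ := u_h + (-1 : ℝ) • ut with he
  have hes' : ∀ w dw, MemVh M w dw →
      bilin a d₀ e de w dw = ∫ x in Omega, (q_h x - q x) * w x := by
    intro w dw hw
    rw [hes w dw hw]
    congr 1; ext x
    simp only [Pi.add_apply, Pi.smul_apply, smul_eq_mul]; ring
  obtain ⟨duh, huhV, -⟩ := huh
  have hec := heV.1.continuousOn
  have huhc := huhV.1.continuousOn
  set E := √(∫ x in Omega, e x ^ 2) with hE
  have hE0 : 0 ≤ E := Real.sqrt_nonneg _
  have hE2 : E ^ 2 = ∫ x in Omega, e x ^ 2 :=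
    Real.sq_sqrt (integral_nonneg fun x => sq_nonneg _)
  have heE : ∫ x in Omega, |e x| ≤ E :=
    Real.le_sqrt_of_sq_le (sq_integral_abs_le (memLp_of_continuousOn hec 2))
  have huu : ∫ x in Omega, |u_h x - u x| ≤ E + Cf * Lu * M.width ^ 2 := by
    have hb : ∀ x ∈ Omega, |u_h x - u x| ≤ |e x| + Cf * Lu * M.width ^ 2 := by
      intro x hx
      have h1 := hest x (Set.Ioo_subset_Icc_self hx)
      have h2 : u_h x - u x = e x - (u x - ut x) := by simp [he]; ring
      rw [h2]
      exact (abs_sub _ _).trans (add_le_add le_rfl h1)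
    have i1 : IntegrableOn (fun x => |e x|) Omega := (continuousOn_integrableOn hec).abs
    calc ∫ x in Omega, |u_h x - u x| ≤ ∫ x in Omega, (|e x| + Cf * Lu * M.width ^ 2) :=
          setIntegral_mono_on
            (continuousOn_integrableOn (huhc.sub huV.continuousOn)).abs
            (i1.add (integrable_const _)) measurableSet_Ioo hb
      _ = (∫ x in Omega, |e x|) + Cf * Lu * M.width ^ 2 := by
          rw [integral_add i1 (integrable_const _)]; simp
      _ ≤ _ := by linarith
  -- `z_h - zt` is a discrete adjoint with data `u_h - u`, whose `L¹` norm is `O(E + h²)`. The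
  -- remaining part `z - zt` is a finite element error, `O(h²)`, with derivative `O(h)`.
  obtain ⟨hs1, hs2⟩ := hstab M (z_h - zt) (dz_h - dzt) (fun x => u_h x - u x) (hzh.sub hzt)
    (continuousOn_integrableOn (huhc.sub huV.continuousOn)) (by
    intro w dw hw
    have hri' : IntegrableOn (fun x => w x * (u_h x - u_d x)) Omega := by
      simpa only [mul_comm, Pi.sub_apply] using integrableOn_mul_continuousOn
        ((continuousOn_integrableOn huhc).sub (hd.desired.integrable le_top)) hw.1.continuousOn
    rw [hd.bilin_sub_left hzh.1 hzt.1 hw.1, hzts w dw hw, bilin_comm, hzhs w dw hw,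
      ← integral_sub hri' (integrableOn_mul_continuousOn hri hw.1.continuousOn)]
    congr 1; ext x; ring)
  refine ⟨e, de, E, hE0, heV, hes', heE, ?_, ?_, ?_⟩
  -- Each variational inequality is tested with the other control; in the sum the total variations
  -- cancel.
  · have k1 := hst q_h μ_h hqh
    have k2 := hsth q μ hq
    have i1 : IntegrableOn (fun x => (q_h x - q x) * (z x - zt x)) Omega :=
      integrableOn_mul_continuousOn hqd (hzV.continuousOn.sub hzt.1.continuousOn)
    have m1 : |∫ x in Omega, (q_h x - q x) * (z x - zt x)| ≤
        (∫ x in Omega, |q_h x - q x|) * (Cf * Lz * M.width ^ 2) :=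
      abs_integral_mul_le hqd hz1
    have e1 : ∫ x in Omega, (q_h x - q x) * zt x = ∫ x in Omega, (u x - u_d x) * e x := by
      rw [← hes' _ _ hzt, bilin_comm, hzts _ _ heV]
    have e2 : ∫ x in Omega, (q_h x - q x) * z_h x = ∫ x in Omega, e x * (u_h x - u_d x) := by
      rw [← hes' _ _ hzh, hzhs _ _ heV]
    have e3 : ∫ x in Omega, z x * (q_h x - q x) =
        (∫ x in Omega, (q_h x - q x) * (z x - zt x)) + ∫ x in Omega, (u x - u_d x) * e x := by
      rw [← e1, ← integral_add i1 (integrableOn_mul_continuousOn hqd hzt.1.continuousOn)]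
      congr 1; ext x; ring
    have e4 : ∫ x in Omega, z_h x * (q x - q_h x) = - ∫ x in Omega, e x * (u_h x - u_d x) := by
      rw [← e2, ← integral_neg]
      congr 1; ext x; ring
    have m2 := abs_integral_mul_le_of_sq hec hest
    have j1 : IntegrableOn (fun x => (u x - u_d x) * e x) Omega :=
      integrableOn_mul_continuousOn hri hec
    have j2 : IntegrableOn (fun x => e x * (u x - ut x)) Omega :=
      continuousOn_integrableOn (hec.mul (huV.continuousOn.sub
        (by have : ut = u_h - e := by ext x; simp [he]
            rw [this]; exact huhc.sub hec)))
    have j3 : IntegrableOn (fun x => e x ^ 2) Omega := continuousOn_integrableOn (hec.pow 2)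
    -- Since `u_h = u - (u - ut) + e`, the terms with `u - u_d` cancel in the sum, `E²` appears with
    -- the favourable sign, and only products with the finite element errors `z - zt` and `u - ut`
    -- survive.
    have e5 : ∫ x in Omega, e x * (u_h x - u_d x) = (∫ x in Omega, (u x - u_d x) * e x)
        - (∫ x in Omega, e x * (u x - ut x)) + ∫ x in Omega, e x ^ 2 := by
      have j4 : IntegrableOn (fun x => (u x - u_d x) * e x - e x * (u x - ut x)) Omega :=
        j1.sub j2
      rw [← integral_sub j1 j2, ← integral_add j4 j3]
      congr 1; ext x; simp [he]; ring
    rw [e3] at k1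
    rw [e4, e5, ← hE2] at k2
    have k3 : E ^ 2 ≤ (∫ x in Omega, (q_h x - q x) * (z x - zt x))
        + ∫ x in Omega, e x * (u x - ut x) := by linarith
    have n1 := integral_abs_nonneg fun x => q_h x - q x
    have hE' : 0 ≤ M.width ^ 2 * E := by positivity
    have hN' : 0 ≤ M.width ^ 2 * ∫ x in Omega, |q_h x - q x| := mul_nonneg (sq_nonneg _) n1
    have k4 := k3.trans (add_le_add ((le_abs_self _).trans m1) ((le_abs_self _).trans m2))
    have k5 : Cf * Lz * (M.width ^ 2 * ∫ x in Omega, |q_h x - q x|) ≤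
        C * (M.width ^ 2 * ∫ x in Omega, |q_h x - q x|) :=
      mul_le_mul_of_nonneg_right (by rw [hC]; linarith) hN'
    have k6 : Cf * Lu * (M.width ^ 2 * E) ≤ C * (M.width ^ 2 * E) :=
      mul_le_mul_of_nonneg_right (by rw [hC]; linarith) hE'
    rw [← hE] at k4
    nlinarith
  · intro x hx
    have h1 := hz1 x hx
    have h2 := hs1 x hx
    have h3 : z x - z_h x = (z x - zt x) - (z_h - zt) x := by simp
    rw [h3]
    refine (abs_sub _ _).trans ((add_le_add h1 h2).trans ?_)
    have h4 := mul_le_mul_of_nonneg_left huu hCs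
    rw [hC]
    nlinarith [mul_nonneg p1 (add_nonneg (sq_nonneg M.width) hE0),
      mul_nonneg p2 hE0, mul_nonneg p3 hE0, mul_nonneg hCs (sq_nonneg M.width)]
  · filter_upwards [hz2, hs2] with x h1 h2
    have h3 : gz x - dz_h x = (gz x - dzt x) - (dz_h - dzt) x := by simp
    rw [h3]
    refine (abs_sub _ _).trans ((add_le_add h1 h2).trans ?_)
    have h4 := mul_le_mul_of_nonneg_left huu hCs
    have h5 : M.width ^ 2 ≤ M.width := by
      have := M.width_le_one; nlinarith
    have h6 := mul_le_mul_of_nonneg_left h5 p3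
    rw [hC]
    nlinarith [mul_nonneg p1 (add_nonneg hw0.le hE0),
      mul_nonneg p2 hE0, mul_nonneg p3 hE0, mul_nonneg hCs hw0.le]

/-- A priori bounds for the discrete optimal controls. -/
theorem IsData.exists_apriori (hd : IsData α a d₀ u_d) :
    ∃ C h₁, 0 ≤ C ∧ 0 < h₁ ∧ ∀ (M : Mesh) (q_h u_h : ℝ → ℝ) (μ_h : SignedMeasure ℝ),
      M.width ≤ h₁ → MemBV q_h μ_h → IsState (MemVh M) a d₀ q_h u_h →
      (∀ q₁ μ₁ u₁, MemBV q₁ μ₁ → IsState (MemVh M) a d₀ q₁ u₁ →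
        cost α u_d u_h μ_h ≤ cost α u_d u₁ μ₁) →
      measNorm μ_h ≤ C ∧ ∫ x in Omega, |q_h x| ≤ C := by
  obtain ⟨χ, hχ, hχ1⟩ := exists_isTest_integral_one
  obtain ⟨Cp, hCp, hpair⟩ := hd.exists_pairing_estimate hχ
  obtain ⟨B, hB0, hB⟩ := hχ.exists_bound
  have hα := hd.alpha_pos
  have hud2 : MemLp u_d 2 volOmega := hd.desired.mono_exponent le_top
  set J := ∫ x in Omega, u_d x ^ 2 with hJ
  have hJ0 : 0 ≤ J := integral_nonneg fun x => sq_nonneg _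
  -- The zero control has cost `J / 2`. Comparison with it bounds the total variation by `T` and the
  -- `L¹` norm of `u_h` by `U`.
  set T := 1 / 2 * J / α with hT
  have hT0 : 0 ≤ T := by positivity
  set U := 2 * √J with hU
  -- The cost does not see the additive constant `b` of `q_h`. Pairing with `χ` gives `|b| ≤ T B +
  -- Cp (U + T) + |b| / 2`, and absorbing the last term produces the factor `2`.
  set b₀ := 2 * (T * B + Cp * (U + T)) with hb₀
  have hU0 : 0 ≤ U := by positivity
  have hb₀0 : 0 ≤ b₀ := by positivity
  refine ⟨T + b₀, 1 / (2 * (Cp + 1)), by positivity, by positivity, ?_⟩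
  intro M q_h u_h μ_h hM hqh huh hmin
  have hw0 := M.width_pos
  have hcost := hmin 0 0 0 MemBV.zero (by
    refine ⟨0, memVh_zero M, fun w dw hw => ?_⟩
    simp [bilin])
  unfold cost at hcost
  simp only [Pi.zero_apply, zero_sub, neg_sq, measNorm_zero, mul_zero, add_zero, ← hJ] at hcost
  have hn := measNorm_nonneg μ_h
  have hsq : 0 ≤ ∫ x in Omega, (u_h x - u_d x) ^ 2 := integral_nonneg fun x => sq_nonneg _
  have hμ : measNorm μ_h ≤ T := by
    rw [hT, le_div_iff₀ hα]; linarith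
  obtain ⟨du, huV, hus⟩ := huh
  have huc := huV.1.continuousOn
  have hue : MemLp (fun x => u_h x - u_d x) 2 volOmega :=
    (memLp_of_continuousOn huc 2).sub hud2
  have hu1 : ∫ x in Omega, |u_h x| ≤ U := by
    have h1 : ∫ x in Omega, |u_h x - u_d x| ≤ √J := by
      apply Real.le_sqrt_of_sq_le
      refine (sq_integral_abs_le hue).trans ?_
      nlinarith [mul_nonneg hα.le hn]
    have h2 : ∫ x in Omega, |u_d x| ≤ √J := Real.le_sqrt_of_sq_le (sq_integral_abs_le hud2)
    have i1 : IntegrableOn (fun x => |u_h x - u_d x|) Omega :=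
      (MemLp.integrableOn_omega hue).abs
    have i2 : IntegrableOn (fun x => |u_d x|) Omega := (MemLp.integrableOn_omega hud2).abs
    have h3 : ∫ x in Omega, |u_h x| ≤ ∫ x in Omega, (|u_h x - u_d x| + |u_d x|) := by
      apply integral_mono (continuousOn_integrableOn huc).abs (i1.add i2)
      intro x
      have := abs_add_le (u_h x - u_d x) (u_d x)
      simpa using this
    rw [integral_add i1 i2] at h3
    rw [hU]; linarith
  obtain ⟨b, hb⟩ := hqh.ae_eq
  have hμi : IntegrableOn (fun x => μ_h (Set.Iio x)) Omega := by
    simpa using integrableOn_signed_Iio μ_h (ψ := fun _ => 1) (integrable_const 1)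
  have hq1 : ∫ x in Omega, |q_h x| ≤ |b| + T := by
    have : ∫ x in Omega, |q_h x| ≤ ∫ x in Omega, (|b| + T) := by
      apply integral_mono_ae hqh.integrable.abs (integrable_const _)
      filter_upwards [hb] with x hx
      rw [hx]
      exact (abs_add_le _ _).trans (add_le_add le_rfl ((abs_apply_le_measNorm μ_h _).trans hμ))
    simpa using this
  have hp := hpair M u_h du q_h huV hqh.integrable hus
  have e1 : ∫ x in Omega, q_h x * χ x = b + ∫ x in Omega, μ_h (Set.Iio x) * χ x := by
    have : ∫ x in Omega, q_h x * χ x = ∫ x in Omega, (b * χ x + μ_h (Set.Iio x) * χ x) := by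
      apply integral_congr_ae
      filter_upwards [hb] with x hx
      rw [hx]; ring
    rw [this, integral_add (hχ.integrable.const_mul b) (integrableOn_signed_Iio μ_h hχ.integrable),
      integral_const_mul, hχ1, mul_one]
  have b1 : |∫ x in Omega, μ_h (Set.Iio x) * χ x| ≤ T * B := by
    have := norm_integral_le_of_norm_le_const (μ := volOmega)
      (f := fun x => μ_h (Set.Iio x) * χ x) (C := T * B) (Filter.Eventually.of_forall fun x => by
        rw [norm_mul]
        exact mul_le_mul ((abs_apply_le_measNorm μ_h _).trans hμ) (hB x) (norm_nonneg _) hT0)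
    simpa using this
  rw [e1] at hp
  have h2 : |b| ≤ |b + ∫ x in Omega, μ_h (Set.Iio x) * χ x|
      + |∫ x in Omega, μ_h (Set.Iio x) * χ x| := by
    have := abs_sub (b + ∫ x in Omega, μ_h (Set.Iio x) * χ x)
      (∫ x in Omega, μ_h (Set.Iio x) * χ x)
    simpa using this
  have hwsq : M.width ^ 2 ≤ M.width := by
    have := M.width_le_one; nlinarith
  -- This is the purpose of the threshold on the mesh width: the `L¹` norm of `q_h` on the right of
  -- the pairing estimate itself contains `|b|`.
  have hCw : Cp * M.width ^ 2 ≤ 1 / 2 := by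
    have h3 : Cp * M.width ^ 2 ≤ (Cp + 1) * (1 / (2 * (Cp + 1))) :=
      mul_le_mul (by linarith) (hwsq.trans hM) (sq_nonneg _) (by linarith)
    have h4 : (Cp + 1) * (1 / (2 * (Cp + 1))) = 1 / 2 := by field_simp
    linarith
  have hb' : |b| ≤ b₀ := by
    have h5 : Cp * ((∫ x in Omega, |u_h x|) + M.width ^ 2 * ∫ x in Omega, |q_h x|) ≤
        Cp * U + 1 / 2 * |b| + Cp * T := by
      have h6 : Cp * M.width ^ 2 * (∫ x in Omega, |q_h x|) ≤ Cp * M.width ^ 2 * (|b| + T) :=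
        mul_le_mul_of_nonneg_left hq1 (by positivity)
      have h7 : Cp * M.width ^ 2 * |b| ≤ 1 / 2 * |b| :=
        mul_le_mul_of_nonneg_right hCw (abs_nonneg _)
      have h8 : Cp * M.width ^ 2 * T ≤ Cp * T := by
        apply mul_le_mul_of_nonneg_right _ hT0
        exact mul_le_of_le_one_right hCp (hwsq.trans M.width_le_one)
      have h9 := mul_le_mul_of_nonneg_left hu1 hCp
      nlinarith
    rw [hb₀]; linarith
  exact ⟨by linarith, by linarith⟩

end rates

end

end BVControl
-- Roots of perturbed adjoint states.
namespace BVControl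

noncomputable section

section roots

open Filter Topology

theorem hasDerivAt_primitive {g : ℝ → ℝ} (hg : ContinuousOn g (Set.Icc 0 1)) {y : ℝ}
    (hy : y ∈ Omega) : HasDerivAt (primitive g) (g y) y := by
  have hn : Set.Icc (0 : ℝ) 1 ∈ 𝓝 y := Icc_mem_nhds hy.1 hy.2
  have hi := intervalIntegrable_of_omega (continuousOn_integrableOn hg) (x := 0) (y := y)
    (by simp) (Set.Ioo_subset_Icc_self hy)
  refine intervalIntegral.integral_hasDerivAt_right hi ?_ (hg.continuousAt hn)
  exact ⟨Set.Icc 0 1, hn, hg.aestronglyMeasurable measurableSet_Icc⟩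

/-- Fermat's theorem: where `|Φ|` reaches its bound `α`, `Φ` has a local extremum, and `Φ' = z`. -/
theorem eq_zero_of_abs_primitive_eq {z : ℝ → ℝ} {α : ℝ} (hz : ContinuousOn z (Set.Icc 0 1))
    (h : ∀ y ∈ Omega, |primitive z y| ≤ α) {y : ℝ} (hy : y ∈ Omega)
    (hα : |primitive z y| = α) : z y = 0 := by
  have hd := hasDerivAt_primitive hz hy
  have hn : Omega ∈ 𝓝 y := isOpen_Ioo.mem_nhds hy
  rcases abs_choice (primitive z y) with h1 | h1
  · apply IsLocalMax.hasDerivAt_eq_zero (f := primitive z) _ hd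
    filter_upwards [hn] with t ht
    rw [← h1, hα]
    exact (abs_le.1 (h t ht)).2
  · apply IsLocalMin.hasDerivAt_eq_zero (f := primitive z) _ hd
    filter_upwards [hn] with t ht
    have := (abs_le.1 (h t ht)).1
    rw [hα] at h1
    linarith

theorem eventually_closedBall {p : ℝ → Prop} {c : ℝ} (h : ∀ᶠ y in 𝓝 c, p y) :
    ∀ᶠ r in 𝓝[>] (0 : ℝ), ∀ y ∈ Metric.closedBall c r, p y := by
  obtain ⟨ε, hε, hb⟩ := Metric.eventually_nhds_iff_ball.1 h
  filter_upwards [Ioo_mem_nhdsGT hε] with r hr y hy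
  exact hb y (Metric.closedBall_subset_ball hr.2 hy)

theorem eventually_disjoint_ball {x y : ℝ} (h : x ≠ y) :
    ∀ᶠ r in 𝓝[>] (0 : ℝ), Disjoint (Metric.ball x r) (Metric.ball y r) := by
  have hd : 0 < dist x y / 2 := half_pos (dist_pos.2 h)
  filter_upwards [Ioo_mem_nhdsGT hd] with r hr
  apply Metric.ball_disjoint_ball
  linarith [hr.2]

/-- Neighbourhoods of the extremal points of the multiplier, on which the adjoint state is
strictly monotone, and outside of which the multiplier is not extremal. -/
theorem exists_radius {α : ℝ} (hα : 0 < α) {z g : ℝ → ℝ} (hz : MemV z g)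
    (hg : ContinuousOn g (Set.Icc 0 1)) (h1 : primitive z 1 = 0)
    (hle : ∀ y ∈ Omega, |primitive z y| ≤ α) {m : ℕ} {x : Fin m → ℝ}
    (hinj : Function.Injective x) (hset : ∀ y, (y ∈ Omega ∧ |primitive z y| = α) ↔ ∃ i, x i = y)
    (hne : ∀ i, g (x i) ≠ 0) :
    ∃ (R σ δ : ℝ) (s : Fin m → ℝ), 0 < R ∧ 0 < σ ∧ 0 < δ ∧ (∀ i, |s i| = 1) ∧
      (∀ i, Metric.closedBall (x i) R ⊆ Omega) ∧
      (∀ i j, i ≠ j → Disjoint (Metric.ball (x i) R) (Metric.ball (x j) R)) ∧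
      (∀ i, ∀ y ∈ Metric.ball (x i) R, σ ≤ s i * g y) ∧
      ∀ y ∈ Set.Icc (0 : ℝ) 1, (∀ i, y ∉ Metric.ball (x i) R) → |primitive z y| ≤ α - δ := by
  have hx : ∀ i, x i ∈ Omega := fun i => ((hset (x i)).2 ⟨i, rfl⟩).1
  obtain ⟨s, hs1, hs⟩ : ∃ s : Fin m → ℝ, (∀ i, |s i| = 1) ∧ ∀ i, s i * g (x i) = |g (x i)| := by
    refine ⟨fun i => SignType.sign (g (x i)), fun i => ?_, fun i => sign_mul_self _⟩
    rcases lt_or_gt_of_ne (hne i) with h | h <;> simp [h]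
  -- Working with all small parameters at once avoids minima over the index set, which is empty for
  -- `m = 0`.
  have hσ : ∀ᶠ σ in 𝓝[>] (0 : ℝ), ∀ i, σ < |g (x i)| := by
    rw [eventually_all]
    intro i
    filter_upwards [Ioo_mem_nhdsGT (abs_pos.2 (hne i))] with σ hσ
    exact hσ.2
  obtain ⟨σ, hσ, hσ0⟩ := (hσ.and self_mem_nhdsWithin).exists
  have e1 : ∀ᶠ r in 𝓝[>] (0 : ℝ), ∀ i, ∀ y ∈ Metric.closedBall (x i) r,
      y ∈ Omega ∧ σ < s i * g y := by
    rw [eventually_all]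
    intro i
    apply eventually_closedBall
    have hc : ContinuousAt (fun y => s i * g y) (x i) :=
      (hg.continuousAt (Icc_mem_nhds (hx i).1 (hx i).2)).const_mul (s i)
    have h2 : ∀ᶠ y in 𝓝 (x i), σ < s i * g y :=
      hc.eventually (lt_mem_nhds (by show σ < s i * g (x i); rw [hs]; exact hσ i))
    have h3 : ∀ᶠ y in 𝓝 (x i), y ∈ Omega := isOpen_Ioo.mem_nhds (hx i)
    exact h3.and h2
  have e2 : ∀ᶠ r in 𝓝[>] (0 : ℝ), ∀ i j, i ≠ j →
      Disjoint (Metric.ball (x i) r) (Metric.ball (x j) r) := by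
    rw [eventually_all]; intro i
    rw [eventually_all]; intro j
    by_cases hij : i = j
    · exact Eventually.of_forall fun r h => absurd hij h
    · filter_upwards [eventually_disjoint_ball (hinj.ne hij)] with r hr _
      exact hr
  obtain ⟨R, ⟨hR1, hR2⟩, hR0⟩ := ((e1.and e2).and self_mem_nhdsWithin).exists
  have hK : IsCompact (Set.Icc (0 : ℝ) 1 \ ⋃ i, Metric.ball (x i) R) :=
    isCompact_Icc.diff (isOpen_iUnion fun i => Metric.isOpen_ball)
  have hcont : ContinuousOn (fun y => α - |primitive z y|)
      (Set.Icc (0 : ℝ) 1 \ ⋃ i, Metric.ball (x i) R) :=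
    (continuousOn_const.sub
      (primitive_continuousOn (continuousOn_integrableOn hz.continuousOn)).abs).mono
      Set.sdiff_subset
  -- The margin `δ` comes from compactness of what is left of `[0, 1]`; the end points cause no loss
  -- because `Φ` vanishes there.
  obtain ⟨δ, hδ0, hδ⟩ := hK.exists_forall_le' hcont (a := 0) (by
    rintro y ⟨hy, hyb⟩
    rw [sub_pos]
    rcases hy.1.eq_or_lt with h0 | h0
    · rw [← h0, primitive_zero, abs_zero]; exact hα
    rcases hy.2.eq_or_lt with h0' | h0'
    · rw [h0', h1, abs_zero]; exact hα
    refine lt_of_le_of_ne (hle y ⟨h0, h0'⟩) fun heq => hyb ?_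
    obtain ⟨i, hi⟩ := (hset y).1 ⟨⟨h0, h0'⟩, heq⟩
    rw [Set.mem_iUnion]
    exact ⟨i, by rw [hi]; exact Metric.mem_ball_self hR0⟩)
  refine ⟨R, σ, δ, s, hR0, hσ0, hδ0, hs1, fun i y hy => (hR1 i y hy).1, hR2,
    fun i y hy => (hR1 i y (Metric.ball_subset_closedBall hy)).2.le, fun y hy hyb => ?_⟩
  have := hδ y ⟨hy, by simpa using hyb⟩
  linarith

theorem mul_le_primitive_sub {f : ℝ → ℝ} (hf : IntegrableOn f Omega) {s σ y₁ y₂ : ℝ}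
    (h₁ : y₁ ∈ Set.Icc (0 : ℝ) 1) (h₂ : y₂ ∈ Set.Icc (0 : ℝ) 1) (h₁₂ : y₁ ≤ y₂)
    (h : ∀ᵐ y ∂volOmega, y ∈ Set.Icc y₁ y₂ → σ ≤ s * f y) :
    σ * (y₂ - y₁) ≤ s * (primitive f y₂ - primitive f y₁) := by
  rw [primitive_sub_primitive hf h₁ h₂, ← intervalIntegral.integral_const_mul]
  have : ∫ _ in y₁..y₂, σ ≤ ∫ y in y₁..y₂, s * f y := by
    apply intervalIntegral.integral_mono_ae_restrict h₁₂ (by simp)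
      ((intervalIntegrable_of_omega hf h₁ h₂).const_mul s)
    change ∀ᵐ y ∂(volume.restrict (Set.Icc y₁ y₂)), _
    rw [ae_restrict_iff' measurableSet_Icc]
    filter_upwards [ae_Icc_of_ae_omega h] with y hy hm
    exact hy (Set.Icc_subset_Icc h₁.1 h₂.2 hm) hm
  simpa [mul_comm] using this

/-- Existence, uniqueness and location of the root of a perturbed function near a simple root. -/
theorem exists_unique_root {z g z_h dz_h : ℝ → ℝ} (hz : MemV z g) (hzh : MemV z_h dz_h)
    {c R σ s ε : ℝ} (hR : 0 < R) (hσ : 0 < σ) (hs : |s| = 1)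
    (hball : Metric.closedBall c R ⊆ Omega) (hzc : z c = 0)
    (hg : ∀ y ∈ Metric.ball c R, σ ≤ s * g y)
    (hdz : ∀ᵐ x ∂volOmega, |g x - dz_h x| ≤ σ / 2)
    (hε : ∀ x ∈ Set.Icc (0 : ℝ) 1, |z x - z_h x| ≤ ε) (hεR : ε < σ * R / 2) :
    ∃ ρ ∈ Metric.ball c R, z_h ρ = 0 ∧ (∀ y ∈ Metric.ball c R, z_h y = 0 → y = ρ) ∧
      |c - ρ| ≤ ε / σ := by
  have hI : Metric.ball c R ⊆ Set.Icc 0 1 :=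
    Metric.ball_subset_closedBall.trans (hball.trans Set.Ioo_subset_Icc_self)
  have hconv : ∀ y₁ ∈ Metric.ball c R, ∀ y₂ ∈ Metric.ball c R, Set.Icc y₁ y₂ ⊆ Metric.ball c R :=
    fun y₁ h₁ y₂ h₂ => (convex_ball c R).ordConnected.out h₁ h₂
  have hzinc : ∀ y₁ ∈ Metric.ball c R, ∀ y₂ ∈ Metric.ball c R, y₁ ≤ y₂ →
      σ * (y₂ - y₁) ≤ s * (z y₂ - z y₁) := by
    intro y₁ h₁ y₂ h₂ h₁₂
    rw [hz.eqOn_primitive (hI h₁), hz.eqOn_primitive (hI h₂)]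
    exact mul_le_primitive_sub hz.integrable_deriv (hI h₁) (hI h₂) h₁₂
      (Eventually.of_forall fun y hy => hg y (hconv _ h₁ _ h₂ hy))
  -- Half of the slope `σ` survives the perturbation of the derivative; this gives uniqueness of the
  -- root.
  have hzhinc : ∀ y₁ ∈ Metric.ball c R, ∀ y₂ ∈ Metric.ball c R, y₁ ≤ y₂ →
      σ / 2 * (y₂ - y₁) ≤ s * (z_h y₂ - z_h y₁) := by
    intro y₁ h₁ y₂ h₂ h₁₂
    rw [hzh.eqOn_primitive (hI h₁), hzh.eqOn_primitive (hI h₂)]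
    apply mul_le_primitive_sub hzh.integrable_deriv (hI h₁) (hI h₂) h₁₂
    filter_upwards [hdz] with y hy hm
    have h3 := hg y (hconv _ h₁ _ h₂ hm)
    have h4 : |s * (g y - dz_h y)| ≤ σ / 2 := by rw [abs_mul, hs, one_mul]; exact hy
    have h5 := (abs_le.1 h4).2
    linarith
  have hc : c ∈ Metric.ball c R := Metric.mem_ball_self hR
  have hl : c - R / 2 ∈ Metric.ball c R := by
    rw [Metric.mem_ball, Real.dist_eq, abs_lt]; constructor <;> linarith
  have hr : c + R / 2 ∈ Metric.ball c R := by
    rw [Metric.mem_ball, Real.dist_eq, abs_lt]; constructor <;> linarith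
  have hsε : ∀ y ∈ Metric.ball c R, |s * z y - s * z_h y| ≤ ε := by
    intro y hy
    rw [← mul_sub, abs_mul, hs, one_mul]
    exact hε y (hI hy)
  -- At distance `R / 2` from its root, `s z` has size at least `σ R / 2`, which exceeds `ε`; so
  -- `z_h` keeps the sign of `z` there.
  have hneg : s * z_h (c - R / 2) ≤ 0 := by
    have h1 := hzinc _ hl _ hc (by linarith)
    have h2 := (abs_le.1 (hsε _ hl)).1
    rw [hzc] at h1
    nlinarith
  have hpos : 0 ≤ s * z_h (c + R / 2) := by
    have h1 := hzinc _ hc _ hr (by linarith)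
    have h2 := (abs_le.1 (hsε _ hr)).2
    rw [hzc] at h1
    nlinarith
  have hcont : ContinuousOn (fun y => s * z_h y) (Set.Icc (c - R / 2) (c + R / 2)) :=
    continuousOn_const.mul (hzh.continuousOn.mono ((hconv _ hl _ hr).trans hI))
  obtain ⟨ρ, hρ, hρ0⟩ := intermediate_value_Icc (by linarith) hcont ⟨hneg, hpos⟩
  have hs0 : s ≠ 0 := by
    intro h0; rw [h0, abs_zero] at hs; exact zero_ne_one hs
  have hρ0' : z_h ρ = 0 := (mul_eq_zero.1 hρ0).resolve_left hs0
  have hρb : ρ ∈ Metric.ball c R := hconv _ hl _ hr hρ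
  refine ⟨ρ, hρb, hρ0', fun y hy hy0 => ?_, ?_⟩
  · rcases le_total y ρ with h | h
    · have := hzhinc y hy ρ hρb h
      rw [hρ0', hy0, sub_zero, mul_zero] at this
      nlinarith
    · have := hzhinc ρ hρb y hy h
      rw [hρ0', hy0, sub_zero, mul_zero] at this
      nlinarith
  -- The location uses the full slope of `z`: `σ |c - ρ| ≤ |z ρ| = |z ρ - z_h ρ| ≤ ε`.
  · have h2 := hsε ρ hρb
    rw [hρ0', mul_zero, sub_zero] at h2
    have h3 := abs_le.1 h2
    rw [le_div_iff₀ hσ]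
    rcases le_total c ρ with h | h
    · have := hzinc c hc ρ hρb h
      rw [hzc, sub_zero] at this
      rw [abs_of_nonpos (by linarith)]
      linarith
    · have := hzinc ρ hρb c hc h
      rw [hzc, zero_sub] at this
      rw [abs_of_nonneg (by linarith)]
      linarith

end roots

/-! ### Comparison of step functions with nearby jumps. -/

section step

variable {m : ℕ}

theorem stepFun_eq {a₀ : ℝ} {c x : Fin m → ℝ} {t : ℝ} (ht : t ∈ Omega) :
    stepFun a₀ c x t = a₀ + ∑ i, c i * (Set.Ioi (x i)).indicator (fun _ => 1) t := by
  unfold stepFun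
  congr 1
  refine Finset.sum_congr rfl fun i _ => ?_
  congr 1
  simp only [Set.indicator_apply, Set.mem_Ioo, Set.mem_Ioi, ht.2, and_true]

theorem memLp_stepFun (a₀ : ℝ) (c x : Fin m → ℝ) : MemLp (stepFun a₀ c x) 1 volOmega := by
  have : stepFun a₀ c x = fun t => a₀ + ∑ i, (Set.Ioo (x i) 1).indicator (fun _ => c i) t := by
    ext t
    unfold stepFun
    congr 1
    refine Finset.sum_congr rfl fun i _ => ?_
    by_cases h : t ∈ Set.Ioo (x i) 1 <;> simp [h]
  rw [this]
  exact (memLp_const a₀).add (memLp_finsetSum _ fun i _ =>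
    (memLp_const (c i)).indicator measurableSet_Ioo)

theorem integral_stepFun_mul {a₀ : ℝ} {c x : Fin m → ℝ} (hx : ∀ i, x i ∈ Omega) {w : ℝ → ℝ}
    (hw : IntegrableOn w Omega) : ∫ t in Omega, stepFun a₀ c x t * w t =
      a₀ * primitive w 1 + ∑ i, c i * (primitive w 1 - primitive w (x i)) := by
  have e : ∫ t in Omega, stepFun a₀ c x t * w t =
      ∫ t in Omega, (a₀ * w t + ∑ i, c i * (Set.Ioi (x i)).indicator w t) := by
    apply setIntegral_congr_fun measurableSet_Ioo
    intro t ht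
    simp only [stepFun_eq ht, add_mul, Finset.sum_mul]
    congr 1
    refine Finset.sum_congr rfl fun i _ => ?_
    by_cases h : t ∈ Set.Ioi (x i) <;> simp [h]
  have hi : ∀ i, IntegrableOn (fun t => c i * (Set.Ioi (x i)).indicator w t) Omega :=
    fun i => Integrable.const_mul (hw.indicator measurableSet_Ioi) _
  rw [e, integral_add (hw.const_mul a₀) (integrable_finsetSum _ fun i _ => hi i),
    integral_const_mul, ← primitive_one, integral_finsetSum _ fun i _ => hi i]
  congr 1
  refine Finset.sum_congr rfl fun i _ => ?_
  rw [integral_const_mul, setIntegral_indicator_Ioi hw (hx i)]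

/-- Jumps with the same index are compared: their indicators differ only between `x i` and `y i`,
where the error is weighted with the perturbed height `d i`. -/
theorem integral_abs_stepFun_sub_le (a₀ a₁ : ℝ) (c d x y : Fin m → ℝ) :
    ∫ t in Omega, |stepFun a₁ d y t - stepFun a₀ c x t| ≤
      |a₀ - a₁| + ∑ i, (|c i - d i| + |d i| * |x i - y i|) := by
  have hU : ∀ i, IntegrableOn ((Set.uIoc (x i) (y i)).indicator fun _ => (1 : ℝ)) Omega :=
    fun i => (integrable_const (1 : ℝ)).indicator measurableSet_uIoc
  have hi : ∀ i, IntegrableOn (fun t => |c i - d i|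
      + |d i| * (Set.uIoc (x i) (y i)).indicator (fun _ => (1 : ℝ)) t) Omega :=
    fun i => (integrable_const _).add ((hU i).const_mul _)
  have hpt : ∀ t ∈ Omega, |stepFun a₁ d y t - stepFun a₀ c x t| ≤ |a₀ - a₁| +
      ∑ i, (|c i - d i| + |d i| * (Set.uIoc (x i) (y i)).indicator (fun _ => (1 : ℝ)) t) := by
    intro t ht
    rw [stepFun_eq ht, stepFun_eq ht, add_sub_add_comm, ← Finset.sum_sub_distrib]
    refine (abs_add_le _ _).trans (add_le_add (abs_sub_comm _ _).le ?_)
    refine (Finset.abs_sum_le_sum_abs _ _).trans (Finset.sum_le_sum fun i _ => ?_)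
    have n1 := abs_nonneg (c i - d i)
    have n2 := abs_nonneg (d i)
    by_cases h1 : t ∈ Set.Ioi (x i) <;> by_cases h2 : t ∈ Set.Ioi (y i)
    · have hm : t ∉ Set.uIoc (x i) (y i) := fun h => by
        rcases Set.mem_uIoc.1 h with h | h
        · exact not_lt.2 h.2 h2
        · exact not_lt.2 h.2 h1
      simp [h1, h2, hm, abs_sub_comm]
    · have hm : t ∈ Set.uIoc (x i) (y i) := Set.mem_uIoc.2 (Or.inl ⟨h1, not_lt.1 h2⟩)
      simp only [Set.indicator_of_mem h1, Set.indicator_of_notMem h2, Set.indicator_of_mem hm,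
        mul_zero, mul_one, zero_sub, abs_neg]
      have := abs_add_le (c i - d i) (d i)
      simpa using this
    · have hm : t ∈ Set.uIoc (x i) (y i) := Set.mem_uIoc.2 (Or.inr ⟨h2, not_lt.1 h1⟩)
      simp only [Set.indicator_of_notMem h1, Set.indicator_of_mem h2, Set.indicator_of_mem hm,
        mul_zero, mul_one, sub_zero]
      linarith
    · have hm : t ∉ Set.uIoc (x i) (y i) := fun h => by
        rcases Set.mem_uIoc.1 h with h | h
        · exact h1 h.1
        · exact h2 h.1
      simp [h1, h2, hm]
  have hL : IntegrableOn (fun t => |stepFun a₁ d y t - stepFun a₀ c x t|) Omega :=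
    ((memLp_one_iff_integrable.1 (memLp_stepFun a₁ d y)).sub
      (memLp_one_iff_integrable.1 (memLp_stepFun a₀ c x))).abs
  have hR : IntegrableOn (fun t => |a₀ - a₁| + ∑ i, (|c i - d i|
      + |d i| * (Set.uIoc (x i) (y i)).indicator (fun _ => (1 : ℝ)) t)) Omega :=
    (integrable_const _).add (integrable_finsetSum _ fun i _ => hi i)
  refine (setIntegral_mono_on hL hR measurableSet_Ioo hpt).trans ?_
  rw [integral_add (integrable_const _) (integrable_finsetSum _ fun i _ => hi i),
    integral_finsetSum _ fun i _ => hi i]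
  refine add_le_add (by simp) (Finset.sum_le_sum fun i _ => ?_)
  rw [integral_add (integrable_const _) ((hU i).const_mul _), integral_const_mul]
  refine add_le_add (by simp) (mul_le_mul_of_nonneg_left ?_ (abs_nonneg _))
  rw [integral_indicator_const _ measurableSet_uIoc, smul_eq_mul, mul_one]
  have h1 : volOmega.real (Set.uIoc (x i) (y i)) ≤ volume.real (Set.uIoc (x i) (y i)) :=
    ENNReal.toReal_mono (by simp [Set.uIoc]) (Measure.restrict_apply_le _ _)
  refine h1.trans (le_of_eq ?_)
  rw [Set.uIoc, Real.volume_real_Ioc_of_le min_le_max, max_sub_min_eq_abs, abs_sub_comm]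

open Filter Topology in
/-- Step functions with nearby jumps are compared by testing with finitely many functions. -/
theorem exists_stepFun_compare {x : Fin m → ℝ} (hinj : Function.Injective x)
    (hx : ∀ i, x i ∈ Omega) (a₀ : ℝ) (c : Fin m → ℝ) {K : ℝ} (hK : 0 ≤ K) :
    ∃ (C : ℝ) (w : Option (Fin m) → ℝ → ℝ), 0 ≤ C ∧ (∀ k, IsTest (w k)) ∧
      ∀ (a₁ : ℝ) (d y : Fin m → ℝ) (X : ℝ), 0 ≤ X → (∀ i, |d i| ≤ K) → (∀ i, y i ∈ Omega) →
        (∀ i, |x i - y i| ≤ X) →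
        (∀ k, |∫ t in Omega, (stepFun a₁ d y t - stepFun a₀ c x t) * w k t| ≤ X) →
        ∑ i, |c i - d i| ≤ C * X ∧ |a₀ - a₁| ≤ C * X ∧
          ∫ t in Omega, |stepFun a₁ d y t - stepFun a₀ c x t| ≤ C * X := by
  -- Bumps dual to the unperturbed jump points. Pairing a step function with `W i'` kills its
  -- constant and evaluates its jump measure at `-W i`, so these tests isolate the heights one by
  -- one.
  have hbump : ∀ i, ∃ W : ℝ → ℝ, IsTest W ∧ W (x i) = 1 ∧ ∀ j, j ≠ i → W (x j) = 0 := by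
    intro i
    have e1 : ∀ᶠ r in 𝓝[>] (0 : ℝ), Metric.closedBall (x i) r ⊆ Omega :=
      eventually_closedBall (isOpen_Ioo.mem_nhds (hx i))
    have e2 : ∀ᶠ r in 𝓝[>] (0 : ℝ), ∀ j, j ≠ i → x j ∉ Metric.ball (x i) r := by
      rw [eventually_all]; intro j
      by_cases hij : j = i
      · exact Eventually.of_forall fun r h => absurd hij h
      · filter_upwards [Ioo_mem_nhdsGT (dist_pos.2 (hinj.ne hij))] with r hr _ hm
        exact absurd (Metric.mem_ball.1 hm) (not_lt.2 hr.2.le)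
    obtain ⟨r, ⟨h1, h2⟩, h0⟩ := ((e1.and e2).and self_mem_nhdsWithin).exists
    obtain ⟨W, hW, hW1, -, hW0⟩ := exists_isTest_bump h0 h1
    exact ⟨W, hW, hW1, fun j hj => hW0 _ (h2 j hj)⟩
  choose W hW hW1 hW0 using hbump
  obtain ⟨χ, hχ, hχ1⟩ := exists_isTest_integral_one
  choose L hL0 hL using fun i => (hW i).exists_lipschitz
  obtain ⟨B, hB0, hB⟩ := hχ.exists_bound
  -- For each `i`, `1` comes from the test itself and `K * L i`, summed over the jumps, from moving
  -- the evaluation points from `y j` to `x j`.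
  set C₁ := ∑ i, (1 + ∑ _j : Fin m, K * L i) with hC₁
  have hC₁0 : 0 ≤ C₁ := Finset.sum_nonneg fun i _ =>
    add_nonneg zero_le_one (Finset.sum_nonneg fun j _ => mul_nonneg hK (hL0 i))
  set C₂ := 1 + C₁ * B + ∑ _j : Fin m, K * B with hC₂
  have hKB : 0 ≤ ∑ _j : Fin m, K * B := Finset.sum_nonneg fun j _ => mul_nonneg hK hB0
  have hKs : 0 ≤ ∑ _j : Fin m, K := Finset.sum_nonneg fun j _ => hK
  have hC₂0 : 0 ≤ C₂ := by positivity
  refine ⟨C₁ + C₂ + ∑ _j : Fin m, K, fun k => k.elim χ fun i => deriv (W i), by positivity,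
    fun k => ?_, ?_⟩
  · cases k with
    | none => exact hχ
    | some i => exact (hW i).mk_deriv
  intro a₁ d y X hX hd hy hxy htest
  have hsub : ∀ {w : ℝ → ℝ}, IsTest w →
      ∫ t in Omega, (stepFun a₁ d y t - stepFun a₀ c x t) * w t =
      (a₁ * primitive w 1 + ∑ i, d i * (primitive w 1 - primitive w (y i))) -
        (a₀ * primitive w 1 + ∑ i, c i * (primitive w 1 - primitive w (x i))) := by
    intro w hw
    have hwc := hw.smooth.continuous.continuousOn (s := Set.Icc (0 : ℝ) 1)
    rw [← integral_stepFun_mul hy hw.integrable, ← integral_stepFun_mul hx hw.integrable,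
      ← integral_sub
        (integrableOn_mul_continuousOn (memLp_one_iff_integrable.1 (memLp_stepFun a₁ d y)) hwc)
        (integrableOn_mul_continuousOn (memLp_one_iff_integrable.1 (memLp_stepFun a₀ c x)) hwc)]
    simp_rw [sub_mul]
  have hc : ∀ i, |c i - d i| ≤ (1 + ∑ _j : Fin m, K * L i) * X := by
    intro i
    have h1 := htest (some i)
    simp only [Option.elim] at h1
    rw [hsub (hW i).mk_deriv] at h1
    simp only [(hW i).primitive_deriv, (hW i).eq_zero (x := 1) (by simp), mul_zero, zero_add,
      zero_sub, mul_neg] at h1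
    have e1 : ∀ b : Fin m → ℝ, ∑ j, b j * W i (x j) = b i := by
      intro b
      rw [Finset.sum_eq_single i (fun j _ hj => by rw [hW0 i j hj, mul_zero]) (by simp), hW1,
        mul_one]
    rw [Finset.sum_neg_distrib, Finset.sum_neg_distrib, e1 c] at h1
    have h2 : |∑ j, d j * (W i (x j) - W i (y j))| ≤ (∑ _j : Fin m, K * L i) * X := by
      rw [Finset.sum_mul]
      refine (Finset.abs_sum_le_sum_abs _ _).trans (Finset.sum_le_sum fun j _ => ?_)
      rw [abs_mul, mul_assoc]
      exact mul_le_mul (hd j) ((hL i _ _).trans (mul_le_mul_of_nonneg_left (hxy j) (hL0 i)))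
        (abs_nonneg _) hK
    simp_rw [mul_sub] at h2
    rw [Finset.sum_sub_distrib, e1 d] at h2
    have e2 : c i - d i = (-∑ j, d j * W i (y j) - -c i)
        - (d i - ∑ j, d j * W i (y j)) := by ring
    rw [e2]
    refine (abs_sub _ _).trans ((add_le_add h1 h2).trans (le_of_eq ?_))
    ring
  have hcs : ∑ i, |c i - d i| ≤ C₁ * X := by
    rw [hC₁, Finset.sum_mul]
    exact Finset.sum_le_sum fun i _ => hc i
  have hpl : ∀ s ∈ Set.Icc (0 : ℝ) 1, ∀ t ∈ Set.Icc (0 : ℝ) 1,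
      |primitive χ t - primitive χ s| ≤ B * |t - s| := by
    intro s hs t ht
    rw [primitive_sub_primitive hχ.integrable hs ht]
    exact abs_integral_sub_le (Eventually.of_forall hB) hs ht
  -- With the heights under control, the test function `χ` of integral one recovers the constant.
  have ha : |a₀ - a₁| ≤ C₂ * X := by
    have h1 := htest none
    simp only [Option.elim] at h1
    rw [hsub hχ] at h1
    have hp1 : primitive χ 1 = 1 := by rw [primitive_one, hχ1]
    have h3 : |∑ i, d i * (primitive χ 1 - primitive χ (y i))
        - ∑ i, c i * (primitive χ 1 - primitive χ (x i))| ≤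
        C₁ * X * B + (∑ _j : Fin m, K * B) * X := by
      rw [← Finset.sum_sub_distrib]
      calc |∑ i, (d i * (primitive χ 1 - primitive χ (y i))
            - c i * (primitive χ 1 - primitive χ (x i)))| ≤
            ∑ i, (|c i - d i| * B + K * B * X) := by
            refine (Finset.abs_sum_le_sum_abs _ _).trans (Finset.sum_le_sum fun i _ => ?_)
            have hxi := Set.Ioo_subset_Icc_self (hx i)
            have hyi := Set.Ioo_subset_Icc_self (hy i)
            have e3 : d i * (primitive χ 1 - primitive χ (y i))
                - c i * (primitive χ 1 - primitive χ (x i)) =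
                d i * (primitive χ (x i) - primitive χ (y i))
                - (c i - d i) * (primitive χ 1 - primitive χ (x i)) := by ring
            rw [e3]
            refine (abs_sub _ _).trans ?_
            rw [abs_mul, abs_mul, add_comm]
            refine add_le_add (mul_le_mul_of_nonneg_left ?_ (abs_nonneg _)) ?_
            · refine (hpl _ hxi 1 (by simp)).trans (mul_le_of_le_one_right hB0 ?_)
              rw [abs_of_nonneg (by linarith [hxi.2])]
              linarith [hxi.1]
            · rw [mul_assoc]
              exact mul_le_mul (hd i)
                ((hpl _ hyi _ hxi).trans (mul_le_mul_of_nonneg_left (hxy i) hB0))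
                (abs_nonneg _) hK
        _ = (∑ i, |c i - d i|) * B + (∑ _j : Fin m, K * B) * X := by
            rw [Finset.sum_add_distrib, Finset.sum_mul, Finset.sum_mul]
        _ ≤ _ := by
            have := mul_le_mul_of_nonneg_right hcs hB0
            linarith
    rw [hp1] at h1 h3
    set P := ∑ i, d i * (1 - primitive χ (y i))
    set Q := ∑ i, c i * (1 - primitive χ (x i))
    have e2 : a₀ - a₁ = -(a₁ * 1 + P - (a₀ * 1 + Q)) + (P - Q) := by ring
    rw [e2]
    refine (abs_add_le _ _).trans ?_
    rw [abs_neg]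
    refine (add_le_add h1 h3).trans (le_of_eq ?_)
    rw [hC₂]; ring
  refine ⟨hcs.trans (mul_le_mul_of_nonneg_right (by linarith) hX),
    ha.trans (mul_le_mul_of_nonneg_right (by linarith) hX), ?_⟩
  refine (integral_abs_stepFun_sub_le a₀ a₁ c d x y).trans ?_
  rw [Finset.sum_add_distrib]
  have h6 : ∑ i, |d i| * |x i - y i| ≤ (∑ _j : Fin m, K) * X := by
    rw [Finset.sum_mul]
    exact Finset.sum_le_sum fun i _ => mul_le_mul (hd i) (hxy i) (abs_nonneg _) hK
  linarith

end step

end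

end BVControl
-- Assembly of the estimates.
namespace BVControl

noncomputable section

open Filter Topology

/-- Links the classical derivative in the nondegeneracy hypothesis to the continuous weak derivative
of the analysis. -/
theorem MemV.deriv_eq {z g : ℝ → ℝ} (hz : MemV z g) (hg : ContinuousOn g (Set.Icc 0 1)) {y : ℝ}
    (hy : y ∈ Omega) : deriv z y = g y := by
  have he : z =ᶠ[𝓝 y] primitive g := by
    filter_upwards [Icc_mem_nhds hy.1 hy.2] with t ht
    exact hz.eqOn_primitive ht
  rw [he.deriv_eq]
  exact (hasDerivAt_primitive hg hy).deriv

theorem abs_primitive_sub_le {z z_h : ℝ → ℝ} (hz : ContinuousOn z (Set.Icc 0 1))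
    (hzh : ContinuousOn z_h (Set.Icc 0 1)) {ε : ℝ} (hε0 : 0 ≤ ε)
    (hε : ∀ x ∈ Set.Icc (0 : ℝ) 1, |z x - z_h x| ≤ ε) {y : ℝ} (hy : y ∈ Set.Icc (0 : ℝ) 1) :
    |primitive z y - primitive z_h y| ≤ ε := by
  have h0 : (0 : ℝ) ∈ Set.Icc (0 : ℝ) 1 := by simp
  have e : primitive z y - primitive z_h y = ∫ s in (0 : ℝ)..y, (z s - z_h s) :=
    (intervalIntegral.integral_sub (intervalIntegrable_of_omega (continuousOn_integrableOn hz) h0 hy)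
      (intervalIntegrable_of_omega (continuousOn_integrableOn hzh) h0 hy)).symm
  rw [e]
  have hb : ∀ᵐ x ∂volOmega, |z x - z_h x| ≤ ε := by
    rw [ae_omega_iff]
    exact Eventually.of_forall fun x hx => hε x (Set.Ioo_subset_Icc_self hx)
  refine (abs_integral_sub_le hb h0 hy).trans (mul_le_of_le_one_right hε0 ?_)
  rw [sub_zero, abs_of_nonneg hy.1]
  exact hy.2

/-- The roots of a perturbed adjoint state near the extremal points of the multiplier, and the
location of the extremal points of the perturbed multiplier. -/
theorem exists_roots {α : ℝ} {z g z_h dz_h : ℝ → ℝ} (hz : MemV z g) (hzh : MemV z_h dz_h)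
    {m : ℕ} {x s : Fin m → ℝ} {R σ δ ε : ℝ} (hR : 0 < R) (hσ : 0 < σ) (hs : ∀ i, |s i| = 1)
    (hball : ∀ i, Metric.closedBall (x i) R ⊆ Omega)
    (hdisj : ∀ i j, i ≠ j → Disjoint (Metric.ball (x i) R) (Metric.ball (x j) R))
    (hzx : ∀ i, z (x i) = 0) (hg : ∀ i, ∀ y ∈ Metric.ball (x i) R, σ ≤ s i * g y)
    (hout : ∀ y ∈ Set.Icc (0 : ℝ) 1, (∀ i, y ∉ Metric.ball (x i) R) → |primitive z y| ≤ α - δ)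
    (hdz : ∀ᵐ y ∂volOmega, |g y - dz_h y| ≤ σ / 2) (hε0 : 0 ≤ ε)
    (hε : ∀ y ∈ Set.Icc (0 : ℝ) 1, |z y - z_h y| ≤ ε) (hεR : ε < σ * R / 2) (hεδ : ε < δ)
    (hle : ∀ y ∈ Omega, |primitive z_h y| ≤ α) :
    ∃ x_h : Fin m → ℝ, Function.Injective x_h ∧
      (∀ i, x_h i ∈ Metric.ball (x i) R ∧ z_h (x_h i) = 0 ∧
        ∀ y ∈ Metric.ball (x i) R, z_h y = 0 → y = x_h i) ∧
      (∀ i, |x i - x_h i| ≤ ε / σ) ∧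
      ∀ y ∈ Omega, |primitive z_h y| = α → y ∈ Set.range x_h := by
  choose ρ hρ hρ0 hρu hρd using fun i => exists_unique_root hz hzh hR hσ (hs i) (hball i) (hzx i)
    (hg i) hdz hε hεR
  refine ⟨ρ, fun i j hij => ?_, fun i => ⟨hρ i, hρ0 i, hρu i⟩, hρd, fun y hy hyα => ?_⟩
  · by_contra hne
    exact Set.disjoint_left.1 (hdisj i j hne) (hρ i) (by rw [hij]; exact hρ j)
  · have hyI := Set.Ioo_subset_Icc_self hy
    -- Inside a ball, an extremal point of the perturbed multiplier is a root of `z_h`, hence the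
    -- only one. Outside, the margin `δ > ε` excludes it.
    by_cases hb : ∃ i, y ∈ Metric.ball (x i) R
    · obtain ⟨i, hi⟩ := hb
      exact ⟨i, (hρu i y hi (eq_zero_of_abs_primitive_eq hzh.continuousOn hle hy hyα)).symm⟩
    · have h1 := hout y hyI (not_exists.1 hb)
      have h2 := abs_primitive_sub_le hz.continuousOn hzh.continuousOn hε0 hε hyI
      have h3 := abs_sub_abs_le_abs_sub (primitive z_h y) (primitive z y)
      rw [abs_sub_comm] at h3
      linarith

/-- If `E` exceeded the bound, it would be at least `t`, and the right-hand side at most `(A + B) t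
E < E²`. Used twice, with `t = h` and then with `t = h²`. -/
theorem le_of_sq_le {A B t E : ℝ} (hA : 0 ≤ A) (hB : 0 ≤ B) (ht : 0 < t)
    (h : E ^ 2 ≤ A * t ^ 2 + B * t * E) : E ≤ (A + B + 1) * t := by
  by_contra! hlt
  have h1 : t ≤ E := by nlinarith [mul_nonneg (add_nonneg hA hB) ht.le]
  have h2 : A * t ^ 2 ≤ A * t * E := by
    rw [pow_two, ← mul_assoc]
    exact mul_le_mul_of_nonneg_left h1 (mul_nonneg hA ht.le)
  have h3 : (A + B + 1) * t * E ≤ E * E :=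
    mul_le_mul_of_nonneg_right hlt.le (ht.le.trans h1)
  have h4 : 0 < t * E := mul_pos ht (ht.trans_le h1)
  nlinarith

theorem eLpNorm_one_le {f g : ℝ → ℝ} (hf : IntegrableOn f Omega) (hg : IntegrableOn g Omega)
    {B : ℝ} (h : ∫ x in Omega, |g x - f x| ≤ B) :
    eLpNorm (f - g) 1 volOmega ≤ ENNReal.ofReal B := by
  rw [eLpNorm_one_eq_lintegral_enorm, ← ofReal_integral_norm_eq_lintegral_enorm (hf.sub hg)]
  apply ENNReal.ofReal_le_ofReal
  refine le_trans (le_of_eq ?_) h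
  congr 1
  ext x
  rw [Real.norm_eq_abs, Pi.sub_apply, abs_sub_comm]

theorem eLpNorm_top_le {f g : ℝ → ℝ} {B : ℝ} (h : ∀ x ∈ Set.Icc (0 : ℝ) 1, |f x - g x| ≤ B) :
    eLpNorm (f - g) ⊤ volOmega ≤ ENNReal.ofReal B := by
  rw [eLpNorm_exponent_top]
  apply eLpNormEssSup_le_of_ae_bound
  rw [ae_omega_iff]
  exact Eventually.of_forall fun x hx => h x (Set.Ioo_subset_Icc_self hx)

end

end BVControl

open Filter Topology BVControl in
theorem mainTheorem2 (α : ℝ) (a d₀ u_d : ℝ → ℝ) (hdata : BVControl.IsData α a d₀ u_d)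
    (q u z : ℝ → ℝ)
    (hopt : BVControl.IsOptimal BVControl.MemV α a d₀ u_d q u)
    (hadj : BVControl.IsAdjoint BVControl.MemV a d₀ u_d u z)
    (m : ℕ) (x : Fin m → ℝ) (hinj : Function.Injective x)
    (hset : {y ∈ BVControl.Omega | |BVControl.multiplier z y| = α} = Set.range x)
    (hderiv : ∀ i, deriv z (x i) ≠ 0) :
    ∃ R C h₀ a₀ : ℝ, ∃ c : Fin m → ℝ, 0 < R ∧ 0 < C ∧ 0 < h₀ ∧
      (∀ i, Metric.ball (x i) R ⊆ BVControl.Omega) ∧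
      (∀ i j, i ≠ j → Disjoint (Metric.ball (x i) R) (Metric.ball (x j) R)) ∧
      q =ᵐ[BVControl.volOmega] BVControl.stepFun a₀ c x ∧
      ∀ M : BVControl.Mesh, M.width ≤ h₀ → ∀ q_h u_h z_h : ℝ → ℝ,
        BVControl.IsOptimal (BVControl.MemVh M) α a d₀ u_d q_h u_h →
        BVControl.IsAdjoint (BVControl.MemVh M) a d₀ u_d u_h z_h →
        ∃ (a_h : ℝ) (c_h x_h : Fin m → ℝ),
          (∀ i, x_h i ∈ Metric.ball (x i) R ∧ z_h (x_h i) = 0 ∧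
            ∀ y ∈ Metric.ball (x i) R, z_h y = 0 → y = x_h i) ∧
          q_h =ᵐ[BVControl.volOmega] BVControl.stepFun a_h c_h x_h ∧
          ∑ i, |x i - x_h i| ≤ C * M.width ^ 2 ∧
          ∑ i, |c i - c_h i| ≤ C * M.width ^ 2 ∧
          |a₀ - a_h| ≤ C * M.width ^ 2 ∧
          MeasureTheory.eLpNorm (q - q_h) 1 BVControl.volOmega
            ≤ ENNReal.ofReal (C * M.width ^ 2) ∧
          MeasureTheory.eLpNorm (z - z_h) ⊤ BVControl.volOmega
            ≤ ENNReal.ofReal (C * M.width ^ 2) := by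
  have hα := hdata.alpha_pos
  have hmem : ∀ y, (y ∈ Omega ∧ |primitive z y| = α) ↔ ∃ i, x i = y := fun y => by
    rw [← Set.mem_range, ← hset]; rfl
  have hx : ∀ i, x i ∈ Omega := fun i => ((hmem (x i)).2 ⟨i, rfl⟩).1
  obtain ⟨μ, hq, hu, hmin⟩ := hopt
  have hst : IsStationary α z q μ := fun q₁ μ₁ h₁ =>
    IsOptimal.variational_inequality hdata hdata.isStateSpace_memV hq hu hmin hadj h₁
  obtain ⟨g, C₀, hC₀, hg, hz, hkey⟩ := hdata.exists_key_estimate hq hu hadj hst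
  obtain ⟨C₁, h₁, hC₁, hh₁, hapr⟩ := hdata.exists_apriori
  have hle : ∀ y ∈ Omega, |primitive z y| ≤ α := fun y hy =>
    hst.abs_primitive_le hα hq hz.continuousOn hy
  have hzx : ∀ i, z (x i) = 0 := fun i =>
    eq_zero_of_abs_primitive_eq hz.continuousOn hle (hx i) ((hmem (x i)).2 ⟨i, rfl⟩).2
  obtain ⟨R, σ, δ, s, hR, hσ, hδ, hs, hball, hdisj, hgσ, hout⟩ := exists_radius hα hz hg
    (hst.primitive_one hq) hle hinj hmem fun i => by
      rw [← hz.deriv_eq hg (hx i)]; exact hderiv i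
  obtain ⟨a₀, hqs⟩ := hst.ae_eq_stepFun hα hq hz.continuousOn hinj
    fun y hy hyα => (hmem y).1 ⟨hy, hyα⟩
  set c : Fin m → ℝ := fun i => μ {x i}
  -- The bound for the discrete jump heights is the a priori bound for the total variation of `q_h`.
  obtain ⟨C₂, w, hC₂, hw, hcmp⟩ := exists_stepFun_compare hinj hx a₀ c hC₁
  choose Cw hCw hpair using fun k => hdata.exists_pairing_estimate (hw k)
  set N₀ := C₁ + ∫ y in Omega, |q y|
  have hN₀ : 0 ≤ N₀ := add_nonneg hC₁ (integral_nonneg fun y => abs_nonneg _)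
  -- Chosen so that `C₃ (h² + E)` bounds both the displacement of the roots and all the test
  -- pairings.
  set C₃ := C₀ / σ + ∑ k, Cw k * (1 + N₀) with hC₃
  have hCk : ∀ k, 0 ≤ Cw k * (1 + N₀) := fun k => mul_nonneg (hCw k) (by positivity)
  have hCsum : 0 ≤ ∑ k, Cw k * (1 + N₀) := Finset.sum_nonneg fun k _ => hCk k
  have hCσ : 0 ≤ C₀ / σ := by positivity
  have hC₃0 : 0 ≤ C₃ := by positivity
  set C₄ := C₀ * N₀ + C₀ + 1
  have hC₄ : 0 ≤ C₄ := by positivity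
  set C₅ := C₀ * (C₂ * C₃) + (C₀ * (C₂ * C₃) + C₀) + 1
  have hC₅ : 0 ≤ C₅ := by positivity
  -- The closeness of `z_h` to `z` required by `exists_roots`: for the slope, for the sign change
  -- and for the margin. The last two must be strict, hence the smaller fractions.
  set τ := min (σ / 2) (min (σ * R / 4) (δ / 2)) with hτ
  have hτ0 : 0 < τ := by positivity
  have hτ1 : τ ≤ σ / 2 := min_le_left _ _
  have hτ2 : τ ≤ σ * R / 4 := (min_le_right _ _).trans (min_le_left _ _)
  have hτ3 : τ ≤ δ / 2 := (min_le_right _ _).trans (min_le_right _ _)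
  set D := C₀ * (1 + C₄) + 1
  have hD : 0 < D := by positivity
  refine ⟨R, (m * C₃ + C₂ * C₃ + C₀) * (1 + C₅) + 1, min h₁ (τ / D), a₀, c, hR, by positivity,
    by positivity, fun i => Metric.ball_subset_closedBall.trans (hball i), hdisj, hqs, ?_⟩
  intro M hM q_h u_h z_h hopt_h hadj_h
  have hh := M.width_pos
  have hh1 := M.width_le_one
  set h := M.width
  have hsq : h ^ 2 ≤ h := pow_le_of_le_one hh.le hh1 two_ne_zero
  obtain ⟨μ_h, hqh, huh, hmin_h⟩ := hopt_h
  have hst_h : IsStationary α z_h q_h μ_h := fun q₁ μ₁ h₁ =>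
    IsOptimal.variational_inequality hdata (hdata.isStateSpace_memVh M) hqh huh hmin_h hadj_h h₁
  obtain ⟨dz_h, hzh, hzh'⟩ := hadj_h
  obtain ⟨hμ, hqC⟩ := hapr M q_h u_h μ_h (hM.trans (min_le_left _ _)) hqh huh hmin_h
  obtain ⟨e, de, E, hE, he, hes, heE, hE2, hzE, hdzE⟩ :=
    hkey M q_h u_h z_h dz_h μ_h hqh huh hzh hzh' hst_h
  have hf : IntegrableOn (fun y => q_h y - q y) Omega := hqh.integrable.sub hq.integrable
  set N := ∫ y in Omega, |q_h y - q y| with hN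
  have hN0 : 0 ≤ N := integral_nonneg fun y => abs_nonneg _
  have hNN : N ≤ N₀ := by
    have : N ≤ ∫ y in Omega, (|q_h y| + |q y|) :=
      integral_mono hf.abs (hqh.integrable.abs.add hq.integrable.abs) fun y => abs_sub _ _
    rw [integral_add hqh.integrable.abs hq.integrable.abs] at this
    exact this.trans (add_le_add hqC le_rfl)
  -- The preliminary rate, from the mere boundedness of `N`. It suffices to locate the jumps of
  -- `q_h`.
  have hEh : E ≤ C₄ * h := by
    refine le_of_sq_le (mul_nonneg hC₀ hN₀) hC₀ hh (hE2.trans (add_le_add ?_ ?_))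
    · have := mul_le_mul_of_nonneg_left hNN (mul_nonneg hC₀ (sq_nonneg h))
      linarith
    · refine mul_le_mul_of_nonneg_right (mul_le_mul_of_nonneg_left hsq hC₀) hE
  have hDh : D * h ≤ τ := by
    have := hM.trans (min_le_right _ _)
    rwa [le_div_iff₀ hD, mul_comm] at this
  have hhE : h + E ≤ (1 + C₄) * h := by linarith
  have hε1 : C₀ * (h + E) ≤ τ := by
    have := mul_le_mul_of_nonneg_left hhE hC₀
    have h2 : D * h = C₀ * ((1 + C₄) * h) + h := by ring
    linarith
  have hε2 : C₀ * (h ^ 2 + E) ≤ τ := by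
    exact le_trans (mul_le_mul_of_nonneg_left (by linarith) hC₀) hε1
  have hσR : 0 < σ * R := mul_pos hσ hR
  obtain ⟨x_h, hinj_h, hroot, hdist, hset_h⟩ := exists_roots hz hzh.1 hR hσ hs hball hdisj hzx hgσ
    hout (hdzE.mono fun y hy => hy.trans (hε1.trans hτ1)) (by positivity) hzE (by linarith)
    (by linarith) fun y hy => hst_h.abs_primitive_le hα hqh hzh.1.continuousOn hy
  obtain ⟨a_h, hqs_h⟩ := hst_h.ae_eq_stepFun hα hqh hzh.1.continuousOn hinj_h hset_h
  set c_h : Fin m → ℝ := fun i => μ_h {x_h i}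
  have hX : 0 ≤ C₃ * (h ^ 2 + E) := by positivity
  have hdX : ∀ i, |x i - x_h i| ≤ C₃ * (h ^ 2 + E) := fun i => by
    refine (hdist i).trans ?_
    rw [mul_div_right_comm]
    exact mul_le_mul_of_nonneg_right (by linarith) (by positivity)
  have hpw : ∀ k, |∫ t in Omega, (q_h t - q t) * w k t| ≤ C₃ * (h ^ 2 + E) := fun k => by
    refine (hpair k M e de _ he hf hes).trans ?_
    have h2 : (∫ t in Omega, |e t|) + h ^ 2 * N ≤ (1 + N₀) * (h ^ 2 + E) := by
      have h3 := mul_le_mul_of_nonneg_left hNN (sq_nonneg h)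
      have h4 := mul_nonneg hN₀ hE
      linarith [sq_nonneg h]
    refine (mul_le_mul_of_nonneg_left h2 (hCw k)).trans ?_
    rw [← mul_assoc]
    have h5 := Finset.single_le_sum (fun k _ => hCk k) (Finset.mem_univ k)
    exact mul_le_mul_of_nonneg_right (by linarith) (by positivity)
  have hdiff : ∀ᵐ t ∂volOmega, q_h t - q t = stepFun a_h c_h x_h t - stepFun a₀ c x t := by
    filter_upwards [hqs, hqs_h] with t h2 h3
    rw [h2, h3]
  obtain ⟨hc, ha, hL⟩ := hcmp a_h c_h x_h (C₃ * (h ^ 2 + E)) hX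
    (fun i => (abs_apply_le_measNorm _ _).trans hμ)
    (fun i => hball i (Metric.ball_subset_closedBall (hroot i).1)) hdX fun k => by
      refine le_of_eq_of_le ?_ (hpw k)
      congr 1
      apply integral_congr_ae
      filter_upwards [hdiff] with t ht
      rw [ht]
  have hNL : N ≤ C₂ * (C₃ * (h ^ 2 + E)) := by
    refine le_of_eq_of_le ?_ hL
    apply integral_congr_ae
    filter_upwards [hdiff] with t ht
    rw [ht]
  -- The bootstrap: with `N = O(h² + E)` the quadratic inequality becomes homogeneous in `h²` and
  -- `E`.
  have hE5 : E ≤ C₅ * h ^ 2 := by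
    refine le_of_sq_le (by positivity) (by positivity) (by positivity) (hE2.trans ?_)
    have := mul_le_mul_of_nonneg_left hNL (mul_nonneg hC₀ (sq_nonneg h))
    refine (add_le_add this le_rfl).trans (le_of_eq ?_)
    ring
  have hhE2 : h ^ 2 + E ≤ (1 + C₅) * h ^ 2 := by linarith
  have hfin : ∀ {B K : ℝ}, 0 ≤ K → K ≤ m * C₃ + C₂ * C₃ + C₀ → B ≤ K * (h ^ 2 + E) →
      B ≤ ((m * C₃ + C₂ * C₃ + C₀) * (1 + C₅) + 1) * h ^ 2 := by
    intro B K hK hKC hB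
    have h2 : K * (h ^ 2 + E) ≤ (m * C₃ + C₂ * C₃ + C₀) * ((1 + C₅) * h ^ 2) :=
      mul_le_mul hKC hhE2 (by positivity) (hK.trans hKC)
    linarith [sq_nonneg h]
  have hm0 : 0 ≤ (m : ℝ) * C₃ := by positivity
  have h23 : 0 ≤ C₂ * C₃ := by positivity
  refine ⟨a_h, c_h, x_h, hroot, hqs_h, hfin hm0 (by linarith) ?_,
    hfin h23 (by linarith) (by rw [mul_assoc]; exact hc),
    hfin h23 (by linarith) (by rw [mul_assoc]; exact ha), ?_, ?_⟩
  · refine (Finset.sum_le_sum fun i _ => hdX i).trans (le_of_eq ?_)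
    simp [mul_assoc]
  · exact eLpNorm_one_le hq.integrable hqh.integrable
      (hfin h23 (by linarith) (by rw [mul_assoc]; exact hNL))
  · exact eLpNorm_top_le fun y hy => hfin hC₀ (by linarith) (hzE y hy)
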